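/- **Lattice and reshaping.** Let $d_j$ ($j\in\mathbb Z/12$) be the unit vector of the plane in direction $15^\circ+30^\circ j$, and let $\Lambda=\sum_j\mathbb Z d_j$, which is free of rank 4 with basis $d_0,d_1,d_2,d_3$. The parity of $d_j$ is that of $j$. Let $\lambda:\Lambda\to\Lambda$ be multiplication by $2+\sqrt3$. The *reshaping* is the additive map $\varphi:\Lambda\to\mathbb Z[i]\subset\mathbb C$ with $\varphi(d_0)=1$, $\varphi(d_1)=1+i$, $\varphi(d_2)=\varphi(d_3)=i$ (hence $\varphi(d_4)=-1+i$, $\varphi(d_5)=-1$). It turns every unit equilateral triangle with edges among the $d_j$ into an isosceles right triangle with legs $1$, the unit squares on $d_1,d_4$ into squares of side $\sqrt2$, and the unit squares on $d_0,d_3$ and on $d_2,d_5$ into unit squares. **Marked triangles.** Corners carry a mark $0$ (white) or $1$ (black). The marked triangles, each an isosceles right triangle with legs $1$, are, up to translation and rotation by $180^\circ$: (i) reshaped equilateral triangles with edges of parity $k\in\{0,1\}$ and marked corners, such that the number of corners whose mark differs from $k$ is not $1$ (10 triangles); (ii) the four pieces into which its two diagonals cut a reshaped square on $d_1,d_4$,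 with marks at the two ends of the hypotenuse (8 triangles); (iii) the two pieces of a reshaped square on $d_0,d_3$ or on $d_2,d_5$, cut along a diagonal, with three marked corners (16 triangles). In (iii) fix $\delta\in\{0,1\}$: for $\delta=0$ the cuts join the ends of $d_0+d_3$, respectively of $d_2+d_5$; for $\delta=1$ they are the other diagonals. These are 34 marked triangles; reflection in a vertical axis together with exchanging white and black groups them into 17 pairs. **Rules.** Fix also $\varepsilon\in\{0,1\}$. In the unreshaped lattice picture, a corner at $v$ with mark $c$ is replaced by a dodecagonal wheel centred at $\lambda v$: six unit triangles around the centre, surrounded alternately by six unit squares (centred in the directions $d_j$ of parity $c$) and six unit triangles (in the other directions). The wheels at the two ends of an edge share an edge; an equilateral triangle contains one further unit triangle between its three wheels, and a square contains one further unit square with a unit triangle on each side between its four wheels. New marks: the six inner vertices of the wheel get $c$; its centre gets $c$ if $\varepsilon=0$ and $1-c$ if $\varepsilon=1$; the two vertices common to the wheels at the ends of an edge in direction $d_j$ with end marks $x,y$ get the opposite of the majority of $x$, $y$, $j\bmod 2$; the vertex of a wheel that is a corner of the further square inside a square gets $1-c$. The tiles of a wheel that straddle an edge belong to the tile on the left of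 this edge (seen from the wheel's centre) if $c=0$, and to that on its right if $c=1$. All new squares are cut into marked triangles as above. The rule of a piece of a square takes the wheel parts on its side of the cutting diagonals, the further triangles at its sides of the square, and the corresponding piece of the further square. Positions are then reshaped by $\varphi$. A triangle rotated by $180^\circ$ is replaced by the rotated patch; no other rotations and no flips are used. Iterating $n$ times from a marked triangle gives its level-$n$ supertile. A tiling of the plane by marked triangles (no gaps, no overlaps) is *generated by the rules* if each of its finite patches is contained in a translate of a supertile. A set of tiles is *aperiodic* if it has no nonzero translational period and, for each vector $v\ne0$, there is an $R$ such that inside no disc of radius $R$ the set has period $v$. **Theorem.** For each choice of $\varepsilon,\delta\in\{0,1\}$: 1. There are 34 rules; the patches of the rules consist of the 34 marked triangles only, and the rules form 17 pairs, in each of which the two different rules are mirror images of each other with white and black exchanged. 2. The rules do not overlap: in each supertile different triangles have disjoint interiors and are replaced by disjoint patches. 3. There is a tiling of the plane generated by the rules. 4. Every tiling of the plane generated by the rules consists of copies of one isosceles right triangle in at most four orientations, is edge-to-edge, and is aperiodic; it remains aperiodic after all marks are erased, that is, as a set of plain triangles. -/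

import Mathlib

namespace OneTriangle

/-! ### Addresses: the edge labels and the reshaping

The square-triangle tiling has unit edges in the twelve directions `15° + 30° j`; opposite
directions carry the same edge label, which gives six labels.  Its vertices are integer
combinations of these unit vectors.  The address `(a, b, c, d)` stands for the combination
`a d₀ + b d₁ + c d₂ + d d₃`, where `d_j` is the unit vector in direction `15° + 30° j`. -/

/-- Vertices of the square-triangle tiling, in the basis `d₀, d₁, d₂, d₃`. -/
abbrev Addr := ℤ × ℤ × ℤ × ℤ

/-- Rotation by 30 degrees of the square-triangle lattice (`d₄ = d₂ - d₀`). -/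
def turn (p : Addr) : Addr :=
  (-p.2.2.2, p.1, p.2.1 + p.2.2.2, p.2.2.1)

/-- The unit edge `d_j` in direction `15° + 30° j` (only `j` modulo 12 matters). -/
def dir (j : ℕ) : Addr := turn^[j] (1, 0, 0, 0)

/-- Multiplication by `2 + √3 = 2 + e^{iπ/6} + e^{-iπ/6}`, the inflation of the square-triangle
tiling. -/
def inflate (p : Addr) : Addr := p + p + turn p + turn^[11] p

/-- The reshaping of edges: the labels at 15° and 165° become horizontal unit edges, those at
75° and 105° vertical unit edges, those at 45° and 135° edges of length `√2` with unchanged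
direction.  So the equilateral triangles become isosceles right triangles with unit legs, the
square at 45° becomes a square with side `√2`, and the two other squares become unit squares. -/
noncomputable def reshape (p : Addr) : ℂ :=
  ((p.1 + p.2.1 : ℤ) : ℂ) + ((p.2.1 + p.2.2.1 + p.2.2.2 : ℤ) : ℂ) * Complex.I

/-! ### Marked triangles

Corners are marked white (`false`) or black (`true`).  There are three families, each in two
colours, exchanged by the mirror image:
* `tri k`: a reshaped equilateral triangle, with edges in directions `j` of parity `k`
  (`k = false`: 15°, 75°, 135°; `k = true`: 45°, 105°, 165°), all three corners marked;
* `quarter k`: one of the four pieces into which its diagonals cut the square of side `√2`,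
  given by a side of the square in direction 135° (`k = false`) or 45° (`k = true`), whose two
  end points are marked;
* `half k`: one of the two pieces of a unit square that comes from the square at 15° and 105°
  (`k = false`) or from that at 75° and 165° (`k = true`), cut along a diagonal, all three
  corners marked, the right angle being at the second one. -/
inductive Kind where
  | tri (k x y z : Bool)
  | quarter (k x y : Bool)
  | half (k x y z : Bool)
  deriving DecidableEq, Fintype

/-- The marked triangles for which there is a rule: in a `tri`, the number of corners whose mark
differs from the parity of the edges is not 1. -/
def Kind.HasRule : Kind → Prop
  | .tri k x y z => (x != k).toNat + (y != k).toNat + (z != k).toNat ≠ 1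
  | _ => True

instance : DecidablePred Kind.HasRule := fun κ => by
  cases κ <;> unfold Kind.HasRule <;> infer_instance

/-- Direction of the first side (from the first corner to the second one) of an unrotated
marked triangle.  `δ` selects along which diagonal the unit squares are cut. -/
def Kind.firstDir (δ : Bool) : Kind → ℕ
  | .tri k _ _ _ => if k then 1 else 0
  | .quarter k _ _ => if k then 1 else 4
  | .half k _ _ _ => (if k then 2 else 0) + (if δ then 3 else 0)

/-- A marked triangle, rotated by 0 (`rot = false`) or 180 degrees (`rot = true`), with the
address of its first corner. -/
structure LTile where
  kind : Kind
  rot : Bool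
  pos : Addr
  deriving DecidableEq

/-- Direction of the first side. -/
def LTile.firstDir (δ : Bool) (t : LTile) : ℕ :=
  t.kind.firstDir δ + (if t.rot then 6 else 0)

/-! The following functions give the placed marked triangle with first corner `p`, first side in
direction `j` and the given marks at the corners, in counterclockwise order. -/

/-- The reshaped equilateral triangle `p, p + d_j, p + d_{j+2}`; any of the corners may be named
first. -/
def mkTri (p : Addr) (j : ℕ) (x y z : Bool) : LTile :=
  let k := decide (j % 2 = 1)
  match j % 12 / 2 with
  | 0 => ⟨.tri k x y z, false, p⟩
  | 3 => ⟨.tri k x y z, true, p⟩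
  | 2 => ⟨.tri k z x y, false, p + dir (j + 2)⟩
  | 5 => ⟨.tri k z x y, true, p + dir (j + 2)⟩
  | 4 => ⟨.tri k y z x, false, p + dir j⟩
  | _ => ⟨.tri k y z x, true, p + dir j⟩

/-- The quarter of the square `p, p + d_j, p + d_j + d_{j+3}, p + d_{j+3}` at its first side
(`j ≡ 1` modulo 3). -/
def mkQuarter (p : Addr) (j : ℕ) (x y : Bool) : LTile :=
  ⟨.quarter (decide (j % 2 = 1)) x y, decide (6 ≤ j % 12), p⟩

/-- The half `p, p + d_j, p + d_j + d_{j+3}` of a square (`j ≡ 0` or `2` modulo 3). -/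
def mkHalf (p : Addr) (j : ℕ) (x y z : Bool) : LTile :=
  ⟨.half (decide (j % 3 = 2)) x y z, decide (6 ≤ j % 12), p⟩

/-- The square `p, p + d_j, p + d_j + d_{j+3}, p + d_{j+3}` with marks `x, y, z, w`, cut into
marked triangles. -/
def mkSquare (δ : Bool) (p : Addr) (j : ℕ) (x y z w : Bool) : List LTile :=
  let p₁ := p + dir j
  let p₂ := p + dir j + dir (j + 3)
  let p₃ := p + dir (j + 3)
  if j % 3 = 1 then
    [mkQuarter p j x y, mkQuarter p₁ (j + 3) y z, mkQuarter p₂ (j + 6) z w,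
      mkQuarter p₃ (j + 9) w x]
  else if decide (3 ≤ j % 6) = δ then
    [mkHalf p j x y z, mkHalf p₂ (j + 6) z w x]
  else
    [mkHalf p₁ (j + 3) y z w, mkHalf p₃ (j + 9) w x y]

/-! ### The substitution

A corner at `v` with mark `c` becomes a dodecagonal wheel around `inflate v`: six triangles
around the centre, then, alternately, six squares in the directions of parity `c` and six
triangles in the other directions.  The wheels at the ends of an edge share an edge.  What
remains is one triangle inside each triangle, and a square with a triangle on each of its sides
inside each square. -/

/-- The vertex of the wheel around `v` between the directions `j` and `j + 1`. -/
def rim (v : Addr) (j : ℕ) : Addr := v + dir j + dir (j + 1)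

/-- The mark of the two vertices shared by the wheels at the ends of an edge in direction `j`
whose ends are marked `x` and `y`: the opposite of the majority of `x`, `y` and the parity
of `j`. -/
def edgeMark (x y : Bool) (j : ℕ) : Bool :=
  let k := decide (j % 2 = 1)
  !((x && y) || (x && k) || (y && k))

/-- The tiles of the wheel around `v` that lie in direction `j`; the rim vertices to the right
and to the left of this direction are marked `r` and `l`, the inner hexagon is marked `c`, the
centre is marked `c` if `ε = false` and the opposite if `ε = true`. -/
def wheelPart (ε δ : Bool) (v : Addr) (c : Bool) (j : ℕ) (r l : Bool) : List LTile :=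
  if decide (j % 2 = 1) = c then
    mkTri v (j + 11) (c ^^ ε) c c :: mkSquare δ (v + dir (j + 11)) j c r l c
  else
    [mkTri (v + dir j) (j + 11) c r l]

/-- The part of the wheel that the rule of a `tri` contains at a corner marked `c` where the
triangle starts in direction `j`, the corners in directions `j` and `j + 2` being marked `n`
and `m`.  The tiles that straddle a side go to the triangle on their left if `c` is white, and
to the one on their right if `c` is black, seen from the corner. -/
def triCorner (ε δ : Bool) (v : Addr) (c : Bool) (j : ℕ) (n m : Bool) : List LTile :=
  let e := edgeMark c n j
  let f := edgeMark c m (j + 2)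
  if c then wheelPart ε δ v c (j + 1) e f ++ wheelPart ε δ v c (j + 2) f f
  else wheelPart ε δ v c j e e ++ wheelPart ε δ v c (j + 1) e f

/-- At a corner of a square marked `c`, the part of the wheel between the side in direction `j`,
at whose other end the mark is `n`, and the diagonal counterclockwise from it. -/
def squareCornerFst (ε δ : Bool) (v : Addr) (c : Bool) (j : ℕ) (n : Bool) : List LTile :=
  let e := edgeMark c n j
  if c then wheelPart ε δ v c (j + 1) e (!c)
  else wheelPart ε δ v c j e e ++ wheelPart ε δ v c (j + 1) e (!c)

/-- At a corner of a square marked `c`, the part of the wheel between the side in direction `j`,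
at whose other end the mark is `m`, and the diagonal clockwise from it. -/
def squareCornerSnd (ε δ : Bool) (v : Addr) (c : Bool) (j : ℕ) (m : Bool) : List LTile :=
  let e := edgeMark c m j
  if c then wheelPart ε δ v c (j + 11) (!c) e ++ wheelPart ε δ v c j e e
  else wheelPart ε δ v c (j + 11) (!c) e

/-- What the rules of the pieces of a square contain along a side of the square in direction `j`
from the corner with wheel centre `a`, marked `x`, to that with wheel centre `b`, marked `y`. -/
def squareSide (ε δ : Bool) (a b : Addr) (j : ℕ) (x y : Bool) : List LTile :=
  squareCornerFst ε δ a x j y ++ squareCornerSnd ε δ b y (j + 6) x ++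
    [mkTri (rim a j) (j + 2) (edgeMark x y j) (!y) (!x)]

/-- The substitution rules, for marked triangles with first corner at the origin. -/
def rule (ε δ : Bool) (κ : Kind) : List LTile :=
  let j := κ.firstDir δ
  let a : Addr := 0
  let b := inflate (dir j)
  match κ with
  | .tri _ x y z =>
      triCorner ε δ a x j y z ++ triCorner ε δ b y (j + 4) z x ++
        triCorner ε δ (inflate (dir (j + 2))) z (j + 8) x y ++
        [mkTri (rim a j) (j + 2) (edgeMark x y j) (edgeMark y z (j + 4)) (edgeMark z x (j + 8))]
  | .quarter _ x y =>
      squareSide ε δ a b j x y ++ [mkQuarter (rim a (j + 1)) j (!x) (!y)]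
  | .half _ x y z =>
      squareSide ε δ a b j x y ++
        squareSide ε δ b (inflate (dir j + dir (j + 3))) (j + 3) y z ++
        [mkHalf (rim a (j + 1)) j (!x) (!y) (!z)]

/-- The rule applied to a placed marked triangle: a rotated copy is replaced by the rotated
patch. -/
def subst (ε δ : Bool) (t : LTile) : Finset LTile :=
  ((rule ε δ t.kind).map fun s =>
    (⟨s.kind, t.rot ^^ s.rot, inflate t.pos + (if t.rot then -s.pos else s.pos)⟩ : LTile)).toFinset

/-- The patch obtained from one marked triangle by applying the rules `n` times. -/
def supertile (ε δ : Bool) (κ : Kind) : ℕ → Finset LTile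
  | 0 => {⟨κ, false, 0⟩}
  | n + 1 => (supertile ε δ κ n).biUnion (subst ε δ)

/-- The mirror image in the vertical axis on addresses: direction `15° + 30° j` becomes
`15° + 30° (5 - j)`. -/
def flipAddr (p : Addr) : Addr :=
  (-p.2.1, -p.1, p.2.1 + p.2.2.2, p.1 + p.2.2.1)

/-- The mirror image in the vertical axis, with white and black exchanged. -/
def mirror (δ : Bool) (t : LTile) : LTile :=
  let j := t.firstDir δ
  match t.kind with
  | .tri _ x y z => mkTri (flipAddr t.pos) (15 - j) (!x) (!z) (!y)
  | .quarter _ x y => mkQuarter (flipAddr (t.pos + dir j)) (23 - j) (!y) (!x)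
  | .half _ x y z => mkHalf (flipAddr (t.pos + dir j + dir (j + 3))) (20 - j) (!z) (!y) (!x)

/-! ### Tilings of the plane `ℂ` -/

/-- A marked triangle in the plane, rotated by 0 or 180 degrees, with its first corner. -/
structure PTile where
  kind : Kind
  rot : Bool
  pos : ℂ

/-- The three corners of a marked triangle in the plane. -/
noncomputable def PTile.corners (δ : Bool) (t : PTile) : Set ℂ :=
  let j := t.kind.firstDir δ + (if t.rot then 6 else 0)
  {t.pos, t.pos + reshape (dir j),
    t.pos + match t.kind with
      | .tri _ _ _ _ => reshape (dir (j + 2))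
      | .quarter _ _ _ => (reshape (dir j) + reshape (dir (j + 3))) / 2
      | .half _ _ _ _ => reshape (dir j) + reshape (dir (j + 3))}

/-- The triangle without its marks. -/
noncomputable def PTile.region (δ : Bool) (t : PTile) : Set ℂ := convexHull ℝ (t.corners δ)

/-- Translation of a marked triangle. -/
noncomputable def PTile.shift (v : ℂ) (t : PTile) : PTile := ⟨t.kind, t.rot, v + t.pos⟩

/-- The marked triangle in the plane with a given address, the plane being translated by `w`. -/
noncomputable def LTile.place (w : ℂ) (t : LTile) : PTile := ⟨t.kind, t.rot, w + reshape t.pos⟩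

/-- No gaps and no overlaps. -/
def IsTiling (δ : Bool) (T : Set PTile) : Prop :=
  (⋃ t ∈ T, t.region δ) = Set.univ ∧
    T.Pairwise fun s t => Disjoint (interior (s.region δ)) (interior (t.region δ))

/-- A tiling generated by the rules: each of its finite patches occurs in a supertile. -/
def IsGenerated (ε δ : Bool) (T : Set PTile) : Prop :=
  IsTiling δ T ∧ ∀ F : Set PTile, F.Finite → F ⊆ T →
    ∃ (κ : Kind) (n : ℕ) (w : ℂ), κ.HasRule ∧
      F ⊆ LTile.place w '' (supertile ε δ κ n : Set LTile)

/-- Two different tiles meet in nothing, in a common corner, or in a common full side. -/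
def IsEdgeToEdge (δ : Bool) (T : Set PTile) : Prop :=
  T.Pairwise fun s t =>
    s.region δ ∩ t.region δ = convexHull ℝ (s.corners δ ∩ t.corners δ) ∧
      (s.corners δ ∩ t.corners δ).ncard ≤ 2

/-- A set `T` of tiles has period `v` inside the set `B` (for `B = univ`: `T` has period `v`). -/
def HasPeriodIn {α : Type} (region : α → Set ℂ) (shift : ℂ → α → α) (T : Set α) (v : ℂ)
    (B : Set ℂ) : Prop :=
  ∀ t : α, region t ⊆ B → region (shift v t) ⊆ B → (t ∈ T ↔ shift v t ∈ T)

/-- A set of tiles is aperiodic if it has no nonzero period and, moreover, no vector is a period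
of arbitrarily large patches. -/
def IsAperiodic {α : Type} (region : α → Set ℂ) (shift : ℂ → α → α) (T : Set α) : Prop :=
  (∀ v : ℂ, v ≠ 0 → ¬ HasPeriodIn region shift T v Set.univ) ∧
    ∀ v : ℂ, v ≠ 0 → ∃ R : ℝ, ∀ x : ℂ, ¬ HasPeriodIn region shift T v (Metric.closedBall x R)

end OneTriangle

namespace OneTriangle

/-! The rules commute with a boundary map on chains of marked edges, so the boundary of a patch is
determined by the boundary of what it was grown from. In a patch grown from a complete wheel the
physical positions of the boundary are scaled by `2 + √3`, while the conjugate positions stay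
bounded; as `reshape` is a combination of the two, the reshaped boundary recedes to infinity. The
number of triangles that cover a quarter of a unit cell changes only at boundary edges, hence it is
eventually the same for all quarters, and a count around the origin shows that it is `1`. Every
supertile lies in such a patch, and so there are no overlaps, and adjacent triangles match.

For aperiodicity, lift the vertices of the square lattice to the addresses. The conjugate positions
are bounded, and the label of a side is determined by the hypotenuses next to it. If the plain
triangles had a period on arbitrarily large discs, a limit of these lifts would have labels with
this period, so its displacement along the period would be a fixed nonzero address. As its multiples
have bounded conjugate positions, its conjugate would be `0`, which is impossible. -/

open Filter

theorem card_filter_hasRule : (Finset.univ.filter Kind.HasRule).card = 34 := by decide +kernel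

theorem hasRule_of_mem_rule :
    ∀ (ε δ : Bool) (κ : Kind), κ.HasRule → ∀ t ∈ rule ε δ κ, t.kind.HasRule := by
  decide +kernel

theorem mirror_mirror_and_hasRule : ∀ (δ : Bool) (κ : Kind), κ.HasRule →
    (mirror δ ⟨κ, false, 0⟩).kind.HasRule ∧ (mirror δ ⟨κ, false, 0⟩).kind ≠ κ ∧
      mirror δ (mirror δ ⟨κ, false, 0⟩) = ⟨κ, false, 0⟩ := by
  decide +kernel

/-! ### Half turns, translations and patches with multiplicities -/

/-- The half turn about the origin (if `r`) or the identity. -/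
def halfTurn {A : Type*} [Neg A] (r : Bool) (a : A) : A := if r then -a else a

theorem map_halfTurn {A B : Type*} [AddGroup A] [AddGroup B] (f : A →+ B) (r : Bool) (a : A) :
    f (halfTurn r a) = halfTurn r (f a) := by
  cases r <;> simp [halfTurn]

theorem norm_halfTurn {A : Type*} [SeminormedAddGroup A] (r : Bool) (a : A) :
    ‖halfTurn r a‖ = ‖a‖ := by
  cases r <;> simp [halfTurn]

/-- The half turn about the origin (if `r`) followed by the translation by `q`. -/
def LTile.act (r : Bool) (q : Addr) (t : LTile) : LTile :=
  ⟨t.kind, r ^^ t.rot, q + halfTurn r t.pos⟩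

/-- The patch that replaces a marked triangle, as a multiset: multiplicities are kept because the
point is to show that nothing is covered twice. -/
def children (ε δ : Bool) (t : LTile) : Multiset LTile :=
  (rule ε δ t.kind).map (LTile.act t.rot (inflate t.pos))

theorem subst_eq_toFinset_children (ε δ : Bool) (t : LTile) :
    subst ε δ t = (children ε δ t).toFinset := rfl

theorem mem_subst {ε δ : Bool} {s t : LTile} : s ∈ subst ε δ t ↔ s ∈ children ε δ t :=
  Multiset.mem_toFinset

theorem children_mirror : ∀ (ε δ : Bool) (κ : Kind), κ.HasRule →
    children ε δ (mirror δ ⟨κ, false, 0⟩) = (children ε δ ⟨κ, false, 0⟩).map (mirror δ) := by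
  decide +kernel

theorem subst_mirror (ε δ : Bool) (κ : Kind) (hκ : κ.HasRule) :
    subst ε δ (mirror δ ⟨κ, false, 0⟩) = (subst ε δ ⟨κ, false, 0⟩).image (mirror δ) := by
  simp only [subst_eq_toFinset_children, children_mirror ε δ κ hκ, Multiset.toFinset_map]

theorem turn_add (p q : Addr) : turn (p + q) = turn p + turn q := by
  simp only [turn, Prod.fst_add, Prod.snd_add, Prod.mk_add_mk, Prod.mk.injEq, true_and, and_true]
  constructor <;> ring

theorem iterate_turn_add (n : ℕ) (p q : Addr) : turn^[n] (p + q) = turn^[n] p + turn^[n] q :=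
  Function.Semiconj₂.iterate turn_add n p q

/-- `inflate` as a homomorphism. -/
def inflateHom : Addr →+ Addr :=
  AddMonoidHom.mk' inflate fun p q => by
    simp only [inflate, turn_add, iterate_turn_add]
    abel

theorem inflate_add (p q : Addr) : inflate (p + q) = inflate p + inflate q :=
  map_add inflateHom p q

theorem inflate_halfTurn (r : Bool) (p : Addr) :
    inflate (halfTurn r p) = halfTurn r (inflate p) :=
  map_halfTurn inflateHom r p

theorem LTile.act_act (r r' : Bool) (q q' : Addr) (t : LTile) :
    (t.act r' q').act r q = t.act (r ^^ r') (q + halfTurn r q') := by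
  cases r <;> cases r' <;> simp [LTile.act, halfTurn] <;> abel

theorem children_act (ε δ r : Bool) (q : Addr) (t : LTile) :
    children ε δ (t.act r q) = (children ε δ t).map (LTile.act r (inflate q)) := by
  simp only [children, Multiset.map_coe, List.map_map, LTile.act, inflate_add, inflate_halfTurn]
  congr 2
  funext s
  exact (LTile.act_act ..).symm

/-- The patch obtained from a patch by applying the rules `n` times. -/
def descendants (ε δ : Bool) (n : ℕ) (P : Multiset LTile) : Multiset LTile :=
  (fun Q => Q.bind (children ε δ))^[n] P

theorem descendants_succ (ε δ : Bool) (n : ℕ) (P : Multiset LTile) :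
    descendants ε δ (n + 1) P = (descendants ε δ n P).bind (children ε δ) :=
  Function.iterate_succ_apply' _ n P

theorem mem_descendants_succ {ε δ : Bool} {n : ℕ} {P : Multiset LTile} {s : LTile} :
    s ∈ descendants ε δ (n + 1) P ↔ ∃ t ∈ descendants ε δ n P, s ∈ children ε δ t := by
  rw [descendants_succ, Multiset.mem_bind]

theorem descendants_bind_children (ε δ : Bool) (n : ℕ) (P : Multiset LTile) :
    descendants ε δ n (P.bind (children ε δ)) = descendants ε δ (n + 1) P := rfl

theorem descendants_descendants (ε δ : Bool) (m n : ℕ) (P : Multiset LTile) :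
    descendants ε δ n (descendants ε δ m P) = descendants ε δ (n + m) P :=
  (Function.iterate_add_apply _ n m P).symm

theorem descendants_add (ε δ : Bool) (n : ℕ) (P Q : Multiset LTile) :
    descendants ε δ n (P + Q) = descendants ε δ n P + descendants ε δ n Q :=
  Function.Semiconj₂.iterate (fun P Q => Multiset.add_bind P Q (children ε δ)) n P Q

theorem descendants_subset (ε δ : Bool) (n : ℕ) {P Q : Multiset LTile} (h : P ⊆ Q) :
    descendants ε δ n P ⊆ descendants ε δ n Q := by
  induction n with
  | zero => exact h
  | succ n ih =>
    intro s hs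
    obtain ⟨t, ht, hst⟩ := mem_descendants_succ.1 hs
    exact mem_descendants_succ.2 ⟨t, ih ht, hst⟩

theorem descendants_act (ε δ r : Bool) (q : Addr) (n : ℕ) (P : Multiset LTile) :
    descendants ε δ n (P.map (LTile.act r q)) =
      (descendants ε δ n P).map (LTile.act r (inflate^[n] q)) := by
  induction n with
  | zero => rfl
  | succ n ih =>
    simp only [descendants_succ, ih, Multiset.bind_map, Multiset.map_bind, children_act,
      Function.iterate_succ_apply']

theorem forall_mem_descendants {ε δ : Bool} {p : LTile → Prop}
    (hp : ∀ t, p t → ∀ s ∈ children ε δ t, p s) {P : Multiset LTile} (hP : ∀ t ∈ P, p t) (n : ℕ) :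
    ∀ t ∈ descendants ε δ n P, p t := by
  induction n with
  | zero => exact hP
  | succ n ih =>
    intro s hs
    obtain ⟨t, ht, hst⟩ := mem_descendants_succ.1 hs
    exact hp t (ih t ht) s hst

theorem mem_supertile {ε δ : Bool} {κ : Kind} {n : ℕ} {t : LTile} :
    t ∈ supertile ε δ κ n ↔ t ∈ descendants ε δ n {⟨κ, false, 0⟩} := by
  induction n generalizing t with
  | zero => exact Finset.mem_singleton.trans Multiset.mem_singleton.symm
  | succ n ih => simp only [supertile, Finset.mem_biUnion, mem_descendants_succ, ih, mem_subst]

/-! ### Marked edges and their substitution -/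

/-- A directed side of a marked triangle: `lat p j x y` is the lattice edge from `p` to
`p + d_j` with end marks `x` and `y`; `leg p j x out` joins the corner `p` with mark `x` to the
centre of the square on `d_j, d_{j+3}`, directed to the centre if `out`; `diag p j x z` is the
diagonal of the square on `d_j, d_{j+3}` from `p`. -/
inductive Edge where
  | lat (p : Addr) (j : Fin 12) (x y : Bool)
  | leg (p : Addr) (j : Fin 12) (x out : Bool)
  | diag (p : Addr) (j : Fin 12) (x z : Bool)
  deriving DecidableEq

/-- The same side in the other direction. -/
def Edge.rev : Edge → Edge
  | .lat p j x y => .lat (p + dir j) (j + 6) y x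
  | .leg p j x o => .leg p j x (!o)
  | .diag p j x z => .diag (p + dir j + dir (j + 3 : Fin 12)) (j + 6) z x

/-- The half turn (if `r`) on direction indices. -/
def turnIdx (r : Bool) (j : Fin 12) : Fin 12 := if r then j + 6 else j

/-- The half turn (if `r`) followed by the translation by `q`, on edges. -/
def Edge.act (r : Bool) (q : Addr) : Edge → Edge
  | .lat p j x y => .lat (q + halfTurn r p) (turnIdx r j) x y
  | .leg p j x o => .leg (q + halfTurn r p) (turnIdx r j) x o
  | .diag p j x z => .diag (q + halfTurn r p) (turnIdx r j) x z

/-- The address of the lattice corner from which an edge is specified. -/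
def Edge.base : Edge → Addr
  | .lat p _ _ _ => p
  | .leg p _ _ _ => p
  | .diag p _ _ _ => p

/-- The index of the direction of the first side of an unrotated triangle. -/
def Kind.idx (δ : Bool) (κ : Kind) : Fin 12 := Fin.ofNat 12 (κ.firstDir δ)

/-- The sides of an unrotated triangle at the origin, directed counterclockwise. -/
def Kind.edges (δ : Bool) (κ : Kind) : Multiset Edge :=
  let j := κ.idx δ
  match κ with
  | .tri _ x y z => {.lat 0 j x y, .lat (dir j) (j + 4) y z,
      .lat (dir (j + 2 : Fin 12)) (j + 8) z x}
  | .quarter _ x y => {.lat 0 j x y, .leg (dir j) (j + 3) y true, .leg 0 j x false}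
  | .half _ x y z => {.lat 0 j x y, .lat (dir j) (j + 3) y z,
      .diag (dir j + dir (j + 3 : Fin 12)) (j + 6) z x}

/-- The sides of a placed triangle, directed counterclockwise. -/
def LTile.edges (δ : Bool) (t : LTile) : Multiset Edge :=
  (t.kind.edges δ).map (Edge.act t.rot t.pos)

/-- The path from the centre `v` of a wheel marked `c` to its rim vertex between the directions
`i` and `i + 1`, which is marked `m`. -/
def spoke (ε : Bool) (v : Addr) (c : Bool) (i : Fin 12) (m : Bool) : Multiset Edge :=
  if decide (i.val % 2 = 1) = c then
    {.lat v (i + 1) (c ^^ ε) c, .lat (v + dir (i + 1 : Fin 12)) i c m}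
  else
    {.lat v i (c ^^ ε) c, .lat (v + dir i) (i + 1) c m}

/-- The path that replaces an edge.  The ownership of the tiles that straddle a lattice edge makes
the path pass on the left of the edge at a black end and on its right at a white end, so it has to
change sides if the marks at the two ends agree. -/
def subEdge (ε : Bool) : Edge → Multiset Edge
  | .lat p j x y =>
    let v := inflate p
    let m := edgeMark x y j
    spoke ε v x (if x then j else j + 11) m +
      (if x = y then
        if x then {.lat (rim v j) (j + 9) m m} else {.lat (rim v (j + 11 : Fin 12)) (j + 3) m m}
      else 0) +
      (spoke ε (inflate (p + dir j)) y (if y then j + 6 else j + 5) m).map Edge.rev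
  | .leg p j x o =>
    let v := inflate p
    let path := spoke ε v x (j + 1) (!x) + {.leg (rim v (j + 1 : Fin 12)) j (!x) true}
    if o then path else path.map Edge.rev
  | .diag p j x z =>
    let v := inflate p
    spoke ε v x (j + 1) (!x) + {.diag (rim v (j + 1 : Fin 12)) j (!x) (!z)} +
      (spoke ε (inflate (p + dir j + dir (j + 3 : Fin 12))) z (j + 7) (!z)).map Edge.rev

theorem dir_add_six : ∀ j : Fin 12, dir (j + 6 : Fin 12) = -dir j := by decide +kernel

theorem dir_add_nine : ∀ j : Fin 12, dir (j + 9 : Fin 12) = -dir (j + 3 : Fin 12) := by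
  decide +kernel

theorem add_six_add_six (j : Fin 12) : j + 6 + 6 = j := by rw [add_assoc]; exact add_zero j

theorem add_six_add_three (j : Fin 12) : j + 6 + 3 = j + 9 := add_assoc j 6 3

theorem Edge.rev_act (r : Bool) (q : Addr) (e : Edge) : (e.act r q).rev = e.rev.act r q := by
  cases e <;> cases r <;>
    simp [Edge.act, Edge.rev, halfTurn, turnIdx, dir_add_six, dir_add_nine,
      add_six_add_three] <;> abel

theorem Edge.act_act (r r' : Bool) (q q' : Addr) (e : Edge) :
    (e.act r' q').act r q = e.act (r ^^ r') (q + halfTurn r q') := by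
  cases e <;> cases r <;> cases r' <;>
    simp [Edge.act, halfTurn, turnIdx, add_six_add_six] <;> abel

theorem Edge.base_act (r : Bool) (q : Addr) (e : Edge) :
    (e.act r q).base = q + halfTurn r e.base := by
  cases e <;> rfl

theorem LTile.edges_act (δ r : Bool) (q : Addr) (t : LTile) :
    (t.act r q).edges δ = (t.edges δ).map (Edge.act r q) := by
  simp only [LTile.edges, LTile.act, Multiset.map_map, Function.comp_def, Edge.act_act]

theorem bind_edges_map_act (δ r : Bool) (q : Addr) (P : Multiset LTile) :
    (P.map (LTile.act r q)).bind (LTile.edges δ) =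
      (P.bind (LTile.edges δ)).map (Edge.act r q) := by
  simp only [Multiset.bind_map, Multiset.map_bind, LTile.edges_act]

theorem spoke_add (ε : Bool) (q v : Addr) (c : Bool) (i : Fin 12) (m : Bool) :
    spoke ε (q + v) c i m = (spoke ε v c i m).map (Edge.act false q) := by
  unfold spoke
  split_ifs <;> simp [Edge.act, halfTurn, turnIdx, add_assoc]

theorem subEdge_translate (ε : Bool) (q : Addr) (e : Edge) :
    subEdge ε (e.act false q) = (subEdge ε e).map (Edge.act false (inflate q)) := by
  have map_rev (m : Multiset Edge) : (m.map (Edge.act false (inflate q))).map Edge.rev =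
      (m.map Edge.rev).map (Edge.act false (inflate q)) := by
    simp only [Multiset.map_map, Function.comp_def, Edge.rev_act]
  cases e with
  | lat p j x y =>
    cases x <;> cases y <;> simp only [subEdge, Edge.act, halfTurn, turnIdx, inflate_add q,
      spoke_add ε (inflate q), map_rev, rim, add_assoc, Multiset.map_add, Multiset.map_singleton,
      Multiset.map_zero, if_true, if_false, Bool.false_eq_true, Bool.true_eq_false]
  | leg p j x o =>
    cases o <;> simp only [subEdge, Edge.act, Edge.rev, halfTurn, turnIdx, inflate_add q,
      spoke_add ε (inflate q), map_rev, rim, add_assoc, Multiset.map_add, Multiset.map_singleton,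
      if_true, if_false, Bool.false_eq_true]
  | diag p j x z =>
    simp only [subEdge, Edge.act, halfTurn, turnIdx, inflate_add q, spoke_add ε (inflate q),
      map_rev, rim, add_assoc, Multiset.map_add, Multiset.map_singleton, if_false,
      Bool.false_eq_true]

theorem subEdge_lat_halfTurn : ∀ (ε : Bool) (j : Fin 12) (x y : Bool),
    subEdge ε (.lat 0 (j + 6) x y) = (subEdge ε (.lat 0 j x y)).map (Edge.act true 0) := by
  decide +kernel

theorem subEdge_leg_halfTurn : ∀ (ε : Bool) (j : Fin 12) (x o : Bool),
    subEdge ε (.leg 0 (j + 6) x o) = (subEdge ε (.leg 0 j x o)).map (Edge.act true 0) := by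
  decide +kernel

theorem subEdge_diag_halfTurn : ∀ (ε : Bool) (j : Fin 12) (x z : Bool),
    subEdge ε (.diag 0 (j + 6) x z) = (subEdge ε (.diag 0 j x z)).map (Edge.act true 0) := by
  decide +kernel

theorem subEdge_lat_rev : ∀ (ε : Bool) (j : Fin 12) (x y : Bool),
    subEdge ε (Edge.lat 0 j x y).rev = (subEdge ε (.lat 0 j x y)).map Edge.rev := by
  decide +kernel

theorem subEdge_leg_rev : ∀ (ε : Bool) (j : Fin 12) (x o : Bool),
    subEdge ε (Edge.leg 0 j x o).rev = (subEdge ε (.leg 0 j x o)).map Edge.rev := by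
  decide +kernel

theorem subEdge_diag_rev : ∀ (ε : Bool) (j : Fin 12) (x z : Bool),
    subEdge ε (Edge.diag 0 j x z).rev = (subEdge ε (.diag 0 j x z)).map Edge.rev := by
  decide +kernel

/-- The translate of an edge that is based at the origin. -/
def Edge.atOrigin (e : Edge) : Edge := e.act false (-e.base)

theorem Edge.act_atOrigin (e : Edge) : e.atOrigin.act false e.base = e := by
  cases e <;> simp [Edge.atOrigin, Edge.act, Edge.base, halfTurn, turnIdx]

theorem subEdge_atOrigin_halfTurn (ε : Bool) (e : Edge) :
    subEdge ε (e.atOrigin.act true 0) = (subEdge ε e.atOrigin).map (Edge.act true 0) := by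
  cases e <;> simp only [Edge.atOrigin, Edge.act, Edge.base, halfTurn, turnIdx, neg_add_cancel,
    neg_zero, add_zero, if_true, if_false, Bool.false_eq_true]
  · exact subEdge_lat_halfTurn ..
  · exact subEdge_leg_halfTurn ..
  · exact subEdge_diag_halfTurn ..

theorem subEdge_atOrigin_rev (ε : Bool) (e : Edge) :
    subEdge ε e.atOrigin.rev = (subEdge ε e.atOrigin).map Edge.rev := by
  cases e <;> simp only [Edge.atOrigin, Edge.act, Edge.base, halfTurn, turnIdx, neg_add_cancel,
    if_false, Bool.false_eq_true]
  · exact subEdge_lat_rev ..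
  · exact subEdge_leg_rev ..
  · exact subEdge_diag_rev ..

theorem subEdge_act (ε r : Bool) (q : Addr) (e : Edge) :
    subEdge ε (e.act r q) = (subEdge ε e).map (Edge.act r (inflate q)) := by
  cases r with
  | false => exact subEdge_translate ε q e
  | true =>
    have h : e.act true q = (e.atOrigin.act true 0).act false (q + halfTurn true e.base) := by
      conv_lhs => rw [← e.act_atOrigin]
      simp [Edge.act_act, halfTurn]
    conv_rhs => rw [← e.act_atOrigin]
    rw [h, subEdge_translate, subEdge_atOrigin_halfTurn, subEdge_translate, inflate_add,
      inflate_halfTurn]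
    simp [Edge.act_act, halfTurn]

theorem subEdge_rev (ε : Bool) (e : Edge) : subEdge ε e.rev = (subEdge ε e).map Edge.rev := by
  conv_lhs => rw [← e.act_atOrigin, Edge.rev_act, subEdge_translate, subEdge_atOrigin_rev]
  conv_rhs => rw [← e.act_atOrigin, subEdge_translate]
  simp only [Multiset.map_map, Function.comp_def, Edge.rev_act]

/-- A chain in which the two directions of each edge occur equally often, that is, which vanishes
when opposite edges cancel. -/
def IsBalanced (m : Multiset Edge) : Prop := m.map Edge.rev = m

instance : DecidablePred IsBalanced := fun m => decEq (m.map Edge.rev) m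

theorem isBalanced_rule_boundary : ∀ (ε δ : Bool) (κ : Kind), κ.HasRule →
    IsBalanced ((rule ε δ κ : Multiset LTile).bind (LTile.edges δ) +
      ((κ.edges δ).bind (subEdge ε)).map Edge.rev) := by
  decide +kernel

/-! ### Antisymmetric functions on edges -/

/-- Functions on directed edges that change sign with the direction: the pairing with such
functions is how boundaries of patches are compared. -/
def Antisymm (F : Edge → ℤ) : Prop := ∀ e, F e.rev = -F e

theorem Antisymm.act {F : Edge → ℤ} (hF : Antisymm F) (r : Bool) (q : Addr) :
    Antisymm fun e => F (e.act r q) := fun e => by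
  rw [← hF, Edge.rev_act]

theorem Antisymm.sum_map_rev {F : Edge → ℤ} (hF : Antisymm F) (m : Multiset Edge) :
    ((m.map Edge.rev).map F).sum = -(m.map F).sum := by
  rw [← Multiset.sum_map_neg, Multiset.map_map]
  exact congrArg Multiset.sum (Multiset.map_congr rfl fun e _ => hF e)

theorem Antisymm.sum_eq_zero {F : Edge → ℤ} (hF : Antisymm F) {m : Multiset Edge}
    (hm : IsBalanced m) : (m.map F).sum = 0 := by
  have h := hF.sum_map_rev m
  rw [show m.map Edge.rev = m from hm] at h
  linarith

theorem Antisymm.sum_subEdge {F : Edge → ℤ} (hF : Antisymm F) (ε : Bool) :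
    Antisymm fun e => ((subEdge ε e).map F).sum := fun e => by
  simp only [subEdge_rev, hF.sum_map_rev]

theorem Antisymm.sum_edges_rule {F : Edge → ℤ} (hF : Antisymm F) (ε δ : Bool) {κ : Kind}
    (hκ : κ.HasRule) :
    (((rule ε δ κ : Multiset LTile).bind (LTile.edges δ)).map F).sum =
      (((κ.edges δ).bind (subEdge ε)).map F).sum := by
  have h := hF.sum_eq_zero (isBalanced_rule_boundary ε δ κ hκ)
  rw [Multiset.map_add, Multiset.sum_add, hF.sum_map_rev] at h
  linarith

theorem Antisymm.sum_edges_children {F : Edge → ℤ} (hF : Antisymm F) (ε δ : Bool) {t : LTile}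
    (ht : t.kind.HasRule) :
    (((children ε δ t).bind (LTile.edges δ)).map F).sum =
      (((t.edges δ).bind (subEdge ε)).map F).sum := by
  have h := (hF.act t.rot (inflate t.pos)).sum_edges_rule ε δ ht
  have h_edges : (t.edges δ).bind (subEdge ε) =
      ((t.kind.edges δ).bind (subEdge ε)).map (Edge.act t.rot (inflate t.pos)) := by
    simp only [LTile.edges, Multiset.bind_map, Multiset.map_bind, subEdge_act]
  rw [h_edges, children, ← Multiset.map_coe, bind_edges_map_act]
  simpa only [Multiset.map_map, Function.comp_def] using h

/-! ### The two embeddings of the lattice -/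

/-- The position of an address in the square-triangle tiling (turned by `-15°`). -/
noncomputable def phys : Addr →+ ℂ :=
  AddMonoidHom.mk' (fun p =>
    ⟨p.1 + p.2.2.1 / 2 + p.2.1 * (√3 / 2), p.2.1 / 2 + p.2.2.1 * (√3 / 2) + p.2.2.2⟩) fun p q => by
    apply Complex.ext <;> simp <;> ring

/-- The conjugate position, with `√3` replaced by `-√3`.  It is contracted by `inflate`, hence
stays bounded on all patches. -/
noncomputable def internal : Addr →+ ℂ :=
  AddMonoidHom.mk' (fun p =>
    ⟨p.1 + p.2.2.1 / 2 - p.2.1 * (√3 / 2), p.2.1 / 2 - p.2.2.1 * (√3 / 2) + p.2.2.2⟩) fun p q => by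
    apply Complex.ext <;> simp <;> ring

theorem phys_apply (p : Addr) : phys p =
    ⟨p.1 + p.2.2.1 / 2 + p.2.1 * (√3 / 2), p.2.1 / 2 + p.2.2.1 * (√3 / 2) + p.2.2.2⟩ := rfl

theorem internal_apply (p : Addr) : internal p =
    ⟨p.1 + p.2.2.1 / 2 - p.2.1 * (√3 / 2), p.2.1 / 2 - p.2.2.1 * (√3 / 2) + p.2.2.2⟩ := rfl

theorem inflate_eq (a b c d : ℤ) :
    inflate (a, b, c, d) =
      (2 * a + b - d, 2 * a + 2 * b + c, b + 2 * c + 2 * d, 2 * d + c - a) := by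
  simp only [inflate, turn, Function.iterate_succ, Function.iterate_zero, Function.comp, id,
    Prod.mk_add_mk, Prod.mk.injEq]
  refine ⟨?_, ?_, ?_, ?_⟩ <;> ring

theorem sqrt_three_mul_self : √3 * √3 = 3 := Real.mul_self_sqrt (by norm_num)

theorem phys_inflate (p : Addr) : phys (inflate p) = ((2 + √3 : ℝ) : ℂ) * phys p := by
  obtain ⟨a, b, c, d⟩ := p
  rw [inflate_eq]
  apply Complex.ext <;> simp [phys_apply]
  · linear_combination (-b / 2 : ℝ) * sqrt_three_mul_self
  · linear_combination (-c / 2 : ℝ) * sqrt_three_mul_self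

theorem internal_inflate (p : Addr) : internal (inflate p) = ((2 - √3 : ℝ) : ℂ) * internal p := by
  obtain ⟨a, b, c, d⟩ := p
  rw [inflate_eq]
  apply Complex.ext <;> simp [internal_apply]
  · linear_combination (-b / 2 : ℝ) * sqrt_three_mul_self
  · linear_combination (-c / 2 : ℝ) * sqrt_three_mul_self

/-- The rational part of the squared length. -/
def ratPart (p : Addr) : ℤ :=
  p.1 * p.1 + p.2.1 * p.2.1 + p.2.2.1 * p.2.2.1 + p.2.2.2 * p.2.2.2 + p.1 * p.2.2.1 +
    p.2.1 * p.2.2.2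

/-- The coefficient of `√3` in the squared length. -/
def irrPart (p : Addr) : ℤ := p.1 * p.2.1 + p.2.1 * p.2.2.1 + p.2.2.1 * p.2.2.2

theorem norm_phys_sq (p : Addr) : ‖phys p‖ ^ 2 = ratPart p + irrPart p * √3 := by
  rw [← Complex.normSq_eq_norm_sq, Complex.normSq_apply]
  simp only [phys_apply, ratPart, irrPart]
  push_cast
  linear_combination (p.2.1 ^ 2 / 4 + p.2.2.1 ^ 2 / 4 : ℝ) * sqrt_three_mul_self

theorem norm_internal_sq (p : Addr) : ‖internal p‖ ^ 2 = ratPart p - irrPart p * √3 := by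
  rw [← Complex.normSq_eq_norm_sq, Complex.normSq_apply]
  simp only [internal_apply, ratPart, irrPart]
  push_cast
  linear_combination (p.2.1 ^ 2 / 4 + p.2.2.1 ^ 2 / 4 : ℝ) * sqrt_three_mul_self

theorem sqrt_three_bounds : 1.73205 < √3 ∧ √3 < 1.73206 :=
  ⟨Real.lt_sqrt_of_sq_lt (by norm_num), (Real.sqrt_lt' (by norm_num)).2 (by norm_num)⟩

/-- A decidable sufficient condition for `u + v √3 ≤ 0`, from `1.73205 < √3 < 1.73206`. -/
def SurdNonpos (u v : ℤ) : Prop := 100000 * u + 173205 * v ≤ 0 ∧ 100000 * u + 173206 * v ≤ 0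

instance (u v : ℤ) : Decidable (SurdNonpos u v) := inferInstanceAs (Decidable (_ ∧ _))

theorem SurdNonpos.le {u v : ℤ} (h : SurdNonpos u v) : (u : ℝ) + v * √3 ≤ 0 := by
  obtain ⟨h_lower, h_upper⟩ := h
  have h_lower' : (100000 * u + 173205 * v : ℝ) ≤ 0 := by exact_mod_cast h_lower
  have h_upper' : (100000 * u + 173206 * v : ℝ) ≤ 0 := by exact_mod_cast h_upper
  obtain ⟨lt_sqrt, sqrt_lt⟩ := sqrt_three_bounds
  rcases le_total (0 : ℝ) v with hv | hv
  · linarith [mul_le_mul_of_nonneg_left sqrt_lt.le hv]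
  · linarith [mul_le_mul_of_nonpos_left lt_sqrt.le hv]

/-- The factor of `phys` in `reshape`. -/
noncomputable def physFactor : ℂ := ⟨1 / 2 + √3 / 3, √3 / 6⟩

/-- The factor of `internal` in `reshape`. -/
noncomputable def internalFactor : ℂ := ⟨1 / 2 - √3 / 3, -(√3 / 6)⟩

theorem reshape_eq (p : Addr) :
    reshape p = physFactor * phys p + internalFactor * internal p := by
  apply Complex.ext <;> simp [reshape, physFactor, internalFactor, phys_apply, internal_apply]
  · linear_combination (p.2.2.1 / 6 - p.2.1 / 3 : ℝ) * sqrt_three_mul_self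
  · linear_combination (-(p.2.1 / 6 + p.2.2.1 / 3) : ℝ) * sqrt_three_mul_self

theorem le_norm_physFactor : 1.115 ≤ ‖physFactor‖ := by
  refine le_of_sq_le_sq ?_ (norm_nonneg _)
  rw [← Complex.normSq_eq_norm_sq, Complex.normSq_apply]
  simp only [physFactor]
  nlinarith [sqrt_three_bounds.1, sqrt_three_mul_self]

theorem norm_internalFactor_le : ‖internalFactor‖ ≤ 0.3 := by
  refine le_of_sq_le_sq ?_ (by norm_num)
  rw [← Complex.normSq_eq_norm_sq, Complex.normSq_apply]
  simp only [internalFactor]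
  nlinarith [sqrt_three_bounds.1, sqrt_three_mul_self]

theorem norm_reshape_ge (p : Addr) : 1.115 * ‖phys p‖ - 0.3 * ‖internal p‖ ≤ ‖reshape p‖ := by
  have h_triangle : ‖physFactor * phys p‖ ≤ ‖reshape p‖ + ‖internalFactor * internal p‖ := by
    rw [eq_sub_of_add_eq (reshape_eq p).symm]
    exact norm_sub_le _ _
  rw [norm_mul, norm_mul] at h_triangle
  have h_phys := mul_le_mul_of_nonneg_right le_norm_physFactor (norm_nonneg (phys p))
  have h_internal := mul_le_mul_of_nonneg_right norm_internalFactor_le (norm_nonneg (internal p))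
  linarith

theorem norm_phys_inflate_add (p q : Addr) :
    (2 + √3) * ‖phys p‖ - ‖phys q‖ ≤ ‖phys (inflate p + q)‖ := by
  rw [map_add, phys_inflate]
  have h := norm_sub_le (((2 + √3 : ℝ) : ℂ) * phys p + phys q) (phys q)
  rw [add_sub_cancel_right, norm_mul, Complex.norm_real, Real.norm_of_nonneg (by positivity)] at h
  linarith

-- The bound is preserved because `1.9 * (2 - √3) + 1.37 < 1.9`.
theorem norm_internal_inflate_add_le {p q : Addr} (hp : ‖internal p‖ ≤ 1.9)
    (hq : ‖internal q‖ ≤ 1.37) : ‖internal (inflate p + q)‖ ≤ 1.9 := by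
  rw [map_add, internal_inflate]
  refine (norm_add_le _ _).trans ?_
  obtain ⟨lt_sqrt, sqrt_lt⟩ := sqrt_three_bounds
  rw [norm_mul, Complex.norm_real, Real.norm_of_nonneg (by linarith)]
  nlinarith [norm_nonneg (internal p)]

/-- The squared conjugate length is at most `1.37²`. -/
def SmallInternal (p : Addr) : Prop := SurdNonpos (10000 * ratPart p - 18769) (-10000 * irrPart p)

instance (p : Addr) : Decidable (SmallInternal p) := inferInstanceAs (Decidable (SurdNonpos _ _))

theorem SmallInternal.norm_le {p : Addr} (h : SmallInternal p) : ‖internal p‖ ≤ 1.37 := by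
  refine le_of_sq_le_sq ?_ (by norm_num)
  have h_le := SurdNonpos.le h
  push_cast at h_le
  rw [norm_internal_sq]
  linarith

/-! ### Wheels and the patches that grow from them -/

/-- Triangles that have a rule and whose first corner has a small conjugate position. -/
def LTile.IsAdmissible (t : LTile) : Prop := t.kind.HasRule ∧ ‖internal t.pos‖ ≤ 1.9

-- `14 + 8√3 = (1 + √3)² (2 + √3)`, where `2 + √3` is the squared radius of a wheel.
theorem pos_bounds_of_mem_rule : ∀ (ε δ : Bool) (κ : Kind), κ.HasRule → ∀ s ∈ rule ε δ κ,
    SurdNonpos (ratPart s.pos - 14) (irrPart s.pos - 8) ∧ SmallInternal s.pos := by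
  decide +kernel

theorem mem_children {ε δ : Bool} {s t : LTile} :
    s ∈ children ε δ t ↔ ∃ u ∈ rule ε δ t.kind, u.act t.rot (inflate t.pos) = s :=
  List.mem_map

theorem LTile.IsAdmissible.of_mem_children {ε δ : Bool} (t : LTile) (ht : t.IsAdmissible) :
    ∀ s ∈ children ε δ t, s.IsAdmissible := by
  intro s hs
  obtain ⟨u, hu, rfl⟩ := mem_children.1 hs
  refine ⟨hasRule_of_mem_rule ε δ t.kind ht.1 u hu, norm_internal_inflate_add_le ht.2 ?_⟩
  rw [map_halfTurn, norm_halfTurn]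
  exact (pos_bounds_of_mem_rule ε δ t.kind ht.1 u hu).2.norm_le

/-- The complete wheel around the origin, with rim vertices marked opposite to the inner ones. -/
def wheel (ε δ c : Bool) : Multiset LTile :=
  (Multiset.range 12).bind fun j => wheelPart ε δ 0 c j (!c) (!c)

/-- The patch obtained from a wheel by applying the rules `n` times. -/
def wheelPatch (ε δ c : Bool) (n : ℕ) : Multiset LTile := descendants ε δ n (wheel ε δ c)

theorem wheelPatch_succ (ε δ c : Bool) (n : ℕ) :
    wheelPatch ε δ c (n + 1) = (wheelPatch ε δ c n).bind (children ε δ) :=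
  descendants_succ ε δ n _

/-- The boundary of a wheel. -/
def rimEdges (c : Bool) : Multiset Edge :=
  Finset.univ.val.map fun j : Fin 12 => .lat (rim 0 (j + 11 : Fin 12)) (j + 3) (!c) (!c)

/-- The boundary of the `n`-th patch that grows from a wheel. -/
def boundary (ε c : Bool) (n : ℕ) : Multiset Edge :=
  (fun m => m.bind (subEdge ε))^[n] (rimEdges c)

theorem boundary_succ (ε c : Bool) (n : ℕ) :
    boundary ε c (n + 1) = (boundary ε c n).bind (subEdge ε) :=
  Function.iterate_succ_apply' _ n _

theorem hasRule_and_smallInternal_of_mem_wheel : ∀ (ε δ c : Bool), ∀ t ∈ wheel ε δ c,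
    t.kind.HasRule ∧ SmallInternal t.pos := by
  decide +kernel

theorem isAdmissible_of_mem_wheel {ε δ c : Bool} : ∀ t ∈ wheel ε δ c, t.IsAdmissible :=
  fun t ht =>
    have ⟨h_rule, h_internal⟩ := hasRule_and_smallInternal_of_mem_wheel ε δ c t ht
    ⟨h_rule, h_internal.norm_le.trans (by norm_num)⟩

theorem isAdmissible_of_mem_wheelPatch {ε δ c : Bool} {n : ℕ} :
    ∀ t ∈ wheelPatch ε δ c n, t.IsAdmissible :=
  forall_mem_descendants LTile.IsAdmissible.of_mem_children isAdmissible_of_mem_wheel n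

theorem isBalanced_wheel_boundary : ∀ ε δ c : Bool,
    IsBalanced ((wheel ε δ c).bind (LTile.edges δ) + (rimEdges c).map Edge.rev) := by
  decide +kernel

theorem Antisymm.sum_edges_wheel {F : Edge → ℤ} (hF : Antisymm F) (ε δ c : Bool) :
    (((wheel ε δ c).bind (LTile.edges δ)).map F).sum = ((rimEdges c).map F).sum := by
  have h := hF.sum_eq_zero (isBalanced_wheel_boundary ε δ c)
  rw [Multiset.map_add, Multiset.sum_add, hF.sum_map_rev] at h
  linarith

theorem Antisymm.sum_edges_bind_children {F : Edge → ℤ} (hF : Antisymm F) (ε δ : Bool)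
    {P : Multiset LTile} (hP : ∀ t ∈ P, t.kind.HasRule) :
    (((P.bind (children ε δ)).bind (LTile.edges δ)).map F).sum =
      (((P.bind (LTile.edges δ)).bind (subEdge ε)).map F).sum := by
  simp only [Multiset.bind_assoc, Multiset.map_bind, Multiset.sum_bind]
  refine congrArg Multiset.sum (Multiset.map_congr rfl fun t ht => ?_)
  simpa only [Multiset.map_bind, Multiset.sum_bind] using hF.sum_edges_children ε δ (hP t ht)

theorem Antisymm.sum_edges_wheelPatch {F : Edge → ℤ} (hF : Antisymm F) (ε δ c : Bool) (n : ℕ) :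
    (((wheelPatch ε δ c n).bind (LTile.edges δ)).map F).sum = ((boundary ε c n).map F).sum := by
  induction n generalizing F with
  | zero => exact hF.sum_edges_wheel ε δ c
  | succ n ih =>
    have h_rule : ∀ t ∈ wheelPatch ε δ c n, t.kind.HasRule :=
      fun t ht => (isAdmissible_of_mem_wheelPatch t ht).1
    rw [wheelPatch_succ, boundary_succ, hF.sum_edges_bind_children ε δ h_rule]
    simpa only [Multiset.map_bind, Multiset.sum_bind] using ih (hF.sum_subEdge ε)

/-- Lattice edges. -/
def Edge.isLat : Edge → Bool
  | .lat _ _ _ _ => true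
  | _ => false

theorem subEdge_lat_bounds : ∀ (ε : Bool) (j : Fin 12) (x y : Bool),
    ∀ e ∈ subEdge ε (.lat 0 j x y), e.isLat = true ∧
      SurdNonpos (ratPart e.base - 9) (irrPart e.base) ∧ SmallInternal e.base := by
  decide +kernel

theorem rimEdges_bounds : ∀ (c : Bool), ∀ e ∈ rimEdges c, e.isLat = true ∧
    SmallInternal e.base ∧ ratPart e.base = 2 ∧ irrPart e.base = 1 := by
  decide +kernel

theorem exists_of_mem_subEdge_of_isLat {ε : Bool} {e f : Edge} (he : e.isLat)
    (hf : f ∈ subEdge ε e) :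
    f.isLat ∧ ∃ q, f.base = inflate e.base + q ∧ ‖phys q‖ ≤ 3 ∧ ‖internal q‖ ≤ 1.37 := by
  match e, he with
  | .lat p j x y, _ =>
    have h_translate : Edge.lat p j x y = (Edge.lat 0 j x y).act false p := by
      simp [Edge.act, halfTurn, turnIdx]
    rw [h_translate, subEdge_act] at hf
    obtain ⟨g, hg, rfl⟩ := Multiset.mem_map.1 hf
    obtain ⟨h_lat, h_phys, h_internal⟩ := subEdge_lat_bounds ε j x y g hg
    refine ⟨by cases g <;> exact h_lat, g.base, g.base_act _ _, ?_, h_internal.norm_le⟩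
    have h_le := h_phys.le
    push_cast at h_le
    refine le_of_sq_le_sq ?_ (by norm_num)
    rw [norm_phys_sq]
    linarith

theorem bounds_of_mem_boundary {ε c : Bool} {n : ℕ} : ∀ e ∈ boundary ε c n,
    e.isLat ∧ 1.9 + 2 * n ≤ ‖phys e.base‖ ∧ ‖internal e.base‖ ≤ 1.9 := by
  have lt_sqrt := sqrt_three_bounds.1
  induction n with
  | zero =>
    intro e he
    obtain ⟨h_lat, h_internal, h_rat, h_irr⟩ := rimEdges_bounds c e he
    refine ⟨h_lat, le_of_sq_le_sq ?_ (norm_nonneg _), h_internal.norm_le.trans (by norm_num)⟩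
    rw [norm_phys_sq, h_rat, h_irr]
    norm_num
    linarith
  | succ n ih =>
    intro f hf
    rw [boundary_succ] at hf
    obtain ⟨e, he, hfe⟩ := Multiset.mem_bind.1 hf
    obtain ⟨h_lat, h_phys, h_internal⟩ := ih e he
    obtain ⟨hf_lat, q, hq, hq_phys, hq_internal⟩ := exists_of_mem_subEdge_of_isLat h_lat hfe
    have h_grow := norm_phys_inflate_add e.base q
    rw [hq]
    refine ⟨hf_lat, ?_, norm_internal_inflate_add_le h_internal hq_internal⟩
    push_cast
    nlinarith

theorem le_norm_reshape_of_mem_boundary {ε c : Bool} {n : ℕ} {e : Edge}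
    (he : e ∈ boundary ε c n) : 1 + 2 * n ≤ ‖reshape e.base‖ := by
  obtain ⟨-, h_phys, h_internal⟩ := bounds_of_mem_boundary e he
  have := norm_reshape_ge e.base
  have : (0 : ℝ) ≤ n := n.cast_nonneg
  linarith

/-! ### Triangles that stay away from the origin -/

/-- The first corner is at least as far from the origin as the rim of the wheel. -/
def LTile.IsFar (t : LTile) : Prop := SurdNonpos (2 - ratPart t.pos) (1 - irrPart t.pos)

instance (t : LTile) : Decidable t.IsFar := inferInstanceAs (Decidable (SurdNonpos _ _))

/-- The radius of a wheel in the square-triangle tiling. -/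
noncomputable def wheelRadius : ℝ := √(2 + √3)

theorem wheelRadius_sq : wheelRadius ^ 2 = 2 + √3 := Real.sq_sqrt (by positivity)

theorem wheelRadius_nonneg : 0 ≤ wheelRadius := Real.sqrt_nonneg _

theorem LTile.IsFar.le_norm_phys {t : LTile} (ht : t.IsFar) : wheelRadius ≤ ‖phys t.pos‖ := by
  have h_le := SurdNonpos.le ht
  push_cast at h_le
  refine le_of_sq_le_sq ?_ (norm_nonneg _)
  rw [wheelRadius_sq, norm_phys_sq]
  linarith

theorem norm_phys_pos_le_of_mem_rule {ε δ : Bool} {κ : Kind} (hκ : κ.HasRule) {s : LTile}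
    (hs : s ∈ rule ε δ κ) : ‖phys s.pos‖ ≤ (1 + √3) * wheelRadius := by
  have h_le := (pos_bounds_of_mem_rule ε δ κ hκ s hs).1.le
  push_cast at h_le
  refine le_of_sq_le_sq ?_ (mul_nonneg (by positivity) wheelRadius_nonneg)
  rw [norm_phys_sq, mul_pow, wheelRadius_sq]
  nlinarith [sqrt_three_mul_self]

theorem wheelRadius_le_norm_phys_of_mem_children {ε δ : Bool} {t : LTile} (ht : t.kind.HasRule)
    (h : wheelRadius ≤ ‖phys t.pos‖) :
    ∀ s ∈ children ε δ t, wheelRadius ≤ ‖phys s.pos‖ := by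
  intro s hs
  obtain ⟨u, hu, rfl⟩ := mem_children.1 hs
  have h_grow := norm_phys_inflate_add t.pos (halfTurn t.rot u.pos)
  rw [map_halfTurn, norm_halfTurn] at h_grow
  have h_offset := norm_phys_pos_le_of_mem_rule ht hu
  calc wheelRadius = (2 + √3) * wheelRadius - (1 + √3) * wheelRadius := by ring
    _ ≤ (2 + √3) * ‖phys t.pos‖ - ‖phys u.pos‖ := by gcongr
    _ ≤ _ := h_grow

theorem lt_norm_reshape_of_forall_isFar {ε δ : Bool} {P : Multiset LTile}
    (hP : ∀ t ∈ P, t.IsAdmissible) (hfar : ∀ t ∈ P, t.IsFar) {n : ℕ} {t : LTile}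
    (ht : t ∈ descendants ε δ n P) : 1.5 < ‖reshape t.pos‖ := by
  obtain ⟨h_adm, h_far⟩ := forall_mem_descendants (ε := ε) (δ := δ)
    (p := fun t => t.IsAdmissible ∧ wheelRadius ≤ ‖phys t.pos‖)
    (fun t ht s hs => ⟨LTile.IsAdmissible.of_mem_children t ht.1 s hs,
      wheelRadius_le_norm_phys_of_mem_children ht.1.1 ht.2 s hs⟩)
    (fun t ht => ⟨hP t ht, (hfar t ht).le_norm_phys⟩) n t ht
  have h_radius : 1.93 ≤ wheelRadius := by
    refine le_of_sq_le_sq ?_ wheelRadius_nonneg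
    rw [wheelRadius_sq]
    linarith [sqrt_three_bounds.1]
  linarith [norm_reshape_ge t.pos, h_adm.2]

/-- The triangles of the wheel whose first corner is not on the rim. -/
def hub (ε δ c : Bool) : Multiset LTile := (wheel ε δ c).filter fun t => ¬ t.IsFar

theorem filter_bind_children_hub : ∀ ε δ c : Bool,
    ((hub ε δ c).bind (children ε δ)).filter (fun t => ¬ t.IsFar) = hub ε δ (c ^^ ε) := by
  decide +kernel

theorem wheel_subset_bind_children : ∀ ε δ c : Bool,
    wheel ε δ (c ^^ ε) ⊆ (wheel ε δ c).bind (children ε δ) := by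
  simp only [Multiset.subset_iff]
  decide +kernel

/-! ### The corners of a triangle in the lattice

All lifts of corners are doubled, so that the centres of squares are included. -/

/-- The lifted corner at the right angle of an unrotated triangle at the origin. -/
def Kind.apexLift (δ : Bool) : Kind → Addr
  | .tri k _ _ _ => if k then (0, 0, 0, 2) else 0
  | .quarter k _ _ => if k then (-1, 1, 1, 0) else (-1, -1, 1, 0)
  | .half k _ _ _ =>
    if k then (if δ then (0, -2, 0, 2) else (0, 0, 2, 0))
    else (if δ then (0, 0, 0, 2) else (2, 0, 0, 0))

/-- The orientation of an unrotated triangle: in direction `i ^ k` from the right angle there is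
one leg, and the other one follows counterclockwise. -/
def Kind.ori (δ : Bool) : Kind → Fin 4
  | .tri k _ _ _ => if k then 3 else 0
  | .quarter k _ _ => if k then 3 else 0
  | .half k _ _ _ => if k then (if δ then 3 else 2) else (if δ then 2 else 1)

/-- The lift of the horizontal leg, from left to right. -/
def Kind.hor : Kind → Addr
  | .tri k _ _ _ => if k then (0, 2, 0, -2) else (2, 0, 0, 0)
  | .quarter _ _ _ => (1, 1, -1, 0)
  | .half k _ _ _ => if k then (0, 2, 0, -2) else (2, 0, 0, 0)

/-- The lift of the vertical leg, upwards. -/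
def Kind.ver : Kind → Addr
  | .tri k _ _ _ => if k then (0, 0, 0, 2) else (0, 0, 2, 0)
  | .quarter _ _ _ => (-1, 1, 1, 0)
  | .half k _ _ _ => if k then (0, 0, 2, 0) else (0, 0, 0, 2)

/-- The lift of the leg in direction `i ^ k`. -/
def Kind.leg (κ : Kind) (k : Fin 4) : Addr :=
  match k with
  | 0 => κ.hor
  | 1 => κ.ver
  | 2 => -κ.hor
  | 3 => -κ.ver

/-- The lifted end points of an edge. -/
def Edge.ends : Edge → Addr × Addr
  | .lat p j _ _ => (p + p, p + p + (dir j + dir j))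
  | .leg p j _ o =>
    if o then (p + p, p + p + (dir j + dir (j + 3 : Fin 12)))
    else (p + p + (dir j + dir (j + 3 : Fin 12)), p + p)
  | .diag p j _ _ =>
    (p + p, p + p + (dir j + dir (j + 3 : Fin 12) + (dir j + dir (j + 3 : Fin 12))))

/-- The lifted corner at the right angle of a triangle. -/
def LTile.apexLift (δ : Bool) (t : LTile) : Addr :=
  t.pos + t.pos + halfTurn t.rot (t.kind.apexLift δ)

/-- The orientation of a triangle, encoded as in `Kind.ori`. -/
def LTile.ori (δ : Bool) (t : LTile) : Fin 4 := t.kind.ori δ + if t.rot then 2 else 0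

/-- The three directed sides of a triangle with right angle at `a` and legs `u` and `v`. -/
def sides (a u v : Addr) : Multiset (Addr × Addr) := {(a, a + u), (a + u, a + v), (a + v, a)}

theorem Kind.map_ends_edges : ∀ (δ : Bool) (κ : Kind), (κ.edges δ).map Edge.ends =
    sides (κ.apexLift δ) (κ.leg (κ.ori δ)) (κ.leg (κ.ori δ + 1)) := by
  decide +kernel

theorem Kind.leg_add_two (κ : Kind) (k : Fin 4) : κ.leg (k + 2) = -κ.leg k := by
  fin_cases k <;> simp [Kind.leg]

theorem Edge.ends_act (r : Bool) (q : Addr) (e : Edge) :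
    (e.act r q).ends = (q + q + halfTurn r e.ends.1, q + q + halfTurn r e.ends.2) := by
  cases e with
  | lat p j x y =>
    cases r <;> simp [Edge.act, Edge.ends, halfTurn, turnIdx, dir_add_six] <;>
      constructor <;> abel
  | leg p j x o =>
    cases r <;> cases o <;> simp [Edge.act, Edge.ends, halfTurn, turnIdx, dir_add_six,
      add_six_add_three, dir_add_nine] <;> constructor <;> abel
  | diag p j x z =>
    cases r <;> simp [Edge.act, Edge.ends, halfTurn, turnIdx, dir_add_six,
      add_six_add_three, dir_add_nine] <;> constructor <;> abel

theorem Edge.ends_rev (e : Edge) : e.rev.ends = (e.ends.2, e.ends.1) := by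
  cases e with
  | lat p j x y => simp [Edge.rev, Edge.ends, dir_add_six]; constructor <;> abel
  | leg p j x o => cases o <;> simp [Edge.rev, Edge.ends]
  | diag p j x z =>
    simp [Edge.rev, Edge.ends, dir_add_six, add_six_add_three, dir_add_nine]
    constructor <;> abel

theorem map_halfTurn_sides (r : Bool) (q a u v : Addr) :
    (sides a u v).map (fun x => (q + halfTurn r x.1, q + halfTurn r x.2)) =
      sides (q + halfTurn r a) (halfTurn r u) (halfTurn r v) := by
  cases r
  · simp only [sides, halfTurn, Multiset.insert_eq_cons, Multiset.map_cons,
      Multiset.map_singleton, Bool.false_eq_true, if_false, add_assoc]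
  · simp only [sides, halfTurn, Multiset.insert_eq_cons, Multiset.map_cons,
      Multiset.map_singleton, if_true, neg_add, add_assoc]

theorem LTile.leg_ori_add (δ : Bool) (t : LTile) (k : Fin 4) :
    t.kind.leg (t.ori δ + k) = halfTurn t.rot (t.kind.leg (t.kind.ori δ + k)) := by
  cases h : t.rot <;> simp [LTile.ori, h, halfTurn, add_right_comm _ 2 k, Kind.leg_add_two]

theorem LTile.map_ends_edges (δ : Bool) (t : LTile) : (t.edges δ).map Edge.ends =
    sides (t.apexLift δ) (t.kind.leg (t.ori δ)) (t.kind.leg (t.ori δ + 1)) := by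
  have h_leg := t.leg_ori_add δ 0
  rw [add_zero, add_zero] at h_leg
  rw [h_leg, t.leg_ori_add, LTile.apexLift, ← map_halfTurn_sides, ← Kind.map_ends_edges]
  simp only [LTile.edges, Multiset.map_map, Function.comp_def, Edge.ends_act]

/-! ### Cells of the square lattice -/

/-- The reshaping in integer coordinates. -/
def flat : Addr →+ ℤ × ℤ :=
  AddMonoidHom.mk' (fun p => (p.1 + p.2.1, p.2.1 + p.2.2.1 + p.2.2.2)) fun p q => by
    simp only [Prod.fst_add, Prod.snd_add, Prod.mk_add_mk, Prod.mk.injEq]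
    constructor <;> ring

/-- The unit step in direction `i ^ k`. -/
def step (k : Fin 4) : ℤ × ℤ :=
  match k with
  | 0 => (1, 0)
  | 1 => (0, 1)
  | 2 => (-1, 0)
  | 3 => (0, -1)

/-- The right angle of a triangle in the square lattice, relative to its first corner. -/
def Kind.apexOff (δ : Bool) : Kind → ℤ × ℤ
  | .tri k _ _ _ => if k then (0, 1) else 0
  | .quarter k _ _ => if k then (0, 1) else (-1, 0)
  | .half k _ _ _ =>
    if k then (if δ then (-1, 0) else (0, 1)) else (if δ then (0, 1) else (1, 0))

/-- The right angle of a triangle in the square lattice. -/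
def LTile.apex (δ : Bool) (t : LTile) : ℤ × ℤ := flat t.pos + halfTurn t.rot (t.kind.apexOff δ)

theorem Kind.flat_leg : ∀ (κ : Kind) (k : Fin 4), flat (κ.leg k) = step k + step k := by
  decide +kernel

theorem Kind.flat_apexLift : ∀ (δ : Bool) (κ : Kind),
    flat (κ.apexLift δ) = κ.apexOff δ + κ.apexOff δ := by
  decide +kernel

theorem LTile.flat_apexLift (δ : Bool) (t : LTile) :
    flat (t.apexLift δ) = t.apex δ + t.apex δ := by
  rw [LTile.apexLift, LTile.apex, map_add, map_add, map_halfTurn, Kind.flat_apexLift]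
  cases t.rot <;> simp only [halfTurn, if_true, if_false, Bool.false_eq_true] <;> abel

/-- The lower left corner of the unit cell that contains the triangle with right angle `a` and
orientation `k`. -/
def cellOf (a : ℤ × ℤ) (k : Fin 4) : ℤ × ℤ :=
  match k with
  | 0 => a
  | 1 => (a.1 - 1, a.2)
  | 2 => (a.1 - 1, a.2 - 1)
  | 3 => (a.1, a.2 - 1)

/-- The lower left corner of the unit cell that contains a triangle. -/
def LTile.cell (δ : Bool) (t : LTile) : ℤ × ℤ := cellOf (t.apex δ) (t.ori δ)

/-- The triangle covers the quarter `q` of the cell with lower left corner `z`; the quarters cut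
out by the two diagonals are numbered west, south, east, north. -/
def LTile.Covers (δ : Bool) (t : LTile) (z : ℤ × ℤ) (q : Fin 4) : Prop :=
  t.cell δ = z ∧ (q = t.ori δ ∨ q = t.ori δ + 1)

instance (δ : Bool) (t : LTile) (z : ℤ × ℤ) (q : Fin 4) : Decidable (t.Covers δ z q) :=
  inferInstanceAs (Decidable (_ ∧ _))

/-- Indicator function of the quarters covered by a triangle with right angle `a` and
orientation `k`. -/
def covAt (a : ℤ × ℤ) (k : Fin 4) (z : ℤ × ℤ) (q : Fin 4) : ℤ :=
  if cellOf a k = z ∧ (q = k ∨ q = k + 1) then 1 else 0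

/-- Indicator function of `Covers`. -/
def LTile.cov (δ : Bool) (z : ℤ × ℤ) (q : Fin 4) (t : LTile) : ℤ :=
  covAt (t.apex δ) (t.ori δ) z q

theorem LTile.cov_eq_ite (δ : Bool) (z : ℤ × ℤ) (q : Fin 4) (t : LTile) :
    t.cov δ z q = if t.Covers δ z q then 1 else 0 := rfl

/-- Signed indicator of the directed segment from `u` to `u + w`; the end points `x` and `y` of the
tested segment are doubled. -/
def crossing (u w : ℤ × ℤ) (x y : ℤ × ℤ) : ℤ :=
  (if x = u + u ∧ y - x = w + w then 1 else 0) - (if y = u + u ∧ x - y = w + w then 1 else 0)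

/-- Signed indicator of the edges above a directed segment of the square lattice. -/
def Edge.crossing (u w : ℤ × ℤ) (e : Edge) : ℤ :=
  OneTriangle.crossing u w (flat e.ends.1) (flat e.ends.2)

theorem antisymm_crossing (u w : ℤ × ℤ) : Antisymm (Edge.crossing u w) := fun e => by
  simp [Edge.crossing, crossing, Edge.ends_rev]

/-- The sum of `crossing` over the sides of the triangle with right angle `a` and orientation
`k`. -/
def crossingAt (u w a : ℤ × ℤ) (k : Fin 4) : ℤ :=
  crossing u w (a + a) (a + a + (step k + step k)) +
    (crossing u w (a + a + (step k + step k)) (a + a + (step (k + 1) + step (k + 1))) +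
      crossing u w (a + a + (step (k + 1) + step (k + 1))) (a + a))

theorem sum_crossing_edges (δ : Bool) (t : LTile) (u w : ℤ × ℤ) :
    ((t.edges δ).map (Edge.crossing u w)).sum = crossingAt u w (t.apex δ) (t.ori δ) := by
  have h : (t.edges δ).map (Edge.crossing u w) =
      ((t.edges δ).map Edge.ends).map fun x => crossing u w (flat x.1) (flat x.2) := by
    rw [Multiset.map_map]
    rfl
  simp only [h, t.map_ends_edges δ, sides, Multiset.insert_eq_cons, Multiset.map_cons,
    Multiset.map_singleton, Multiset.sum_cons, Multiset.sum_singleton, map_add,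
    LTile.flat_apexLift, Kind.flat_leg, crossingAt]

theorem crossingAt_vertical (a : ℤ × ℤ) (k : Fin 4) (x y : ℤ) :
    crossingAt (x, y) (0, 1) a k = covAt a k (x - 1, y) 2 - covAt a k (x, y) 0 := by
  obtain ⟨a, b⟩ := a
  fin_cases k <;> simp [crossingAt, crossing, covAt, step, cellOf] <;> split_ifs <;> omega

theorem crossingAt_horizontal (a : ℤ × ℤ) (k : Fin 4) (x y : ℤ) :
    crossingAt (x, y) (1, 0) a k = covAt a k (x, y) 1 - covAt a k (x, y - 1) 3 := by
  obtain ⟨a, b⟩ := a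
  fin_cases k <;> simp [crossingAt, crossing, covAt, step, cellOf] <;> split_ifs <;> omega

theorem crossingAt_rising (a : ℤ × ℤ) (k : Fin 4) (x y : ℤ) :
    crossingAt (x, y) (1, 1) a k = covAt a k (x, y) 3 - covAt a k (x, y) 2 := by
  obtain ⟨a, b⟩ := a
  fin_cases k <;> simp [crossingAt, crossing, covAt, step, cellOf] <;> split_ifs <;> omega

theorem crossingAt_falling_west (a : ℤ × ℤ) (k : Fin 4) (x y : ℤ) :
    crossingAt (x + 1, y) (-1, 1) a k = covAt a k (x, y) 0 - covAt a k (x, y) 3 := by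
  obtain ⟨a, b⟩ := a
  fin_cases k <;> simp [crossingAt, crossing, covAt, step, cellOf] <;> split_ifs <;> omega

theorem crossingAt_falling_south (a : ℤ × ℤ) (k : Fin 4) (x y : ℤ) :
    crossingAt (x + 1, y) (-1, 1) a k = covAt a k (x, y) 1 - covAt a k (x, y) 2 := by
  obtain ⟨a, b⟩ := a
  fin_cases k <;> simp [crossingAt, crossing, covAt, step, cellOf] <;> split_ifs <;> omega

/-! ### Every quarter of a cell is covered exactly once -/

/-- The embedding of the square lattice in the plane. -/
noncomputable def toPlane : ℤ × ℤ →+ ℂ :=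
  AddMonoidHom.mk' (fun z => (z.1 : ℂ) + (z.2 : ℂ) * Complex.I) fun z w => by
    push_cast [Prod.fst_add, Prod.snd_add]
    ring

theorem toPlane_flat (p : Addr) : toPlane (flat p) = reshape p := rfl

theorem eventually_flat_base_notMem_of_mem_boundary (ε : Bool) (S : Finset (ℤ × ℤ)) :
    ∀ᶠ n in atTop, ∀ c, ∀ e ∈ boundary ε c n, flat e.base ∉ S := by
  have h_far : ∀ᶠ n : ℕ in atTop, ∀ z ∈ S, ‖toPlane z‖ < n :=
    (Finset.eventually_all S).2 fun z _ => tendsto_natCast_atTop_atTop.eventually_gt_atTop _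
  filter_upwards [h_far] with n hn c e he h_mem
  have h_lt := hn _ h_mem
  rw [toPlane_flat] at h_lt
  have := le_norm_reshape_of_mem_boundary he
  have : (0 : ℝ) ≤ n := n.cast_nonneg
  linarith

theorem Antisymm.eventually_sum_edges_wheelPatch_eq_zero {F : Edge → ℤ} (hF : Antisymm F)
    (ε δ : Bool) {S : Finset (ℤ × ℤ)} (hS : ∀ e, e.isLat → flat e.base ∉ S → F e = 0) :
    ∀ᶠ n in atTop, ∀ c, (((wheelPatch ε δ c n).bind (LTile.edges δ)).map F).sum = 0 := by
  filter_upwards [eventually_flat_base_notMem_of_mem_boundary ε S] with n hn c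
  rw [hF.sum_edges_wheelPatch]
  refine Multiset.sum_eq_zero fun x hx => ?_
  obtain ⟨e, he, rfl⟩ := Multiset.mem_map.1 hx
  exact hS e (bounds_of_mem_boundary e he).1 (hn c e he)

theorem crossing_eq_zero {u w : ℤ × ℤ} {e : Edge} (he : e.isLat)
    (h : flat e.base ∉ ({u, u + w} : Finset (ℤ × ℤ))) : e.crossing u w = 0 := by
  match e, he with
  | .lat p j x y, _ =>
    rw [Finset.mem_insert, Finset.mem_singleton, not_or] at h
    have of_double {v : ℤ × ℤ} (hv : flat (p + p) = v + v) : flat p = v := by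
      rw [map_add] at hv
      simp only [Prod.ext_iff, Prod.fst_add, Prod.snd_add] at hv
      ext <;> omega
    rw [Edge.crossing, crossing, if_neg fun hx => h.1 (of_double hx.1), if_neg, sub_zero]
    rintro ⟨hy, hxy⟩
    refine h.2 (of_double ?_)
    change flat (Edge.lat p j x y).ends.1 = _
    rw [sub_eq_iff_eq_add.1 hxy, hy]
    abel

theorem eventually_sum_crossingAt_eq_zero (ε δ : Bool) (u w : ℤ × ℤ) : ∀ᶠ n in atTop, ∀ c,
    ((wheelPatch ε δ c n).map fun t => crossingAt u w (t.apex δ) (t.ori δ)).sum = 0 := by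
  filter_upwards [(antisymm_crossing u w).eventually_sum_edges_wheelPatch_eq_zero ε δ
    fun e => crossing_eq_zero] with n hn c
  rw [← hn c, Multiset.map_bind, Multiset.sum_bind]
  simp only [sum_crossing_edges]

/-- How often a quarter of a cell is covered by the `n`-th patch. -/
def mult (ε δ c : Bool) (n : ℕ) (z : ℤ × ℤ) (q : Fin 4) : ℤ :=
  ((wheelPatch ε δ c n).map (LTile.cov δ z q)).sum

/-- Two quarters are covered equally often by all sufficiently late patches. -/
def EventuallyEqMult (ε δ : Bool) (a b : (ℤ × ℤ) × Fin 4) : Prop :=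
  ∀ᶠ n in atTop, ∀ c, mult ε δ c n a.1 a.2 = mult ε δ c n b.1 b.2

theorem EventuallyEqMult.symm {ε δ : Bool} {a b : (ℤ × ℤ) × Fin 4}
    (h : EventuallyEqMult ε δ a b) : EventuallyEqMult ε δ b a :=
  h.mono fun _ hn c => (hn c).symm

theorem EventuallyEqMult.trans {ε δ : Bool} {a b d : (ℤ × ℤ) × Fin 4}
    (h : EventuallyEqMult ε δ a b) (h' : EventuallyEqMult ε δ b d) : EventuallyEqMult ε δ a d := by
  filter_upwards [h, h'] with n hn hn' c using (hn c).trans (hn' c)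

theorem eventuallyEqMult_of_crossingAt (ε δ : Bool) {a b : (ℤ × ℤ) × Fin 4} {u w : ℤ × ℤ}
    (h : ∀ p k, crossingAt u w p k = covAt p k a.1 a.2 - covAt p k b.1 b.2) :
    EventuallyEqMult ε δ a b := by
  filter_upwards [eventually_sum_crossingAt_eq_zero ε δ u w] with n hn c
  have h_sum := hn c
  simp only [h, Multiset.sum_map_sub] at h_sum
  exact sub_eq_zero.1 h_sum

theorem eventuallyEqMult_quarter (ε δ : Bool) (z : ℤ × ℤ) (q : Fin 4) :
    EventuallyEqMult ε δ (z, q) (z, 0) := by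
  obtain ⟨x, y⟩ := z
  have h_three : EventuallyEqMult ε δ ((x, y), 3) ((x, y), 0) :=
    (eventuallyEqMult_of_crossingAt ε δ fun p k => crossingAt_falling_west p k x y).symm
  have h_two : EventuallyEqMult ε δ ((x, y), 2) ((x, y), 0) :=
    (eventuallyEqMult_of_crossingAt ε δ fun p k => crossingAt_rising p k x y).symm.trans h_three
  fin_cases q
  · exact .of_forall fun _ _ => rfl
  · exact (eventuallyEqMult_of_crossingAt ε δ
      fun p k => crossingAt_falling_south p k x y).trans h_two
  · exact h_two
  · exact h_three

theorem eventuallyEqMult_left (ε δ : Bool) (x y : ℤ) :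
    EventuallyEqMult ε δ ((x - 1, y), 0) ((x, y), 0) :=
  (eventuallyEqMult_quarter ε δ (x - 1, y) 2).symm.trans
    (eventuallyEqMult_of_crossingAt ε δ fun p k => crossingAt_vertical p k x y)

theorem eventuallyEqMult_below (ε δ : Bool) (x y : ℤ) :
    EventuallyEqMult ε δ ((x, y - 1), 0) ((x, y), 0) :=
  ((eventuallyEqMult_quarter ε δ (x, y - 1) 3).symm.trans
    (eventuallyEqMult_of_crossingAt ε δ fun p k => crossingAt_horizontal p k x y).symm).trans
    (eventuallyEqMult_quarter ε δ (x, y) 1)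

theorem eventuallyEqMult_zero (ε δ : Bool) (z : ℤ × ℤ) (q : Fin 4) :
    EventuallyEqMult ε δ (z, q) (0, 0) := by
  obtain ⟨x, y⟩ := z
  have h_column : EventuallyEqMult ε δ ((0, y), 0) (0, 0) := by
    induction y using Int.induction_on with
    | zero => exact .of_forall fun _ _ => rfl
    | succ i ih => exact .trans (by simpa using (eventuallyEqMult_below ε δ 0 (i + 1)).symm) ih
    | pred i ih => exact (eventuallyEqMult_below ε δ 0 (-i)).trans ih
  have h_row : EventuallyEqMult ε δ ((x, y), 0) ((0, y), 0) := by
    induction x using Int.induction_on with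
    | zero => exact .of_forall fun _ _ => rfl
    | succ i ih => exact .trans (by simpa using (eventuallyEqMult_left ε δ (i + 1) y).symm) ih
    | pred i ih => exact (eventuallyEqMult_left ε δ (-i) y).trans ih
  exact (eventuallyEqMult_quarter ε δ (x, y) q).trans (h_row.trans h_column)

theorem Kind.apexOff_of_cellOf : ∀ (δ : Bool) (κ : Kind) (r : Bool),
    -cellOf (halfTurn r (κ.apexOff δ)) (κ.ori δ + if r then 2 else 0) ∈
      ({0, 1} : Finset ℤ) ×ˢ ({0, 1} : Finset ℤ) := by
  decide +kernel

theorem cellOf_add (u a : ℤ × ℤ) (k : Fin 4) : cellOf (u + a) k = u + cellOf a k := by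
  fin_cases k <;> simp [cellOf, Prod.ext_iff] <;> omega

theorem LTile.cov_zero_eq_zero {δ : Bool} {t : LTile} (h : 1.5 < ‖reshape t.pos‖) :
    t.cov δ 0 0 = 0 := by
  rw [LTile.cov_eq_ite, if_neg]
  rintro ⟨h_cell, -⟩
  rw [LTile.cell, LTile.apex, cellOf_add, add_eq_zero_iff_eq_neg] at h_cell
  have h_mem := Kind.apexOff_of_cellOf δ t.kind t.rot
  rw [← LTile.ori, ← h_cell] at h_mem
  simp only [Finset.mem_product, Finset.mem_insert, Finset.mem_singleton] at h_mem
  have h_norm : ‖reshape t.pos‖ ^ 2 ≤ 2 := by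
    rw [← toPlane_flat, ← Complex.normSq_eq_norm_sq, Complex.normSq_apply]
    rcases h_mem with ⟨hx | hx, hy | hy⟩ <;> norm_num [toPlane, hx, hy]
  nlinarith

theorem sum_cov_hub : ∀ ε δ c : Bool, ((hub ε δ c).map (LTile.cov δ 0 0)).sum = 1 := by
  decide +kernel

theorem sum_cov_descendants_filter {ε δ : Bool} {P : Multiset LTile}
    (hP : ∀ t ∈ P, t.IsAdmissible) (n : ℕ) :
    ((descendants ε δ n (P.filter fun t => ¬ t.IsFar)).map (LTile.cov δ 0 0)).sum =
      ((descendants ε δ n P).map (LTile.cov δ 0 0)).sum := by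
  conv_rhs => rw [← Multiset.filter_add_not LTile.IsFar P]
  rw [descendants_add, Multiset.map_add, Multiset.sum_add, right_eq_add]
  refine Multiset.sum_eq_zero fun x hx => ?_
  obtain ⟨t, ht, rfl⟩ := Multiset.mem_map.1 hx
  exact LTile.cov_zero_eq_zero (lt_norm_reshape_of_forall_isFar
    (fun t ht => hP t (Multiset.mem_filter.1 ht).1) (fun t ht => (Multiset.mem_filter.1 ht).2) ht)

theorem sum_cov_descendants_hub (ε δ c : Bool) (n : ℕ) :
    ((descendants ε δ n (hub ε δ c)).map (LTile.cov δ 0 0)).sum = 1 := by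
  induction n generalizing c with
  | zero => exact sum_cov_hub ε δ c
  | succ n ih =>
    have h_hub : ∀ t ∈ hub ε δ c, t.IsAdmissible :=
      fun t ht => isAdmissible_of_mem_wheel t (Multiset.mem_filter.1 ht).1
    rw [← descendants_bind_children, ← sum_cov_descendants_filter, filter_bind_children_hub, ih]
    intro s hs
    obtain ⟨t, ht, hst⟩ := Multiset.mem_bind.1 hs
    exact (h_hub t ht).of_mem_children t s hst

theorem eventually_mult_eq_one (ε δ : Bool) (z : ℤ × ℤ) (q : Fin 4) :
    ∀ᶠ n in atTop, ∀ c, mult ε δ c n z q = 1 := by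
  filter_upwards [eventuallyEqMult_zero ε δ z q] with n hn c
  rw [hn c, ← sum_cov_descendants_hub ε δ c n]
  exact (sum_cov_descendants_filter isAdmissible_of_mem_wheel n).symm

/-! ### Uniqueness and matching in patches -/

theorem LTile.cov_nonneg (δ : Bool) (z : ℤ × ℤ) (q : Fin 4) (t : LTile) : 0 ≤ t.cov δ z q := by
  rw [LTile.cov_eq_ite]
  split_ifs <;> simp only [zero_le_one, le_refl]

theorem LTile.Covers.cov_eq_one {δ : Bool} {z : ℤ × ℤ} {q : Fin 4} {t : LTile}
    (h : t.Covers δ z q) : t.cov δ z q = 1 := if_pos h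

theorem LTile.covers_cell_ori (δ : Bool) (t : LTile) : t.Covers δ (t.cell δ) (t.ori δ) :=
  ⟨rfl, Or.inl rfl⟩

theorem sum_map_nonneg {α M : Type*} [AddCommMonoid M] [PartialOrder M] [IsOrderedAddMonoid M]
    {F : α → M} (hF : ∀ a, 0 ≤ F a) (m : Multiset α) : 0 ≤ (m.map F).sum :=
  Multiset.sum_nonneg fun x hx => by
    obtain ⟨a, -, rfl⟩ := Multiset.mem_map.1 hx
    exact hF a

theorem le_sum_map {α M : Type*} [AddCommMonoid M] [PartialOrder M] [IsOrderedAddMonoid M]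
    {F : α → M} (hF : ∀ a, 0 ≤ F a) {m : Multiset α} {a : α} (ha : a ∈ m) :
    F a ≤ (m.map F).sum := by
  obtain ⟨m, rfl⟩ := Multiset.exists_cons_of_mem ha
  rw [Multiset.map_cons, Multiset.sum_cons]
  exact le_add_of_nonneg_right (sum_map_nonneg hF m)

theorem add_le_sum_map {α M : Type*} [AddCommMonoid M] [PartialOrder M] [IsOrderedAddMonoid M]
    {F : α → M} (hF : ∀ a, 0 ≤ F a) {m : Multiset α} {a b : α} (ha : a ∈ m) (hb : b ∈ m)
    (hab : a ≠ b) : F a + F b ≤ (m.map F).sum := by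
  obtain ⟨m, rfl⟩ := Multiset.exists_cons_of_mem ha
  rw [Multiset.map_cons, Multiset.sum_cons]
  gcongr
  exact le_sum_map hF ((Multiset.mem_cons.1 hb).resolve_left hab.symm)

theorem exists_covers_of_sum_cov_eq_one {δ : Bool} {P : Multiset LTile} {z : ℤ × ℤ} {q : Fin 4}
    (h : (P.map (LTile.cov δ z q)).sum = 1) : ∃ t ∈ P, t.Covers δ z q := by
  by_contra! h_none
  have h_zero : P.map (LTile.cov δ z q) = P.map fun _ => 0 :=
    Multiset.map_congr rfl fun t ht => if_neg (h_none t ht)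
  rw [h_zero, Multiset.map_const', Multiset.sum_replicate, smul_zero] at h
  exact zero_ne_one h

theorem eq_of_covers_of_sum_cov_eq_one {δ : Bool} {P : Multiset LTile} {z : ℤ × ℤ} {q : Fin 4}
    (h : (P.map (LTile.cov δ z q)).sum = 1) {s t : LTile} (hs : s ∈ P) (ht : t ∈ P)
    (hs' : s.Covers δ z q) (ht' : t.Covers δ z q) : s = t := by
  by_contra hst
  have h_le := add_le_sum_map (LTile.cov_nonneg δ z q) hs ht hst
  rw [h, hs'.cov_eq_one, ht'.cov_eq_one] at h_le
  norm_num at h_le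

theorem eq_of_mem_children_of_sum_cov_eq_one {ε δ : Bool} {P : Multiset LTile} {s t u : LTile}
    (h : ((P.bind (children ε δ)).map (LTile.cov δ (u.cell δ) (u.ori δ))).sum = 1)
    (hs : s ∈ P) (ht : t ∈ P) (hus : u ∈ children ε δ s) (hut : u ∈ children ε δ t) : s = t := by
  by_contra hst
  have cov_nonneg := LTile.cov_nonneg δ (u.cell δ) (u.ori δ)
  have one_le (v : LTile) (hv : u ∈ children ε δ v) :
      1 ≤ ((children ε δ v).map (LTile.cov δ (u.cell δ) (u.ori δ))).sum :=
    (u.covers_cell_ori δ).cov_eq_one.ge.trans (le_sum_map cov_nonneg hv)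
  have h_le := add_le_sum_map (fun v => sum_map_nonneg cov_nonneg (children ε δ v)) hs ht hst
  rw [Multiset.map_bind, Multiset.sum_bind] at h
  linarith [one_le s hus, one_le t hut]

/-- The end points of an edge in the square lattice, with doubled coordinates. -/
def Edge.flatEnds (e : Edge) : (ℤ × ℤ) × (ℤ × ℤ) := (flat e.ends.1, flat e.ends.2)

/-- The directed sides, with doubled coordinates, of the triangle with right angle `a` and
orientation `k` in the square lattice. -/
def flatSides (a : ℤ × ℤ) (k : Fin 4) : Multiset ((ℤ × ℤ) × (ℤ × ℤ)) :=
  {(a + a, a + a + (step k + step k)),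
    (a + a + (step k + step k), a + a + (step (k + 1) + step (k + 1))),
    (a + a + (step (k + 1) + step (k + 1)), a + a)}

theorem LTile.map_flatEnds_edges (δ : Bool) (t : LTile) :
    (t.edges δ).map Edge.flatEnds = flatSides (t.apex δ) (t.ori δ) := by
  have h := congrArg (Multiset.map fun x : Addr × Addr => (flat x.1, flat x.2))
    (t.map_ends_edges δ)
  rw [Multiset.map_map] at h
  refine h.trans ?_
  simp only [sides, flatSides, Multiset.insert_eq_cons, Multiset.map_cons,
    Multiset.map_singleton, map_add, LTile.flat_apexLift, Kind.flat_leg]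

theorem nodup_flatSides (a : ℤ × ℤ) (k : Fin 4) : (flatSides a k).Nodup := by
  obtain ⟨a, b⟩ := a
  fin_cases k <;> simp [flatSides, step]

theorem LTile.eq_of_flatEnds_eq {δ : Bool} {t : LTile} {e f : Edge} (he : e ∈ t.edges δ)
    (hf : f ∈ t.edges δ) (h : e.flatEnds = f.flatEnds) : e = f :=
  Multiset.inj_on_of_nodup_map (t.map_flatEnds_edges δ ▸ nodup_flatSides _ _) e he f hf h

/-- A quarter to the left of a directed side, given with doubled coordinates. -/
def leftQuarter (x : (ℤ × ℤ) × (ℤ × ℤ)) : (ℤ × ℤ) × Fin 4 :=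
  let d := x.2 - x.1
  let a := x.1.1 / 2
  let b := x.1.2 / 2
  if d = (2, 0) then ((a, b), 1)
  else if d = (0, 2) then ((a - 1, b), 2)
  else if d = (-2, 0) then ((a - 1, b - 1), 3)
  else if d = (0, -2) then ((a, b - 1), 0)
  else if d = (2, 2) then ((a, b), 3)
  else if d = (-2, 2) then ((a - 1, b), 0)
  else if d = (-2, -2) then ((a - 1, b - 1), 2)
  else ((a, b - 1), 3)

theorem covers_leftQuarter_of_mem_flatSides {a : ℤ × ℤ} {k : Fin 4} {x : (ℤ × ℤ) × (ℤ × ℤ)}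
    (hx : x ∈ flatSides a k) :
    cellOf a k = (leftQuarter x).1 ∧ ((leftQuarter x).2 = k ∨ (leftQuarter x).2 = k + 1) := by
  obtain ⟨a, b⟩ := a
  simp only [flatSides, Multiset.insert_eq_cons, Multiset.mem_cons, Multiset.mem_singleton] at hx
  fin_cases k <;> rcases hx with rfl | rfl | rfl <;>
    simp [leftQuarter, step, cellOf, Prod.ext_iff] <;> omega

theorem LTile.covers_leftQuarter {δ : Bool} {t : LTile} {e : Edge} (he : e ∈ t.edges δ) :
    t.Covers δ (leftQuarter e.flatEnds).1 (leftQuarter e.flatEnds).2 :=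
  covers_leftQuarter_of_mem_flatSides (t.map_flatEnds_edges δ ▸ Multiset.mem_map_of_mem _ he)

theorem Edge.rev_rev (e : Edge) : e.rev.rev = e := by
  cases e <;> simp [Edge.rev, dir_add_six, dir_add_nine, add_six_add_six, add_six_add_three]
  abel

/-- Signed indicator of a marked edge. -/
def edgeIndicator (e f : Edge) : ℤ := (if f = e then 1 else 0) - (if f = e.rev then 1 else 0)

theorem antisymm_edgeIndicator (e : Edge) : Antisymm (edgeIndicator e) := fun f => by
  have rev_involutive : Function.Involutive Edge.rev := Edge.rev_rev
  simp only [edgeIndicator, rev_involutive.injective.eq_iff, rev_involutive.eq_iff, neg_sub]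

theorem rev_mem_of_sum_edgeIndicator_eq_zero {m : Multiset Edge} {e : Edge}
    (h : (m.map (edgeIndicator e)).sum = 0) (he : e ∈ m) : e.rev ∈ m := by
  by_contra h_rev
  have h_eq : m.map (edgeIndicator e) = m.map fun f => if f = e then 1 else 0 :=
    Multiset.map_congr rfl fun f hf => by
      rw [edgeIndicator, if_neg (c := f = e.rev) fun h => h_rev (h ▸ hf), sub_zero]
  have h_le : (1 : ℤ) ≤ (m.map fun f => if f = e then 1 else 0).sum := by
    simpa only [if_true] using
      le_sum_map (F := fun f => if f = e then (1 : ℤ) else 0) (fun f => by positivity) he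
  rw [← h_eq, h] at h_le
  norm_num at h_le

theorem eventually_rev_mem_edges (ε δ : Bool) (e : Edge) : ∀ᶠ n in atTop, ∀ c,
    e ∈ (wheelPatch ε δ c n).bind (LTile.edges δ) →
      e.rev ∈ (wheelPatch ε δ c n).bind (LTile.edges δ) := by
  have h_supp : ∀ f : Edge, f.isLat →
      flat f.base ∉ ({flat e.base, flat e.rev.base} : Finset (ℤ × ℤ)) → edgeIndicator e f = 0 := by
    intro f _ hf
    rw [Finset.mem_insert, Finset.mem_singleton, not_or] at hf
    rw [edgeIndicator, if_neg fun h => hf.1 (by rw [h]), if_neg fun h => hf.2 (by rw [h]),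
      sub_zero]
  filter_upwards [(antisymm_edgeIndicator e).eventually_sum_edges_wheelPatch_eq_zero ε δ h_supp]
    with n hn c using rev_mem_of_sum_edgeIndicator_eq_zero (hn c)

theorem eventually_eq_rev_of_flatEnds_eq (ε δ : Bool) {e f : Edge}
    (h : f.flatEnds = e.rev.flatEnds) : ∀ᶠ n in atTop, ∀ c,
      e ∈ (wheelPatch ε δ c n).bind (LTile.edges δ) →
        f ∈ (wheelPatch ε δ c n).bind (LTile.edges δ) → f = e.rev := by
  filter_upwards [eventually_rev_mem_edges ε δ e, eventually_mult_eq_one ε δ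
    (leftQuarter f.flatEnds).1 (leftQuarter f.flatEnds).2] with n h_rev h_mult c he hf
  obtain ⟨t, ht, hft⟩ := Multiset.mem_bind.1 hf
  obtain ⟨u, hu, heu⟩ := Multiset.mem_bind.1 (h_rev c he)
  obtain rfl : t = u := eq_of_covers_of_sum_cov_eq_one (h_mult c) ht hu
    (LTile.covers_leftQuarter hft) (h ▸ LTile.covers_leftQuarter heu)
  exact LTile.eq_of_flatEnds_eq hft heu h

/-! ### Supertiles inside patches -/

theorem LTile.isAdmissible_of_mem_supertile {ε δ : Bool} {κ : Kind} (hκ : κ.HasRule) {n : ℕ}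
    {t : LTile} (ht : t ∈ supertile ε δ κ n) : t.IsAdmissible := by
  refine forall_mem_descendants LTile.IsAdmissible.of_mem_children ?_ n t (mem_supertile.1 ht)
  intro s hs
  obtain rfl := Multiset.mem_singleton.1 hs
  exact ⟨hκ, by rw [map_zero, norm_zero]; norm_num⟩

theorem mem_map_kind_rot_descendants_two_wheel : ∀ (ε δ : Bool) (κ : Kind), κ.HasRule →
    (κ, false) ∈ (descendants ε δ 2 (wheel ε δ false)).map fun t => (t.kind, t.rot) := by
  decide +kernel

theorem exists_mem_wheelPatch_two (ε δ : Bool) {κ : Kind} (hκ : κ.HasRule) :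
    ∃ p, ⟨κ, false, p⟩ ∈ wheelPatch ε δ false 2 := by
  obtain ⟨⟨κ', r, p⟩, ht, h⟩ :=
    Multiset.mem_map.1 (mem_map_kind_rot_descendants_two_wheel ε δ κ hκ)
  obtain ⟨rfl, rfl⟩ := Prod.mk.inj h
  exact ⟨p, ht⟩

theorem wheelPatch_subset_succ (ε δ c : Bool) (n : ℕ) :
    wheelPatch ε δ c n ⊆ wheelPatch ε δ (c ^^ ε) (n + 1) := by
  have h := descendants_subset ε δ n (wheel_subset_bind_children ε δ (c ^^ ε))
  rwa [Bool.xor_assoc, Bool.xor_self, Bool.xor_false] at h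

theorem exists_wheelPatch_subset_add (ε δ c : Bool) (n k : ℕ) :
    ∃ c', wheelPatch ε δ c n ⊆ wheelPatch ε δ c' (n + k) := by
  induction k with
  | zero => exact ⟨c, fun _ h => h⟩
  | succ k ih =>
    obtain ⟨c', h⟩ := ih
    exact ⟨_, fun _ ht => wheelPatch_subset_succ ε δ c' (n + k) (h ht)⟩

theorem exists_eventually_supertile_subset_wheelPatch (ε δ : Bool) {κ : Kind} (hκ : κ.HasRule)
    (n : ℕ) : ∃ Q : Addr, ∀ᶠ N in atTop, ∃ c, ∀ s ∈ supertile ε δ κ n,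
      s.act false Q ∈ wheelPatch ε δ c N := by
  obtain ⟨p, hp⟩ := exists_mem_wheelPatch_two ε δ hκ
  refine ⟨inflate^[n] p, (eventually_ge_atTop (n + 2)).mono fun N hN => ?_⟩
  obtain ⟨M, rfl⟩ := Nat.exists_eq_add_of_le hN
  obtain ⟨c, hc⟩ := exists_wheelPatch_subset_add ε δ false 2 M
  refine ⟨c, fun s hs => ?_⟩
  have h_seed : Multiset.map (LTile.act false p) {⟨κ, false, 0⟩} ⊆ wheelPatch ε δ c (2 + M) := by
    rw [Multiset.map_singleton, Multiset.singleton_subset]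
    simpa [LTile.act, halfTurn] using hc hp
  have h_grown := descendants_subset ε δ n h_seed
  rw [descendants_act, wheelPatch, descendants_descendants, ← add_assoc] at h_grown
  exact h_grown (Multiset.mem_map_of_mem _ (mem_supertile.1 hs))

theorem LTile.ori_act_false (δ : Bool) (q : Addr) (t : LTile) :
    (t.act false q).ori δ = t.ori δ := by
  simp only [LTile.ori, LTile.act, Bool.false_xor]

theorem LTile.apex_act_false (δ : Bool) (q : Addr) (t : LTile) :
    (t.act false q).apex δ = flat q + t.apex δ := by
  simp only [LTile.apex, LTile.act, halfTurn, Bool.false_xor, Bool.false_eq_true, if_false,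
    map_add, add_assoc]

theorem LTile.Covers.act_false {δ : Bool} {t : LTile} {z : ℤ × ℤ} {q : Fin 4}
    (h : t.Covers δ z q) (p : Addr) : (t.act false p).Covers δ (flat p + z) q := by
  obtain ⟨h_cell, h_quarter⟩ := h
  refine ⟨?_, by rwa [LTile.ori_act_false]⟩
  rw [LTile.cell, LTile.apex_act_false, LTile.ori_act_false, cellOf_add, ← LTile.cell, h_cell]

theorem LTile.act_false_injective (p : Addr) : Function.Injective (LTile.act false p) := by
  rintro ⟨κ, r, q⟩ ⟨κ', r', q'⟩ h
  simpa [LTile.act, halfTurn] using h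

theorem eq_of_covers_of_mem_supertile {ε δ : Bool} {κ : Kind} (hκ : κ.HasRule) {n : ℕ}
    {s t : LTile} (hs : s ∈ supertile ε δ κ n) (ht : t ∈ supertile ε δ κ n) {z : ℤ × ℤ}
    {q : Fin 4} (hs' : s.Covers δ z q) (ht' : t.Covers δ z q) : s = t := by
  obtain ⟨Q, hQ⟩ := exists_eventually_supertile_subset_wheelPatch ε δ hκ n
  obtain ⟨N, ⟨c, h_mem⟩, h_mult⟩ := (hQ.and (eventually_mult_eq_one ε δ (flat Q + z) q)).exists
  exact LTile.act_false_injective Q (eq_of_covers_of_sum_cov_eq_one (h_mult c) (h_mem s hs)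
    (h_mem t ht) (hs'.act_false Q) (ht'.act_false Q))

theorem pairwiseDisjoint_subst_supertile {ε δ : Bool} {κ : Kind} (hκ : κ.HasRule) {n : ℕ} :
    (supertile ε δ κ n : Set LTile).PairwiseDisjoint (subst ε δ) := by
  intro s hs t ht hst
  refine Finset.disjoint_left.2 fun u hus hut => hst ?_
  obtain ⟨Q, hQ⟩ := exists_eventually_supertile_subset_wheelPatch ε δ hκ n
  set v := u.act false (inflate Q)
  have h_succ := (tendsto_add_atTop_nat 1).eventually
    (eventually_mult_eq_one ε δ (v.cell δ) (v.ori δ))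
  obtain ⟨N, ⟨c, h_mem⟩, h_mult⟩ := (hQ.and h_succ).exists
  have h_mult := h_mult c
  rw [mult, wheelPatch_succ] at h_mult
  have h_child {x : LTile} (hx : u ∈ subst ε δ x) : v ∈ children ε δ (x.act false Q) := by
    rw [children_act]
    exact Multiset.mem_map_of_mem _ (mem_subst.1 hx)
  exact LTile.act_false_injective Q (eq_of_mem_children_of_sum_cov_eq_one h_mult (h_mem s hs)
    (h_mem t ht) (h_child hus) (h_child hut))

theorem Edge.flatEnds_act_false (q : Addr) (e : Edge) :
    (e.act false q).flatEnds = (flat (q + q), flat (q + q)) + e.flatEnds := by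
  simp only [Edge.flatEnds, Edge.ends_act, halfTurn, Bool.false_eq_true, if_false, map_add,
    Prod.mk_add_mk]

theorem Edge.act_injective (r : Bool) (q : Addr) : Function.Injective (Edge.act r q) :=
  Function.LeftInverse.injective (g := Edge.act r (-halfTurn r q)) fun e => by
    cases e <;> cases r <;> simp [Edge.act, halfTurn, turnIdx, add_six_add_six]

theorem eq_rev_of_mem_edges_of_mem_supertile {ε δ : Bool} {κ : Kind} (hκ : κ.HasRule) {n : ℕ}
    {s t : LTile} (hs : s ∈ supertile ε δ κ n) (ht : t ∈ supertile ε δ κ n) {e f : Edge}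
    (he : e ∈ s.edges δ) (hf : f ∈ t.edges δ) (h : f.flatEnds = e.rev.flatEnds) : f = e.rev := by
  obtain ⟨Q, hQ⟩ := exists_eventually_supertile_subset_wheelPatch ε δ hκ n
  have h_act : (f.act false Q).flatEnds = (e.act false Q).rev.flatEnds := by
    rw [Edge.rev_act, Edge.flatEnds_act_false, Edge.flatEnds_act_false, h]
  obtain ⟨N, ⟨c, h_mem⟩, h_rev⟩ :=
    (hQ.and (eventually_eq_rev_of_flatEnds_eq ε δ h_act)).exists
  have h_edge {x : LTile} {g : Edge} (hx : x ∈ supertile ε δ κ n) (hg : g ∈ x.edges δ) :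
      g.act false Q ∈ (wheelPatch ε δ c N).bind (LTile.edges δ) :=
    Multiset.mem_bind.2 ⟨_, h_mem x hx, LTile.edges_act δ .. ▸ Multiset.mem_map_of_mem _ hg⟩
  have h_eq := h_rev c (h_edge hs he) (h_edge ht hf)
  rw [Edge.rev_act] at h_eq
  exact Edge.act_injective false Q h_eq

theorem lifts_eq_of_mem_sides_of_mem_supertile {ε δ : Bool} {κ : Kind} (hκ : κ.HasRule) {n : ℕ}
    {s t : LTile} (hs : s ∈ supertile ε δ κ n) (ht : t ∈ supertile ε δ κ n) {a b a' b' : Addr}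
    (hab : (a, b) ∈ sides (s.apexLift δ) (s.kind.leg (s.ori δ)) (s.kind.leg (s.ori δ + 1)))
    (hba : (b', a') ∈ sides (t.apexLift δ) (t.kind.leg (t.ori δ)) (t.kind.leg (t.ori δ + 1)))
    (ha : flat a = flat a') (hb : flat b = flat b') : a = a' ∧ b = b' := by
  rw [← LTile.map_ends_edges] at hab hba
  obtain ⟨e, he, he_ends⟩ := Multiset.mem_map.1 hab
  obtain ⟨f, hf, hf_ends⟩ := Multiset.mem_map.1 hba
  have h_rev := eq_rev_of_mem_edges_of_mem_supertile hκ hs ht he hf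
    (by simp only [Edge.flatEnds, Edge.ends_rev, he_ends, hf_ends, ha, hb])
  rw [h_rev, Edge.ends_rev, he_ends, Prod.mk.injEq] at hf_ends
  exact ⟨hf_ends.2, hf_ends.1⟩

-- The bounds select the few triangles whose patches meet this wheel: the evaluation stays small.
theorem wheel_subset_supertile_three : ∀ ε δ : Bool,
    (wheel ε δ false).map (LTile.act false (if ε then (11, 15, 4, -4) else (10, 19, 13, 2))) ⊆
      ((descendants ε δ 2 {⟨.tri false false true true, false, 0⟩}).filter fun t =>
        2 ≤ t.pos.1 ∧ t.pos.1 ≤ 4 ∧ 4 ≤ t.pos.2.1 ∧ t.pos.2.1 ≤ 6 ∧ -1 ≤ t.pos.2.2.2 ∧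
          t.pos.2.2.2 ≤ 1).bind (children ε δ) := by
  simp only [Multiset.subset_iff]
  decide +kernel

theorem exists_wheelPatch_subset_supertile (ε δ : Bool) (n : ℕ) :
    ∃ Q : Addr, ∀ t ∈ wheelPatch ε δ false n,
      t.act false Q ∈ supertile ε δ (.tri false false true true) (n + 3) := by
  set q : Addr := if ε then (11, 15, 4, -4) else (10, 19, 13, 2)
  refine ⟨inflate^[n] q, fun t ht => ?_⟩
  have h_wheel : (wheel ε δ false).map (LTile.act false q) ⊆
      descendants ε δ 3 {⟨.tri false false true true, false, 0⟩} := by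
    intro s hs
    obtain ⟨u, hu, hsu⟩ := Multiset.mem_bind.1 (wheel_subset_supertile_three ε δ hs)
    exact mem_descendants_succ.2 ⟨u, (Multiset.mem_filter.1 hu).1, hsu⟩
  have h_grown := descendants_subset ε δ n h_wheel
  rw [descendants_act, descendants_descendants] at h_grown
  exact mem_supertile.2 (h_grown (Multiset.mem_map_of_mem _ ht))

/-! ### Triangles in the plane -/

theorem toPlane_re (z : ℤ × ℤ) : (toPlane z).re = z.1 := by
  simp [toPlane]

theorem toPlane_im (z : ℤ × ℤ) : (toPlane z).im = z.2 := by
  simp [toPlane]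

theorem add_toPlane_injective (w : ℂ) : Function.Injective fun z => w + toPlane z := fun u v h => by
  have h := add_left_cancel h
  exact Prod.ext (by exact_mod_cast toPlane_re u ▸ toPlane_re v ▸ congrArg Complex.re h)
    (by exact_mod_cast toPlane_im u ▸ toPlane_im v ▸ congrArg Complex.im h)

/-- The corners of the triangle with right angle `a` and orientation `k` in the square lattice. -/
def latticeCorners (a : ℤ × ℤ) (k : Fin 4) : Finset (ℤ × ℤ) := {a, a + step k, a + step (k + 1)}

/-- The third corner of an unrotated or rotated triangle whose first side has direction `j`,
relative to the first corner. -/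
def Kind.thirdOff (κ : Kind) (j : ℕ) : ℤ × ℤ :=
  match κ with
  | .tri _ _ _ _ => flat (dir (j + 2))
  | .quarter _ _ _ =>
    ((flat (dir j + dir (j + 3))).1 / 2, (flat (dir j + dir (j + 3))).2 / 2)
  | .half _ _ _ _ => flat (dir j + dir (j + 3))

theorem Kind.latticeCorners_apexOff : ∀ (δ r : Bool) (κ : Kind),
    latticeCorners (halfTurn r (κ.apexOff δ)) (κ.ori δ + if r then 2 else 0) =
      {0, flat (dir (κ.firstDir δ + if r then 6 else 0)),
        κ.thirdOff (κ.firstDir δ + if r then 6 else 0)} := by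
  decide +kernel

theorem Kind.thirdOff_quarter_add_self : ∀ (δ r k x y : Bool),
    (Kind.quarter k x y).thirdOff ((Kind.quarter k x y).firstDir δ + if r then 6 else 0) +
      (Kind.quarter k x y).thirdOff ((Kind.quarter k x y).firstDir δ + if r then 6 else 0) =
    flat (dir ((Kind.quarter k x y).firstDir δ + if r then 6 else 0) +
      dir ((Kind.quarter k x y).firstDir δ + (if r then 6 else 0) + 3)) := by
  decide +kernel

theorem reshape_add (p q : Addr) : reshape (p + q) = reshape p + reshape q := by
  simp only [← toPlane_flat, map_add]

theorem LTile.corners_place_zero (δ r : Bool) (κ : Kind) :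
    ((⟨κ, r, 0⟩ : LTile).place 0).corners δ =
      toPlane '' {0, flat (dir (κ.firstDir δ + if r then 6 else 0)),
        κ.thirdOff (κ.firstDir δ + if r then 6 else 0)} := by
  have h_zero : reshape 0 = 0 := toPlane_flat 0 ▸ map_zero _
  simp only [Set.image_insert_eq, Set.image_singleton, PTile.corners, LTile.place, h_zero, zero_add,
    map_zero, toPlane_flat]
  congr 3
  cases κ with
  | tri k x y z => rfl
  | quarter k x y =>
    have h := congrArg toPlane (Kind.thirdOff_quarter_add_self δ r k x y)
    rw [map_add, toPlane_flat, reshape_add] at h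
    simp only [← h, add_self_div_two]
  | half k x y z => simp only [Kind.thirdOff, toPlane_flat, reshape_add]

theorem LTile.corners_place (δ : Bool) (w : ℂ) (t : LTile) : (t.place w).corners δ =
    (fun z => w + toPlane z) '' latticeCorners (t.apex δ) (t.ori δ) := by
  have h_corners := t.kind.latticeCorners_apexOff δ t.rot
  have h_shift : (t.place w).corners δ =
      (w + reshape t.pos + ·) '' ((⟨t.kind, t.rot, 0⟩ : LTile).place 0).corners δ := by
    have h_zero : reshape 0 = 0 := toPlane_flat 0 ▸ map_zero _
    simp only [PTile.corners, LTile.place, Set.image_insert_eq, Set.image_singleton, h_zero,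
      zero_add, add_zero]
    rfl
  have h_apex : latticeCorners (t.apex δ) (t.ori δ) = (latticeCorners
      (halfTurn t.rot (t.kind.apexOff δ)) (t.ori δ)).image (flat t.pos + ·) := by
    simp only [latticeCorners, LTile.apex, Finset.image_insert, Finset.image_singleton, add_assoc]
  rw [h_shift, LTile.corners_place_zero, h_apex, LTile.ori, h_corners, Finset.coe_image,
    Set.image_image, Set.image_image]
  simp only [map_add, toPlane_flat, add_assoc, Finset.coe_insert, Finset.coe_singleton]

theorem mem_convexHull_triple {E : Type*} [AddCommGroup E] [Module ℝ E] {v p q x : E} :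
    x ∈ convexHull ℝ {v, v + p, v + q} ↔
      ∃ r s : ℝ, 0 ≤ r ∧ 0 ≤ s ∧ r + s ≤ 1 ∧ v + (r • p + s • q) = x := by
  constructor
  · intro hx
    refine convexHull_min (t := {x | ∃ r s : ℝ, 0 ≤ r ∧ 0 ≤ s ∧ r + s ≤ 1 ∧
      v + (r • p + s • q) = x}) ?_ ?_ hx
    · rintro y (rfl | rfl | rfl)
      · exact ⟨0, 0, by simp⟩
      · exact ⟨1, 0, by simp⟩
      · exact ⟨0, 1, by simp⟩
    · rintro _ ⟨r, s, hr, hs, hrs, rfl⟩ _ ⟨r', s', hr', hs', hrs', rfl⟩ a b ha hb hab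
      refine ⟨a * r + b * r', a * s + b * s', by positivity, by positivity, by nlinarith, ?_⟩
      obtain rfl := eq_sub_of_add_eq hab
      module
  · rintro ⟨r, s, hr, hs, hrs, rfl⟩
    have h_mem (y : E) (hy : y ∈ ({v, v + p, v + q} : Set E)) :=
      subset_convexHull ℝ _ hy
    have h := (convex_convexHull ℝ {v, v + p, v + q}).sum_mem (t := Finset.univ)
      (w := ![1 - r - s, r, s]) (z := ![v, v + p, v + q])
      (by intro i _; fin_cases i <;> simp <;> linarith) (by simp [Fin.sum_univ_three]; ring)
      (by intro i _; fin_cases i <;> exact h_mem _ (by simp))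
    convert h using 1
    simp only [Fin.sum_univ_three, Matrix.cons_val_zero, Matrix.cons_val_one, Matrix.cons_val]
    module

/-- The half with orientation `k` of the unit cell with lower left corner `c`, in real or in
integer coordinates. -/
def HalfCell {K : Type*} [Ring K] [LE K] (c : ℤ × ℤ) (k : Fin 4) (x y : K) : Prop :=
  c.1 ≤ x ∧ x ≤ c.1 + 1 ∧ c.2 ≤ y ∧ y ≤ c.2 + 1 ∧
    match k with
    | 0 => x + y ≤ c.1 + c.2 + 1
    | 1 => y + c.1 ≤ x + c.2
    | 2 => c.1 + c.2 + 1 ≤ x + y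
    | 3 => x + c.2 ≤ y + c.1

theorem halfCell_iff_exists_legs (a : ℤ × ℤ) (k : Fin 4) (x y : ℝ) : HalfCell (cellOf a k) k x y ↔
    ∃ r s : ℝ, 0 ≤ r ∧ 0 ≤ s ∧ r + s ≤ 1 ∧
      a.1 + (r * (step k).1 + s * (step (k + 1)).1) = x ∧
      a.2 + (r * (step k).2 + s * (step (k + 1)).2) = y := by
  constructor
  · intro h
    refine ⟨(x - a.1) * (step k).1 + (y - a.2) * (step k).2,
      (x - a.1) * (step (k + 1)).1 + (y - a.2) * (step (k + 1)).2, ?_⟩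
    fin_cases k <;> simp [HalfCell, cellOf, step] at h ⊢ <;> grind
  · rintro ⟨r, s, hr, hs, hrs, rfl, rfl⟩
    fin_cases k <;> simp [HalfCell, cellOf, step] <;> grind

theorem LTile.region_place (δ : Bool) (w : ℂ) (t : LTile) : (t.place w).region δ =
    convexHull ℝ {w + toPlane (t.apex δ), w + toPlane (t.apex δ) + toPlane (step (t.ori δ)),
      w + toPlane (t.apex δ) + toPlane (step (t.ori δ + 1))} := by
  simp only [PTile.region, LTile.corners_place, latticeCorners, Finset.coe_insert,
    Finset.coe_singleton, Set.image_insert_eq, Set.image_singleton, map_add, add_assoc]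

theorem LTile.mem_region_place_iff {δ : Bool} {w x : ℂ} {t : LTile} :
    x ∈ (t.place w).region δ ↔ HalfCell (t.cell δ) (t.ori δ) (x - w).re (x - w).im := by
  rw [LTile.region_place, mem_convexHull_triple, LTile.cell, halfCell_iff_exists_legs]
  refine exists_congr fun r => exists_congr fun s => ?_
  rw [add_assoc, ← eq_sub_iff_add_eq', Complex.ext_iff]
  simp only [Complex.add_re, Complex.add_im, Complex.real_smul, Complex.re_ofReal_mul,
    Complex.im_ofReal_mul, toPlane_re, toPlane_im]

/-- A point inside the quarter `q` of the cell `z`. -/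
noncomputable def quarterPoint (z : ℤ × ℤ) (q : Fin 4) : ℂ :=
  match q with
  | 0 => ⟨z.1 + 1 / 6, z.2 + 1 / 2⟩
  | 1 => ⟨z.1 + 1 / 2, z.2 + 1 / 6⟩
  | 2 => ⟨z.1 + 5 / 6, z.2 + 1 / 2⟩
  | 3 => ⟨z.1 + 1 / 2, z.2 + 5 / 6⟩

theorem HalfCell.eq_of_lt_of_lt {c z : ℤ × ℤ} {k : Fin 4} {x y : ℝ} (h : HalfCell c k x y)
    (h_left : z.1 < x) (h_right : x < z.1 + 1) (h_below : z.2 < y) (h_above : y < z.2 + 1) :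
    c = z := by
  obtain ⟨h1, h2, h3, h4, -⟩ := h
  have eq_of_lt {m n : ℤ} (h : (m : ℝ) < n + 1) (h' : (n : ℝ) < m + 1) : m = n := by
    have : m < n + 1 := by exact_mod_cast h
    have : n < m + 1 := by exact_mod_cast h'
    omega
  exact Prod.ext (eq_of_lt (by linarith) (by linarith)) (eq_of_lt (by linarith) (by linarith))

theorem LTile.quarterPoint_mem_region_iff {δ : Bool} {w : ℂ} {t : LTile} {z : ℤ × ℤ} {q : Fin 4} :
    w + quarterPoint z q ∈ (t.place w).region δ ↔ t.Covers δ z q := by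
  rw [LTile.mem_region_place_iff, add_sub_cancel_left, LTile.Covers]
  generalize t.cell δ = c
  generalize t.ori δ = k
  constructor
  · intro h
    obtain rfl : c = z := by
      fin_cases q <;> simp only [quarterPoint] at h <;> apply h.eq_of_lt_of_lt <;> linarith
    refine ⟨rfl, ?_⟩
    fin_cases q <;> fin_cases k <;> simp [HalfCell, quarterPoint] at h ⊢ <;> linarith
  · rintro ⟨rfl, h⟩
    fin_cases k <;> rcases h with rfl | rfl <;> simp [HalfCell, quarterPoint] <;> grind

/-! ### Intersections of triangles -/

theorem LTile.ori_eq_of_cell_eq {δ : Bool} {s t : LTile}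
    (h : ∀ z q, s.Covers δ z q → ¬ t.Covers δ z q) (h_cell : s.cell δ = t.cell δ) :
    t.ori δ = s.ori δ + 2 := by
  have h_fst := fun h' => h (s.cell δ) (s.ori δ) ⟨rfl, Or.inl rfl⟩ ⟨h_cell.symm, h'⟩
  have h_snd := fun h' => h (s.cell δ) (s.ori δ + 1) ⟨rfl, Or.inr rfl⟩ ⟨h_cell.symm, h'⟩
  generalize s.ori δ = k at *
  generalize t.ori δ = l at *
  revert h_fst h_snd k l
  decide

theorem exists_separating_opposite (c : ℤ × ℤ) (k : Fin 4) :
    ∃ α β m : ℝ, (α ≠ 0 ∨ β ≠ 0) ∧ (∀ x y, HalfCell c k x y → α * x + β * y ≤ m) ∧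
      ∀ x y, HalfCell c (k + 2) x y → m ≤ α * x + β * y := by
  fin_cases k
  · refine ⟨1, 1, c.1 + c.2 + 1, by simp, fun x y h => ?_, fun x y h => ?_⟩ <;>
      simp [HalfCell] at h <;> linarith
  · refine ⟨-1, 1, c.2 - c.1, by simp, fun x y h => ?_, fun x y h => ?_⟩ <;>
      simp [HalfCell] at h <;> linarith
  · refine ⟨-1, -1, -(c.1 + c.2 + 1), by simp, fun x y h => ?_, fun x y h => ?_⟩ <;>
      simp [HalfCell] at h <;> linarith
  · refine ⟨1, -1, c.1 - c.2, by simp, fun x y h => ?_, fun x y h => ?_⟩ <;>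
      simp [HalfCell] at h <;> linarith

theorem exists_separating_halfCell {c d : ℤ × ℤ} {k l : Fin 4} (h : c = d → l = k + 2) :
    ∃ α β m : ℝ, (α ≠ 0 ∨ β ≠ 0) ∧ (∀ x y, HalfCell c k x y → α * x + β * y ≤ m) ∧
      ∀ x y, HalfCell d l x y → m ≤ α * x + β * y := by
  have cast {a b : ℤ} (h : a < b) : (a : ℝ) + 1 ≤ b := by exact_mod_cast h
  rcases lt_trichotomy c.1 d.1 with h_fst | h_fst | h_fst
  · exact ⟨1, 0, d.1, by simp, fun x y hx => by linarith [hx.2.1, cast h_fst],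
      fun x y hx => by linarith [hx.1]⟩
  · rcases lt_trichotomy c.2 d.2 with h_snd | h_snd | h_snd
    · exact ⟨0, 1, d.2, by simp, fun x y hx => by linarith [hx.2.2.2.1, cast h_snd],
        fun x y hx => by linarith [hx.2.2.1]⟩
    · obtain rfl : c = d := Prod.ext h_fst h_snd
      obtain rfl := h rfl
      exact exists_separating_opposite c k
    · exact ⟨0, -1, -c.2, by simp, fun x y hx => by linarith [hx.2.2.1],
        fun x y hx => by linarith [hx.2.2.2.1, cast h_snd]⟩
  · exact ⟨-1, 0, -c.1, by simp, fun x y hx => by linarith [hx.1],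
      fun x y hx => by linarith [hx.2.1, cast h_fst]⟩

theorem disjoint_interior_of_separating {E : Type*} [TopologicalSpace E] [AddCommGroup E]
    [IsTopologicalAddGroup E] [Module ℝ E] [ContinuousSMul ℝ E] {g : E →L[ℝ] ℝ} (hg : g ≠ 0)
    {A B : Set E} {m : ℝ} (hA : ∀ x ∈ A, g x ≤ m) (hB : ∀ x ∈ B, m ≤ g x) :
    Disjoint (interior A) (interior B) := by
  have h_open := g.isOpenMap_of_ne_zero hg
  have h_lt : interior A ⊆ g ⁻¹' Set.Iio m := by
    rw [← interior_Iic, h_open.preimage_interior_eq_interior_preimage g.continuous]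
    exact interior_mono hA
  have h_gt : interior B ⊆ g ⁻¹' Set.Ioi m := by
    rw [← interior_Ici, h_open.preimage_interior_eq_interior_preimage g.continuous]
    exact interior_mono hB
  exact (Set.disjoint_left.2 fun x (hx : g x < m) hx' => lt_asymm hx hx').mono h_lt h_gt

theorem disjoint_interior_region {δ : Bool} {s t : LTile}
    (h : ∀ z q, s.Covers δ z q → ¬ t.Covers δ z q) (w : ℂ) :
    Disjoint (interior ((s.place w).region δ)) (interior ((t.place w).region δ)) := by
  obtain ⟨α, β, m, h_ne, hs, ht⟩ := exists_separating_halfCell (LTile.ori_eq_of_cell_eq h)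
  let g : ℂ →L[ℝ] ℝ := α • Complex.reCLM + β • Complex.imCLM
  have hg : g ≠ 0 := fun h0 => h_ne.elim
    (fun h_ne => h_ne (by simpa [g] using DFunLike.congr_fun h0 1))
    fun h_ne => h_ne (by simpa [g] using DFunLike.congr_fun h0 Complex.I)
  have g_apply (x : ℂ) : g x = α * (x - w).re + β * (x - w).im + g w := by simp [g]; ring
  refine disjoint_interior_of_separating hg (m := m + g w) (fun x hx => ?_) fun x hx => ?_
  · linarith [g_apply x, hs _ _ (LTile.mem_region_place_iff.1 hx)]
  · linarith [g_apply x, ht _ _ (LTile.mem_region_place_iff.1 hx)]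

theorem mem_latticeCorners_iff {a p : ℤ × ℤ} {k : Fin 4} :
    p ∈ latticeCorners a k ↔ HalfCell (cellOf a k) k p.1 p.2 := by
  obtain ⟨a, b⟩ := a
  obtain ⟨x, y⟩ := p
  fin_cases k <;> simp [latticeCorners, HalfCell, cellOf, step] <;> omega

theorem HalfCell.floor_and_ceil {c : ℤ × ℤ} {k : Fin 4} {x y : ℝ} (h : HalfCell c k x y)
    (hxy : (∃ m : ℤ, x = m) ∨ ∃ n : ℤ, y = n) :
    HalfCell c k ⌊x⌋ ⌊y⌋ ∧ HalfCell c k ⌈x⌉ ⌈y⌉ := by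
  obtain ⟨h_left, h_right, h_below, h_above, h_diag⟩ := h
  have h_left := Int.le_floor.2 h_left
  have h_right : ⌈x⌉ ≤ c.1 + 1 := Int.ceil_le.2 (by push_cast; exact h_right)
  have h_below := Int.le_floor.2 h_below
  have h_above : ⌈y⌉ ≤ c.2 + 1 := Int.ceil_le.2 (by push_cast; exact h_above)
  have hx := Int.floor_le_ceil x
  have hy := Int.floor_le_ceil y
  rcases hxy with ⟨m, rfl⟩ | ⟨n, rfl⟩
  · rw [Int.floor_intCast, Int.ceil_intCast] at *
    fin_cases k <;> simp only [HalfCell, Int.cast_id] at h_diag ⊢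
    · have : ⌈y⌉ ≤ c.1 + c.2 + 1 - m := Int.ceil_le.2 (by push_cast; linarith)
      omega
    · have : ⌈y⌉ ≤ m + c.2 - c.1 := Int.ceil_le.2 (by push_cast; linarith)
      omega
    · have : c.1 + c.2 + 1 - m ≤ ⌊y⌋ := Int.le_floor.2 (by push_cast; linarith)
      omega
    · have : m + c.2 - c.1 ≤ ⌊y⌋ := Int.le_floor.2 (by push_cast; linarith)
      omega
  · rw [Int.floor_intCast, Int.ceil_intCast] at *
    fin_cases k <;> simp only [HalfCell, Int.cast_id] at h_diag ⊢
    · have : ⌈x⌉ ≤ c.1 + c.2 + 1 - n := Int.ceil_le.2 (by push_cast; linarith)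
      omega
    · have : n + c.1 - c.2 ≤ ⌊x⌋ := Int.le_floor.2 (by push_cast; linarith)
      omega
    · have : c.1 + c.2 + 1 - n ≤ ⌊x⌋ := Int.le_floor.2 (by push_cast; linarith)
      omega
    · have : ⌈x⌉ ≤ n + c.1 - c.2 := Int.ceil_le.2 (by push_cast; linarith)
      omega

theorem toPlane_mem_segment {p q : ℤ × ℤ} {r : ℝ} (h_nonneg : 0 ≤ r) (h_le : r ≤ 1) {x : ℂ}
    (h_re : x.re = p.1 + r * (q.1 - p.1)) (h_im : x.im = p.2 + r * (q.2 - p.2)) :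
    x ∈ segment ℝ (toPlane p) (toPlane q) := by
  rw [segment_eq_image']
  refine ⟨r, ⟨h_nonneg, h_le⟩, Complex.ext ?_ ?_⟩
  · simp [toPlane_re, h_re]
  · simp [toPlane_im, h_im]

theorem mem_segment_floor_ceil {x : ℂ} (hx : (∃ m : ℤ, x.re = m) ∨ ∃ n : ℤ, x.im = n) :
    x ∈ segment ℝ (toPlane (⌊x.re⌋, ⌊x.im⌋)) (toPlane (⌈x.re⌉, ⌈x.im⌉)) := by
  have fract_eq (y : ℝ) : y = ⌊y⌋ + Int.fract y * (⌈y⌉ - ⌊y⌋) := by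
    rcases Int.fract_eq_zero_or_add_one_sub_ceil y with h | h
    · rw [h, zero_mul, add_zero]
      linarith [Int.self_sub_floor y]
    · rw [show (⌈y⌉ : ℝ) - ⌊y⌋ = 1 by linarith [Int.self_sub_floor y], mul_one,
        Int.floor_add_fract]
  rcases hx with ⟨m, hm⟩ | ⟨n, hn⟩
  · exact toPlane_mem_segment (Int.fract_nonneg x.im) (Int.fract_lt_one _).le (by simp [hm])
      (fract_eq _)
  · exact toPlane_mem_segment (Int.fract_nonneg x.re) (Int.fract_lt_one _).le (fract_eq _)
      (by simp [hn])

theorem exists_mem_segment_of_opposite {c : ℤ × ℤ} {k : Fin 4} {x : ℂ}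
    (h : HalfCell c k x.re x.im) (h' : HalfCell c (k + 2) x.re x.im) :
    ∃ p q : ℤ × ℤ, HalfCell c k p.1 p.2 ∧ HalfCell c (k + 2) p.1 p.2 ∧ HalfCell c k q.1 q.2 ∧
      HalfCell c (k + 2) q.1 q.2 ∧ x ∈ segment ℝ (toPlane p) (toPlane q) := by
  obtain ⟨-, -, h_below, h_above, h_diag⟩ := h
  obtain ⟨-, -, -, -, h_diag'⟩ := h'
  have h_parity : (k = 0 ∨ k = 2) ∨ (k = 1 ∨ k = 3) := by fin_cases k <;> simp
  rcases h_parity with hk | hk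
  · refine ⟨c + (1, 0), c + (0, 1), ?_, ?_, ?_, ?_,
      toPlane_mem_segment (r := x.im - c.2) (by linarith) (by linarith) ?_ ?_⟩ <;>
      rcases hk with rfl | rfl <;> simp [HalfCell] at h_diag h_diag' ⊢ <;> linarith
  · refine ⟨c, c + (1, 1), ?_, ?_, ?_, ?_,
      toPlane_mem_segment (r := x.im - c.2) (by linarith) (by linarith) ?_ ?_⟩ <;>
      rcases hk with rfl | rfl <;> simp [HalfCell] at h_diag h_diag' ⊢ <;> linarith

theorem exists_mem_segment_of_halfCell {c d : ℤ × ℤ} {k l : Fin 4} {x : ℂ}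
    (h_opp : c = d → l = k + 2) (hc : HalfCell c k x.re x.im) (hd : HalfCell d l x.re x.im) :
    ∃ p q : ℤ × ℤ, HalfCell c k p.1 p.2 ∧ HalfCell d l p.1 p.2 ∧ HalfCell c k q.1 q.2 ∧
      HalfCell d l q.1 q.2 ∧ x ∈ segment ℝ (toPlane p) (toPlane q) := by
  by_cases hx : (∃ m : ℤ, x.re = m) ∨ ∃ n : ℤ, x.im = n
  · exact ⟨_, _, (hc.floor_and_ceil hx).1, (hd.floor_and_ceil hx).1, (hc.floor_and_ceil hx).2,
      (hd.floor_and_ceil hx).2, mem_segment_floor_ceil hx⟩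
  · push Not at hx
    have cell_eq {e : ℤ × ℤ} {j : Fin 4} (h : HalfCell e j x.re x.im) :
        e = (⌊x.re⌋, ⌊x.im⌋) :=
      h.eq_of_lt_of_lt ((Int.floor_le _).lt_of_ne (hx.1 _).symm) (Int.lt_floor_add_one _)
        ((Int.floor_le _).lt_of_ne (hx.2 _).symm) (Int.lt_floor_add_one _)
    obtain rfl := (cell_eq hc).trans (cell_eq hd).symm
    obtain rfl := h_opp rfl
    exact exists_mem_segment_of_opposite hc hd

theorem region_inter {δ : Bool} {s t : LTile} (h : ∀ z q, s.Covers δ z q → ¬ t.Covers δ z q)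
    (w : ℂ) : (s.place w).region δ ∩ (t.place w).region δ =
      convexHull ℝ ((s.place w).corners δ ∩ (t.place w).corners δ) := by
  refine Set.Subset.antisymm ?_ (Set.subset_inter (convexHull_mono Set.inter_subset_left)
    (convexHull_mono Set.inter_subset_right))
  rintro x ⟨hs, ht⟩
  have corner_mem {u : LTile} {p : ℤ × ℤ} (h : HalfCell (u.cell δ) (u.ori δ) p.1 p.2) :
      w + toPlane p ∈ (u.place w).corners δ := by
    rw [LTile.corners_place]
    exact Set.mem_image_of_mem _ (mem_latticeCorners_iff.2 h)
  obtain ⟨p, q, hps, hpt, hqs, hqt, hx⟩ := exists_mem_segment_of_halfCell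
    (LTile.ori_eq_of_cell_eq h) (LTile.mem_region_place_iff.1 hs) (LTile.mem_region_place_iff.1 ht)
  have hx : x ∈ segment ℝ (w + toPlane p) (w + toPlane q) := by
    rwa [← mem_segment_translate ℝ (-w), neg_add_cancel_left, neg_add_cancel_left,
      neg_add_eq_sub]
  exact segment_subset_convexHull (s := (s.place w).corners δ ∩ (t.place w).corners δ)
    ⟨corner_mem hps, corner_mem hpt⟩ ⟨corner_mem hqs, corner_mem hqt⟩ hx

theorem cellOf_eq_and_eq_of_latticeCorners_subset {a b : ℤ × ℤ} {k l : Fin 4}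
    (h : latticeCorners a k ⊆ latticeCorners b l) : cellOf a k = cellOf b l ∧ k = l := by
  have h_apex := h (by simp [latticeCorners] : a ∈ latticeCorners a k)
  have h_fst := h (by simp [latticeCorners] : a + step k ∈ latticeCorners a k)
  have h_snd := h (by simp [latticeCorners] : a + step (k + 1) ∈ latticeCorners a k)
  rw [mem_latticeCorners_iff] at h_apex h_fst h_snd
  generalize cellOf b l = c at *
  obtain ⟨x, y⟩ := a
  obtain ⟨u, v⟩ := c
  fin_cases k <;> fin_cases l <;>
    simp [HalfCell, step, cellOf] at h_apex h_fst h_snd ⊢ <;> omega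

theorem ncard_corners_inter_le {δ : Bool} {s t : LTile}
    (h : ∀ z q, s.Covers δ z q → ¬ t.Covers δ z q) (w : ℂ) :
    ((s.place w).corners δ ∩ (t.place w).corners δ).ncard ≤ 2 := by
  rw [LTile.corners_place, LTile.corners_place, ← Set.image_inter (add_toPlane_injective w),
    Set.ncard_image_of_injective _ (add_toPlane_injective w), ← Finset.coe_inter,
    Set.ncard_coe_finset]
  by_contra! h_card
  have h_eq : latticeCorners (s.apex δ) (s.ori δ) ∩ latticeCorners (t.apex δ) (t.ori δ) =
      latticeCorners (s.apex δ) (s.ori δ) :=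
    Finset.eq_of_subset_of_card_le Finset.inter_subset_left (Finset.card_le_three.trans h_card)
  obtain ⟨h_cell, h_ori⟩ :=
    cellOf_eq_and_eq_of_latticeCorners_subset (Finset.inter_eq_left.1 h_eq)
  exact h _ _ (s.covers_cell_ori δ) ⟨h_cell.symm, Or.inl h_ori⟩

/-! ### Generated tilings -/

theorem IsGenerated.exists_supertile {ε δ : Bool} {T : Set PTile} (hT : IsGenerated ε δ T)
    {s t : PTile} (hs : s ∈ T) (ht : t ∈ T) : ∃ (κ : Kind) (n : ℕ) (w : ℂ), κ.HasRule ∧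
      ∃ s' ∈ supertile ε δ κ n, ∃ t' ∈ supertile ε δ κ n, s'.place w = s ∧ t'.place w = t := by
  obtain ⟨κ, n, w, hκ, hF⟩ := hT.2 {s, t} (Set.toFinite _) (Set.pair_subset hs ht)
  obtain ⟨s', hs', rfl⟩ := hF (Set.mem_insert _ _)
  obtain ⟨t', ht', rfl⟩ := hF (Set.mem_insert_of_mem _ rfl)
  exact ⟨κ, n, w, hκ, s', hs', t', ht', rfl, rfl⟩

theorem IsGenerated.exists_shape {ε δ : Bool} {T : Set PTile} (hT : IsGenerated ε δ T) :
    ∀ t ∈ T, ∃ (v : ℂ) (k : ℕ),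
      t.region δ = convexHull ℝ {v, v + Complex.I ^ k, v + Complex.I ^ (k + 1)} := by
  intro t ht
  obtain ⟨_, _, w, -, t', -, -, -, rfl, -⟩ := hT.exists_supertile ht ht
  have toPlane_step : ∀ k : Fin 4, toPlane (step k) = Complex.I ^ (k : ℕ) ∧
      toPlane (step (k + 1)) = Complex.I ^ ((k : ℕ) + 1) := by
    intro k
    fin_cases k <;> simp [toPlane, step, pow_succ]
  refine ⟨w + toPlane (t'.apex δ), t'.ori δ, ?_⟩
  rw [LTile.region_place, (toPlane_step _).1, (toPlane_step _).2]

theorem not_covers_of_mem_supertile {ε δ : Bool} {κ : Kind} (hκ : κ.HasRule) {n : ℕ} {s t : LTile}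
    (hs : s ∈ supertile ε δ κ n) (ht : t ∈ supertile ε δ κ n) (hst : s ≠ t) :
    ∀ z q, s.Covers δ z q → ¬ t.Covers δ z q := fun _ _ hs' ht' =>
  hst (eq_of_covers_of_mem_supertile hκ hs ht hs' ht')

theorem IsGenerated.isEdgeToEdge {ε δ : Bool} {T : Set PTile} (hT : IsGenerated ε δ T) :
    IsEdgeToEdge δ T := by
  intro s hs t ht hst
  obtain ⟨_, _, w, hκ, s', hs', t', ht', rfl, rfl⟩ := hT.exists_supertile hs ht
  have h := not_covers_of_mem_supertile hκ hs' ht' (ne_of_apply_ne _ hst)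
  exact ⟨region_inter h w, ncard_corners_inter_le h w⟩

theorem pairwise_disjoint_interior_supertile {ε δ : Bool} {κ : Kind} (hκ : κ.HasRule) (n : ℕ)
    (w : ℂ) : (supertile ε δ κ n : Set LTile).Pairwise fun s t =>
      Disjoint (interior ((s.place w).region δ)) (interior ((t.place w).region δ)) :=
  fun _ hs _ ht hst => disjoint_interior_region (not_covers_of_mem_supertile hκ hs ht hst) w

/-- The placed tiles of the `n`-th of the nested patches that grow from a wheel around the
origin. -/
def placedPatch (ε δ : Bool) (n : ℕ) : Set PTile :=
  LTile.place 0 '' {t | t ∈ wheelPatch ε δ false (2 * n)}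

/-- The union of the nested patches that grow from a wheel around the origin. -/
def limitTiling (ε δ : Bool) : Set PTile := ⋃ n, placedPatch ε δ n

theorem monotone_placedPatch (ε δ : Bool) : Monotone (placedPatch ε δ) := by
  refine monotone_nat_of_le_succ fun n => Set.image_mono fun t ht => ?_
  have h := wheelPatch_subset_succ ε δ _ _ (wheelPatch_subset_succ ε δ _ _ ht)
  rwa [Bool.xor_assoc, Bool.xor_self, Bool.xor_false] at h

theorem exists_supertile_of_subset_limitTiling {ε δ : Bool} {F : Set PTile} (hF : F.Finite)
    (hF' : F ⊆ limitTiling ε δ) : ∃ (κ : Kind) (n : ℕ) (w : ℂ), κ.HasRule ∧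
      F ⊆ LTile.place w '' (supertile ε δ κ n : Set LTile) := by
  obtain ⟨-, ⟨n, rfl⟩, hn⟩ := (monotone_placedPatch ε δ).directed_le.directedOn_range
    |>.exists_mem_subset_of_finite_of_subset_sUnion (Set.range_nonempty _) hF hF'
  obtain ⟨Q, hQ⟩ := exists_wheelPatch_subset_supertile ε δ (2 * n)
  refine ⟨.tri false false true true, 2 * n + 3, -reshape Q, by decide, fun t ht => ?_⟩
  obtain ⟨s, hs, rfl⟩ := hn ht
  refine ⟨s.act false Q, hQ s hs, ?_⟩
  simp only [LTile.place, LTile.act, halfTurn, Bool.false_xor, Bool.false_eq_true, if_false,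
    reshape_add, neg_add_cancel_left, zero_add]

theorem halfCell_or_halfCell_add_two (c : ℤ × ℤ) (k : Fin 4) {x y : ℝ} (h_left : c.1 ≤ x)
    (h_right : x ≤ c.1 + 1) (h_below : c.2 ≤ y) (h_above : y ≤ c.2 + 1) :
    HalfCell c k x y ∨ HalfCell c (k + 2) x y := by
  simp only [HalfCell, h_left, h_right, h_below, h_above, true_and]
  fin_cases k
  · exact le_total _ _
  · exact le_total _ _
  · exact le_total _ _
  · exact le_total _ _

theorem exists_opposite_tiles (ε δ : Bool) (z : ℤ × ℤ) :
    ∃ n, ∃ s ∈ wheelPatch ε δ false (2 * n), ∃ t ∈ wheelPatch ε δ false (2 * n),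
      s.cell δ = z ∧ t.cell δ = z ∧ t.ori δ = s.ori δ + 2 := by
  obtain ⟨N, hN⟩ :=
    (eventually_all.2 fun q => eventually_mult_eq_one ε δ z q).exists_forall_of_atTop
  have h_one := fun q => hN (2 * N) (by omega) q false
  obtain ⟨s, hs, hs'⟩ := exists_covers_of_sum_cov_eq_one (h_one 0)
  obtain ⟨t, ht, ht'⟩ := exists_covers_of_sum_cov_eq_one (h_one (s.ori δ + 2))
  refine ⟨N, s, hs, t, ht, hs'.1, ht'.1,
    LTile.ori_eq_of_cell_eq (fun u q hu hu' => ?_) (hs'.1.trans ht'.1.symm)⟩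
  obtain rfl : u = z := hu.1.symm.trans hs'.1
  obtain rfl := eq_of_covers_of_sum_cov_eq_one (h_one q) hs ht hu hu'
  have h_ori := ht'.2
  generalize s.ori δ = k at h_ori
  revert k
  decide

theorem iUnion_region_limitTiling (ε δ : Bool) :
    (⋃ t ∈ limitTiling ε δ, t.region δ) = Set.univ := by
  refine Set.eq_univ_of_forall fun x => ?_
  obtain ⟨n, s, hs, t, ht, hsz, htz, hst⟩ := exists_opposite_tiles ε δ (⌊x.re⌋, ⌊x.im⌋)
  have mem_union {u : LTile} (hu : u ∈ wheelPatch ε δ false (2 * n))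
      (h : HalfCell (u.cell δ) (u.ori δ) x.re x.im) : x ∈ ⋃ t ∈ limitTiling ε δ, t.region δ :=
    Set.mem_biUnion (Set.mem_iUnion.2 ⟨n, Set.mem_image_of_mem _ hu⟩)
      (LTile.mem_region_place_iff.2 (by rwa [sub_zero]))
  rcases halfCell_or_halfCell_add_two (⌊x.re⌋, ⌊x.im⌋) (s.ori δ) (Int.floor_le x.re)
    (Int.lt_floor_add_one x.re).le (Int.floor_le x.im) (Int.lt_floor_add_one x.im).le with h | h
  · exact mem_union hs (hsz ▸ h)
  · exact mem_union ht (htz ▸ hst ▸ h)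

theorem isGenerated_limitTiling (ε δ : Bool) : IsGenerated ε δ (limitTiling ε δ) := by
  refine ⟨⟨iUnion_region_limitTiling ε δ, fun s hs t ht hst => ?_⟩,
    fun F hF hF' => exists_supertile_of_subset_limitTiling hF hF'⟩
  obtain ⟨κ, n, w, hκ, hF⟩ :=
    exists_supertile_of_subset_limitTiling (Set.toFinite {s, t}) (Set.pair_subset hs ht)
  obtain ⟨s', hs', rfl⟩ := hF (Set.mem_insert _ _)
  obtain ⟨t', ht', rfl⟩ := hF (Set.mem_insert_of_mem _ rfl)
  exact pairwise_disjoint_interior_supertile hκ n w hs' ht' (ne_of_apply_ne _ hst)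

/-! ### Periods of labelled square grids -/

section FwdDiff
open Function fwdDiff
variable {G A : Type*} [AddCommGroup G] [AddCommGroup A] {a : G → A} {u e e' : G}

theorem fwdDiff_comm (a : G → A) (u e : G) : Δ_[u] (Δ_[e] a) = Δ_[e] (Δ_[u] a) := by
  funext z
  simp only [fwdDiff, add_right_comm z u e]
  abel

theorem periodic_fwdDiff_comm : Periodic (Δ_[e] a) u ↔ Periodic (Δ_[u] a) e :=
  forall_congr' fun z => by simp only [fwdDiff, add_right_comm z u e, sub_eq_sub_iff_sub_eq_sub]

theorem periodic_fwdDiff (h : Periodic a u) (e : G) : Periodic (Δ_[e] a) u := fun z => by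
  simp only [fwdDiff, add_right_comm z u e, h _]

theorem fwdDiff_add_nsmul_eq_of_ne {S : Set A}
    (hS : ∀ s ∈ S, ∀ t ∈ S, ∀ s' ∈ S, ∀ t' ∈ S, s - t = s' - t' → s ≠ t → t = t')
    (h_mem : ∀ z, Δ_[e'] a z ∈ S) (h_per : Periodic (Δ_[e] a) u) {z : G}
    (hz : Δ_[e'] a (z + u) ≠ Δ_[e'] a z) (n : ℕ) : Δ_[e'] a (z + n • e) = Δ_[e'] a z := by
  have h_diff : Periodic (Δ_[u] (Δ_[e'] a)) e := by
    rw [fwdDiff_comm]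
    exact periodic_fwdDiff (periodic_fwdDiff_comm.1 h_per) e'
  exact (hS _ (h_mem _) _ (h_mem _) _ (h_mem _) _ (h_mem _) (h_diff.nsmul n z).symm hz).symm

theorem not_exists_abs_le_of_add_one_le {g : ℕ → ℝ} (hg : ∀ n, g n + 1 ≤ g (n + 1)) :
    ¬∃ C, ∀ n, |g n| ≤ C := by
  rintro ⟨C, hC⟩
  have h_growth : ∀ n : ℕ, g 0 + n ≤ g n := fun n => by
    induction n with
    | zero => simp
    | succ n ih => push_cast; linarith [hg n]
  obtain ⟨n, hn⟩ := exists_nat_gt (2 * C)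
  linarith [h_growth n, abs_le.1 (hC 0), abs_le.1 (hC n)]

/-- If the labels in direction `e'` did not have the period `u`, they would be constant along some
line in direction `e`, so that `a` would be monotone along this line. -/
theorem periodic_fwdDiff_of_bounded {S : Set A} {H K : A} {f : A →+ ℝ}
    (hS : ∀ s ∈ S, ∀ t ∈ S, ∀ s' ∈ S, ∀ t' ∈ S, s - t = s' - t' → s ≠ t → t = t')
    (h_mem : ∀ z, Δ_[e'] a z ∈ S) (h_per : Periodic (Δ_[e] a) u)
    (h_centre : ∀ z, (Δ_[e] a z = K ↔ Δ_[e'] a z = H) ∨ (Δ_[e] a (z + e') = K ↔ Δ_[e'] a z = H))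
    (h_neg : ∀ z, Δ_[e] a z = K → f (Δ_[e] a z) ≤ -1)
    (h_pos : ∀ z, Δ_[e] a z ≠ K → 1 ≤ f (Δ_[e] a z))
    (h_bounded : ∃ C, ∀ z, |f (a z)| ≤ C) : Periodic (Δ_[e'] a) u := by
  intro z
  by_contra hz
  have h_const := fwdDiff_add_nsmul_eq_of_ne hS h_mem h_per hz
  have h_succ : ∀ n : ℕ, a (z + (n + 1) • e) = a (z + n • e) + Δ_[e] a (z + n • e) := fun n => by
    rw [fwdDiff, succ_nsmul, add_assoc, add_sub_cancel]
  have h_cross : ∀ n : ℕ, Δ_[e] a (z + n • e + e') = Δ_[e] a (z + n • e) := fun n => by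
    have h := (h_const (n + 1)).trans (h_const n).symm
    rw [succ_nsmul, ← add_assoc] at h
    simpa only [fwdDiff, add_right_comm _ e e', sub_eq_sub_iff_sub_eq_sub] using h
  have h_iff : ∀ n : ℕ, Δ_[e] a (z + n • e) = K ↔ Δ_[e'] a z = H := fun n => by
    simpa only [h_cross, h_const, or_self] using h_centre (z + n • e)
  obtain ⟨C, hC⟩ := h_bounded
  by_cases h : Δ_[e'] a z = H
  · refine not_exists_abs_le_of_add_one_le (g := fun n => -f (a (z + n • e))) (fun n => ?_)
      ⟨C, fun n => (abs_neg _).trans_le (hC _)⟩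
    rw [h_succ, map_add]
    linarith [h_neg _ ((h_iff n).2 h)]
  · refine not_exists_abs_le_of_add_one_le (g := fun n => f (a (z + n • e))) (fun n => ?_)
      ⟨C, fun n => hC _⟩
    rw [h_succ, map_add]
    linarith [h_pos _ (mt (h_iff n).1 h)]

theorem add_nsmul_eq_of_periodic_fwdDiff {g : G → A} (hg : Periodic (Δ_[u] g) u) (z : G) (n : ℕ) :
    g (z + n • u) = g z + n • Δ_[u] g z := by
  induction n with
  | zero => simp
  | succ n ih =>
    rw [succ_nsmul, ← add_assoc, sub_eq_iff_eq_add'.1 (hg.nsmul n z), ih, succ_nsmul, add_assoc]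

theorem eq_zero_of_norm_nsmul_le {E : Type*} [NormedAddCommGroup E] [NormedSpace ℝ E] {x : E}
    {C : ℝ} (h : ∀ n : ℕ, ‖n • x‖ ≤ C) : x = 0 := by
  by_contra hx
  obtain ⟨n, hn⟩ := exists_nat_gt (C / ‖x‖)
  rw [div_lt_iff₀ (norm_pos_iff.2 hx)] at hn
  have := h n
  rw [← Nat.cast_smul_eq_nsmul ℝ, norm_smul, Real.norm_natCast] at this
  linarith

end FwdDiff

/-! ### Labels of the sides of cells -/

/-- The lift of a leg in direction `i ^ k` that ends in the centre of a square. -/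
def centreLabel (k : Fin 4) : Addr := (Kind.quarter false false false).leg k

/-- The label of a side in direction `mainDir δ` that does not end in the centre of a square, where
`b` tells whether the hypotenuse at this side is falling. -/
def legLabel (δ b : Bool) : Addr :=
  if δ then (if b then (2, 0, 0, 0) else (0, 2, 0, -2))
  else (if b then (0, 0, 2, 0) else (0, 0, 0, 2))

/-- The direction `i ^ mainDir δ` of the sides whose labels are determined by the hypotenuses:
horizontal for `δ = true` and vertical for `δ = false`. -/
def mainDir (δ : Bool) : Fin 4 := if δ then 0 else 1

/-- The possible labels of the sides in direction `mainDir δ`. -/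
def labels (δ : Bool) : Finset Addr :=
  {legLabel δ true, legLabel δ false, centreLabel (mainDir δ)}

theorem Kind.leg_mem_labels : ∀ (δ : Bool) (κ : Kind), κ.leg (mainDir δ) ∈ labels δ := by
  decide

theorem Kind.leg_eq_centreLabel_iff : ∀ (δ : Bool) (κ : Kind),
    κ.leg (mainDir δ) = centreLabel (mainDir δ) ↔
      κ.leg (mainDir !δ) = centreLabel (mainDir !δ) := by
  decide

theorem eq_of_sub_eq_sub_of_mem_labels : ∀ δ : Bool, ∀ s ∈ labels δ, ∀ t ∈ labels δ,
    ∀ s' ∈ labels δ, ∀ t' ∈ labels δ, s - t = s' - t' → s ≠ t → t = t' := by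
  decide

open scoped InnerProductSpace in
theorem inner_internal_legLabel_le (δ b : Bool) :
    ⟪internal (centreLabel (mainDir δ)), internal (legLabel δ b)⟫_ℝ ≤ -1 / 2 := by
  have := sqrt_three_mul_self
  have := sqrt_three_bounds
  cases δ <;> cases b <;>
    simp [Complex.inner, centreLabel, mainDir, legLabel, internal_apply, Kind.leg, Kind.hor,
      Kind.ver] <;>
    linarith

theorem norm_internal_centreLabel_sq (δ : Bool) :
    ‖internal (centreLabel (mainDir δ))‖ ^ 2 = 2 := by
  rw [norm_internal_sq]
  cases δ <;> simp [centreLabel, mainDir, Kind.leg, Kind.hor, Kind.ver, ratPart, irrPart]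

/-! ### Periodic lifts -/

theorem eq_zero_of_intCast_eq_mul_sqrt_three {m n : ℤ} (h : (m : ℝ) = n * √3) :
    m = 0 ∧ n = 0 := by
  have hn : n = 0 := by
    by_contra hn
    have h_irr : Irrational (√(3 : ℕ)) := Nat.Prime.irrational_sqrt (by norm_num)
    exact (h_irr.intCast_mul hn).ne_int m (by exact_mod_cast h.symm)
  rw [hn, Int.cast_zero, zero_mul] at h
  exact ⟨by exact_mod_cast h, hn⟩

theorem internal_injective : Function.Injective internal := by
  refine (injective_iff_map_eq_zero internal).2 fun p hp => ?_
  obtain ⟨a, b, c, d⟩ := p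
  have h_re : a + c / 2 - b * (√3 / 2) = 0 := congrArg Complex.re hp
  have h_im : b / 2 - c * (√3 / 2) + d = 0 := congrArg Complex.im hp
  obtain ⟨h₁, hb⟩ := eq_zero_of_intCast_eq_mul_sqrt_three (m := 2 * a + c) (n := b) (by
    push_cast; linarith)
  obtain ⟨h₂, hc⟩ := eq_zero_of_intCast_eq_mul_sqrt_three (m := b + 2 * d) (n := c) (by
    push_cast; linarith)
  have ha : a = 0 := by omega
  have hd : d = 0 := by omega
  rw [ha, hb, hc, hd]
  rfl

section PeriodicLift
open Function fwdDiff

/-- A lift `a` of the square lattice to the addresses, in doubled coordinates and at bounded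
conjugate distance, with the labels that occur in supertiles; the labels in direction `mainDir δ`
have the period `u`. -/
structure PeriodicLift (δ : Bool) (u : ℤ × ℤ) (a : ℤ × ℤ → Addr) : Prop where
  flat_eq (z : ℤ × ℤ) : flat (a z) = z + z
  bounded : ∃ C, ∀ z, ‖internal (a z)‖ ≤ C
  fwdDiff_mem (δ' : Bool) (z : ℤ × ℤ) : Δ_[step (mainDir δ')] a z ∈ labels δ'
  centre (z : ℤ × ℤ) :
    (Δ_[step (mainDir δ)] a z = centreLabel (mainDir δ) ↔
      Δ_[step (mainDir !δ)] a z = centreLabel (mainDir !δ)) ∨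
    (Δ_[step (mainDir δ)] a (z + step (mainDir !δ)) = centreLabel (mainDir δ) ↔
      Δ_[step (mainDir !δ)] a z = centreLabel (mainDir !δ))
  periodic : Periodic (Δ_[step (mainDir δ)] a) u

namespace PeriodicLift
variable {δ : Bool} {u : ℤ × ℤ} {a : ℤ × ℤ → Addr}

open scoped InnerProductSpace in
/-- In the conjugate plane, the label towards the centre of a square makes an obtuse angle with the
other labels in the same direction. -/
theorem periodic_fwdDiff_not (h : PeriodicLift δ u a) :
    Periodic (Δ_[step (mainDir !δ)] a) u := by
  set K := internal (centreLabel (mainDir δ))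
  have hK : ‖K‖ ^ 2 = 2 := norm_internal_centreLabel_sq δ
  let f : Addr →+ ℝ := (innerₗ ℂ ((-2 : ℝ) • K)).toAddMonoidHom.comp internal
  have hf : ∀ p, f p = -2 * ⟪K, internal p⟫_ℝ := fun p =>
    real_inner_smul_left K (internal p) (-2)
  obtain ⟨C, hC⟩ := h.bounded
  refine periodic_fwdDiff_of_bounded (f := f)
    (eq_of_sub_eq_sub_of_mem_labels _) (h.fwdDiff_mem _) h.periodic h.centre
    (fun z hz => ?_) (fun z hz => ?_) ⟨‖(-2 : ℝ) • K‖ * C, fun z => ?_⟩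
  · rw [hf, hz, real_inner_self_eq_norm_sq, hK]
    norm_num
  · have h_mem := h.fwdDiff_mem δ z
    simp only [labels, Finset.mem_insert, Finset.mem_singleton, hz, or_false] at h_mem
    rw [hf]
    rcases h_mem with h_mem | h_mem <;> rw [h_mem] <;>
      linarith [inner_internal_legLabel_le δ true, inner_internal_legLabel_le δ false]
  · exact (abs_real_inner_le_norm _ _).trans (mul_le_mul_of_nonneg_left (hC z) (norm_nonneg _))

theorem fwdDiff_eq (h : PeriodicLift δ u a) (z : ℤ × ℤ) : Δ_[u] a z = Δ_[u] a 0 := by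
  have h_main := periodic_fwdDiff_comm.1 h.periodic
  have h_cross := periodic_fwdDiff_comm.1 h.periodic_fwdDiff_not
  have h₀ : Periodic (Δ_[u] a) (1, 0) := by cases δ; exacts [h_cross, h_main]
  have h₁ : Periodic (Δ_[u] a) (0, 1) := by cases δ; exacts [h_main, h_cross]
  have hz : z = z.1 • (1, 0) + z.2 • (0, 1) := by ext <;> simp
  rw [hz]
  exact ((h₀.zsmul _).add_period (h₁.zsmul _)).eq

theorem eq_zero (h : PeriodicLift δ u a) : u = 0 := by
  set b := Δ_[u] a 0
  have h_multiple : ∀ n : ℕ, a (n • u) = a 0 + n • b := fun n => by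
    rw [← zero_add (n • u)]
    exact add_nsmul_eq_of_periodic_fwdDiff
      (fun z => (h.fwdDiff_eq _).trans (h.fwdDiff_eq z).symm) 0 n
  obtain ⟨C, hC⟩ := h.bounded
  have hb : b = 0 := by
    refine internal_injective ((eq_zero_of_norm_nsmul_le (C := C + C) fun n => ?_).trans
      internal.map_zero.symm)
    rw [← map_nsmul, ← add_sub_cancel_left (a 0) (n • b), ← h_multiple, map_sub]
    exact (norm_sub_le _ _).trans (add_le_add (hC _) (hC _))
  have h_flat : u + u = 0 := by
    simpa [b, fwdDiff, h.flat_eq] using congrArg flat hb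
  exact self_eq_neg.1 (eq_neg_of_add_eq_zero_left h_flat)

end PeriodicLift
end PeriodicLift

/-! ### The lift of a supertile -/

/-- The corner of the unit cell with lower left corner `z` at which the side at the quarter `q`
starts, the sides being directed counterclockwise. -/
def cellCorner (z : ℤ × ℤ) (q : Fin 4) : ℤ × ℤ :=
  match q with
  | 0 => z + (0, 1)
  | 1 => z
  | 2 => z + (1, 0)
  | 3 => z + (1, 1)

/-- The lifted starting point of the leg at the quarter `q`, for a triangle that covers this
quarter. The leg ends at `t.sideStart δ q + t.kind.leg (q + 3)`. -/
def LTile.sideStart (δ : Bool) (t : LTile) (q : Fin 4) : Addr :=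
  if q = t.ori δ + 1 then t.apexLift δ else t.apexLift δ + t.kind.leg (t.ori δ + 1)

theorem cellCorner_add_step (z : ℤ × ℤ) (q : Fin 4) :
    cellCorner z q + step (q + 3) = cellCorner z (q + 1) := by
  fin_cases q <;> ext <;> simp [cellCorner, step]

theorem cellCorner_neighbour (z : ℤ × ℤ) (q : Fin 4) :
    cellCorner (z + step (q + 2)) (q + 2) = cellCorner z (q + 1) := by
  fin_cases q <;> ext <;> simp [cellCorner, step]

theorem step_add_two (k : Fin 4) : step (k + 2) = -step k := by
  revert k
  decide

theorem cellCorner_cellOf (a : ℤ × ℤ) (k : Fin 4) : cellCorner (cellOf a k) (k + 1) = a := by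
  fin_cases k <;> ext <;> simp [cellCorner, cellOf]

theorem LTile.sideStart_ori_add_one (δ : Bool) (t : LTile) :
    t.sideStart δ (t.ori δ + 1) = t.apexLift δ := if_pos rfl

theorem LTile.sideStart_ori (δ : Bool) (t : LTile) :
    t.sideStart δ (t.ori δ) = t.apexLift δ + t.kind.leg (t.ori δ + 1) :=
  if_neg (by generalize t.ori δ = k; revert k; decide)

theorem LTile.sideStart_ori_add_leg (δ : Bool) (t : LTile) :
    t.sideStart δ (t.ori δ) + t.kind.leg (t.ori δ + 3) = t.apexLift δ := by
  rw [t.sideStart_ori, show t.ori δ + 3 = t.ori δ + 1 + 2 from (add_assoc _ 1 2).symm,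
    Kind.leg_add_two, add_neg_cancel_right]

theorem Kind.leg_add_two_injective {κ κ' : Kind} {k : Fin 4}
    (h : κ.leg (k + 2) = κ'.leg (k + 2)) : κ.leg k = κ'.leg k :=
  neg_injective (by rw [← Kind.leg_add_two, ← Kind.leg_add_two, h])

theorem LTile.flat_sideStart {δ : Bool} {t : LTile} {z : ℤ × ℤ} {q : Fin 4}
    (h : t.Covers δ z q) : flat (t.sideStart δ q) = cellCorner z q + cellCorner z q := by
  obtain ⟨rfl, rfl | rfl⟩ := h
  · have h_apex := t.flat_apexLift δ
    rw [← t.sideStart_ori_add_leg, map_add, Kind.flat_leg,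
      ← cellCorner_cellOf (t.apex δ) (t.ori δ), ← cellCorner_add_step, add_add_add_comm] at h_apex
    exact add_right_cancel h_apex
  · rw [t.sideStart_ori_add_one, t.flat_apexLift, LTile.cell, cellCorner_cellOf]

theorem LTile.flat_sideStart_add_leg {δ : Bool} {t : LTile} {z : ℤ × ℤ} {q : Fin 4}
    (h : t.Covers δ z q) : flat (t.sideStart δ q + t.kind.leg (q + 3)) =
      cellCorner z (q + 1) + cellCorner z (q + 1) := by
  rw [map_add, flat_sideStart h, Kind.flat_leg, ← cellCorner_add_step, add_add_add_comm]

theorem LTile.flat_hypotenuse_start (δ : Bool) (t : LTile) :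
    flat (t.sideStart δ (t.ori δ + 1) + t.kind.leg (t.ori δ)) =
      cellCorner (t.cell δ) (t.ori δ + 2) + cellCorner (t.cell δ) (t.ori δ + 2) := by
  have h := LTile.flat_sideStart_add_leg (t := t) (δ := δ) ⟨rfl, Or.inr rfl⟩
  rwa [add_assoc, show (1 : Fin 4) + 3 = 0 from rfl, add_zero, add_assoc] at h

theorem LTile.side_mem_sides {δ : Bool} {t : LTile} {z : ℤ × ℤ} {q : Fin 4}
    (h : t.Covers δ z q) : (t.sideStart δ q, t.sideStart δ q + t.kind.leg (q + 3)) ∈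
      sides (t.apexLift δ) (t.kind.leg (t.ori δ)) (t.kind.leg (t.ori δ + 1)) := by
  obtain ⟨-, rfl | rfl⟩ := h
  · rw [t.sideStart_ori_add_leg, t.sideStart_ori]
    simp [sides]
  · rw [t.sideStart_ori_add_one, add_assoc]
    simp [sides]

theorem LTile.hypotenuse_mem_sides (δ : Bool) (t : LTile) :
    (t.sideStart δ (t.ori δ + 1) + t.kind.leg (t.ori δ), t.sideStart δ (t.ori δ)) ∈
      sides (t.apexLift δ) (t.kind.leg (t.ori δ)) (t.kind.leg (t.ori δ + 1)) := by
  rw [t.sideStart_ori_add_one, t.sideStart_ori]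
  simp [sides]

section
variable {ε δ : Bool} {κ : Kind} {n : ℕ} {s t : LTile} {z : ℤ × ℤ} {q : Fin 4}

theorem sideStart_eq_of_neighbour (hκ : κ.HasRule) (hs : s ∈ supertile ε δ κ n)
    (ht : t ∈ supertile ε δ κ n) (hsz : s.Covers δ z q)
    (htz : t.Covers δ (z + step (q + 2)) (q + 2)) :
    s.sideStart δ q + s.kind.leg (q + 3) = t.sideStart δ (q + 2) ∧
      t.kind.leg (q + 3) = s.kind.leg (q + 3) := by
  have h_end : cellCorner (z + step (q + 2)) (q + 2 + 1) = cellCorner z q := by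
    rw [← cellCorner_add_step, cellCorner_neighbour, ← cellCorner_add_step]
    rw [add_assoc, add_right_comm q 2 3, step_add_two, add_neg_cancel, add_zero]
  obtain ⟨h_start, h_end⟩ := lifts_eq_of_mem_sides_of_mem_supertile hκ hs ht
    (LTile.side_mem_sides hsz) (LTile.side_mem_sides htz)
    (by rw [LTile.flat_sideStart hsz, LTile.flat_sideStart_add_leg htz, h_end])
    (by rw [LTile.flat_sideStart_add_leg hsz, LTile.flat_sideStart htz, cellCorner_neighbour])
  refine ⟨h_end, ?_⟩
  rw [← h_end, add_right_comm q 2 3, Kind.leg_add_two, add_assoc, left_eq_add, add_neg_eq_zero]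
    at h_start
  exact h_start.symm

theorem eq_or_ori_eq_add_two (hκ : κ.HasRule) (hs : s ∈ supertile ε δ κ n)
    (ht : t ∈ supertile ε δ κ n) (h_cell : s.cell δ = t.cell δ) :
    s = t ∨ t.ori δ = s.ori δ + 2 :=
  or_iff_not_imp_left.2 fun hst =>
    LTile.ori_eq_of_cell_eq (not_covers_of_mem_supertile hκ hs ht hst) h_cell

theorem sideStart_eq_of_corner (hκ : κ.HasRule) (hs : s ∈ supertile ε δ κ n)
    (ht : t ∈ supertile ε δ κ n) (hsz : s.Covers δ z q) (htz : t.Covers δ z (q + 1)) :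
    s.sideStart δ q + s.kind.leg (q + 3) = t.sideStart δ (q + 1) := by
  obtain rfl | h_ori := eq_or_ori_eq_add_two hκ hs ht (hsz.1.trans htz.1.symm)
  · obtain rfl : q = s.ori δ := by grind [LTile.Covers]
    rw [s.sideStart_ori_add_leg, s.sideStart_ori_add_one]
  · obtain rfl : q = s.ori δ + 1 := by grind [LTile.Covers]
    have h_add : s.ori δ + 1 + 1 = t.ori δ := by grind
    have h_leg : s.ori δ + 1 + 3 = s.ori δ := by grind
    have h_cell := hsz.1.trans htz.1.symm
    rw [h_leg, h_add]
    refine (lifts_eq_of_mem_sides_of_mem_supertile hκ hs ht (s.hypotenuse_mem_sides δ)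
      (t.hypotenuse_mem_sides δ) ?_ ?_).1
    · rw [LTile.flat_hypotenuse_start, LTile.flat_sideStart ⟨rfl, Or.inl rfl⟩, h_ori, h_cell]
    · rw [LTile.flat_hypotenuse_start, LTile.flat_sideStart ⟨rfl, Or.inl rfl⟩, h_ori, h_cell,
        add_assoc, show (2 : Fin 4) + 2 = 0 from rfl, add_zero]

end

/-! ### Labels and hypotenuses -/

/-- Whether the hypotenuse of the half with orientation `k` of a cell is falling. -/
def isFalling (k : Fin 4) : Bool := decide (k = 0 ∨ k = 2)

theorem isFalling_add_two (k : Fin 4) : isFalling (k + 2) = isFalling k := by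
  revert k
  decide

/-- The label of a side between two cells, where `b` and `b'` tell whether their hypotenuses are
falling. -/
def sideLabel (δ b b' : Bool) : Addr := if b = b' then legLabel δ b else centreLabel (mainDir δ)

theorem legLabel_injective (δ : Bool) : Function.Injective (legLabel δ) := by
  revert δ
  decide

theorem Kind.leg_eq_legLabel : ∀ (δ r : Bool) (κ : Kind),
    κ.leg (mainDir δ) ≠ centreLabel (mainDir δ) →
      κ.leg (mainDir δ) = legLabel δ (isFalling (κ.ori δ + if r then 2 else 0)) := by
  decide

theorem Kind.odd_apexLift_and_odd_leg : ∀ (δ : Bool) (κ : Kind) (k : Fin 4),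
    κ.leg (mainDir δ) = centreLabel (mainDir δ) →
      (κ.apexLift δ).1 % 2 = 1 ∧ (κ.leg k).1 % 2 = 1 := by
  decide

theorem LTile.even_sideStart_iff {δ : Bool} {t : LTile} {z : ℤ × ℤ} {q : Fin 4}
    (ht : t.kind.leg (mainDir δ) = centreLabel (mainDir δ)) (htz : t.Covers δ z q) :
    Even (t.sideStart δ q).1 ↔ q = t.ori δ := by
  have h_leg := fun k => (Kind.odd_apexLift_and_odd_leg δ t.kind k ht).2
  have h_apex : (t.apexLift δ).1 % 2 = 1 := by
    have := (Kind.odd_apexLift_and_odd_leg δ t.kind 0 ht).1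
    cases hr : t.rot <;> simp [LTile.apexLift, halfTurn, hr] <;> omega
  obtain ⟨-, rfl | rfl⟩ := htz
  · have := h_leg (t.ori δ + 1)
    rw [t.sideStart_ori, Int.even_iff, Prod.fst_add]
    omega
  · rw [t.sideStart_ori_add_one, Int.even_iff]
    simp [h_apex]

theorem leg_eq_sideLabel {ε δ : Bool} {κ : Kind} (hκ : κ.HasRule) {n : ℕ} {s t : LTile}
    (hs : s ∈ supertile ε δ κ n) (ht : t ∈ supertile ε δ κ n) {z : ℤ × ℤ}
    (hsz : s.Covers δ z (mainDir !δ))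
    (htz : t.Covers δ (z + step (mainDir (!δ) + 2)) (mainDir (!δ) + 2)) :
    s.kind.leg (mainDir δ) = sideLabel δ (isFalling (s.ori δ)) (isFalling (t.ori δ)) := by
  obtain ⟨h_start, h_leg⟩ := sideStart_eq_of_neighbour hκ hs ht hsz htz
  have h_leg : t.kind.leg (mainDir δ) = s.kind.leg (mainDir δ) := by
    cases δ
    · exact Kind.leg_add_two_injective h_leg
    · exact h_leg
  by_cases h : s.kind.leg (mainDir δ) = centreLabel (mainDir δ)
  · have h_odd := (Kind.odd_apexLift_and_odd_leg δ s.kind (mainDir (!δ) + 3) h).2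
    have h_ori : mainDir (!δ) = s.ori δ ↔ mainDir (!δ) + 2 ≠ t.ori δ := by
      rw [← LTile.even_sideStart_iff h hsz, Ne, ← LTile.even_sideStart_iff (h_leg.trans h) htz,
        ← h_start, Prod.fst_add, Int.even_iff, Int.even_iff]
      omega
    have h_ne : isFalling (s.ori δ) ≠ isFalling (t.ori δ) := by
      have hs_ori := hsz.2
      have ht_ori := htz.2
      generalize mainDir (!δ) = q at *
      generalize s.ori δ = k at *
      generalize t.ori δ = l at *
      clear * - h_ori hs_ori ht_ori
      revert q k l
      decide
    rw [sideLabel, if_neg h_ne, h]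
  · have hs_eq := Kind.leg_eq_legLabel δ s.rot s.kind h
    have ht_eq := Kind.leg_eq_legLabel δ t.rot t.kind (by rwa [h_leg])
    rw [← LTile.ori] at hs_eq ht_eq
    rw [h_leg, hs_eq] at ht_eq
    rw [sideLabel, if_pos (legLabel_injective δ ht_eq), hs_eq]

/-! ### The vertex lift of a supertile -/

instance : Nonempty LTile := ⟨⟨.quarter false false false, false, 0⟩⟩

/-- Whether all four quarters of the cell `z` are covered by tiles of the patch `P`. -/
def IsCovered (δ : Bool) (P : Finset LTile) (z : ℤ × ℤ) : Prop := ∀ q, ∃ t ∈ P, t.Covers δ z q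

/-- The tile of the patch `P` that covers the quarter `q` of the cell `z`; arbitrary if there is
none. -/
noncomputable def tileAt (δ : Bool) (P : Finset LTile) (z : ℤ × ℤ) (q : Fin 4) : LTile :=
  Classical.epsilon fun t => t ∈ P ∧ t.Covers δ z q

/-- The lift of the vertex `z` that a patch covering the cell `z` determines. -/
noncomputable def vertexLift (δ : Bool) (P : Finset LTile) (z : ℤ × ℤ) : Addr :=
  (tileAt δ P z 1).sideStart δ 1

/-- Whether the hypotenuse in the cell `z` is falling, for a patch covering this cell. -/
noncomputable def fallsAt (δ : Bool) (P : Finset LTile) (z : ℤ × ℤ) : Bool :=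
  isFalling ((tileAt δ P z 0).ori δ)

namespace IsCovered
variable {δ : Bool} {P : Finset LTile} {z : ℤ × ℤ}

theorem tileAt_mem (h : IsCovered δ P z) (q : Fin 4) : tileAt δ P z q ∈ P :=
  (Classical.epsilon_spec (h q)).1

theorem covers_tileAt (h : IsCovered δ P z) (q : Fin 4) : (tileAt δ P z q).Covers δ z q :=
  (Classical.epsilon_spec (h q)).2

theorem flat_vertexLift (h : IsCovered δ P z) : flat (vertexLift δ P z) = z + z :=
  LTile.flat_sideStart (h.covers_tileAt 1)

variable {ε : Bool} {κ : Kind} {n : ℕ}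

theorem isFalling_eq_fallsAt (hκ : κ.HasRule) {t : LTile} (ht : t ∈ supertile ε δ κ n)
    (h : IsCovered δ (supertile ε δ κ n) (t.cell δ)) :
    isFalling (t.ori δ) = fallsAt δ (supertile ε δ κ n) (t.cell δ) := by
  obtain h_eq | h_ori := eq_or_ori_eq_add_two hκ (h.tileAt_mem 0) ht (h.covers_tileAt 0).1
  · rw [fallsAt, h_eq]
  · rw [fallsAt, h_ori, isFalling_add_two]

theorem sideStart_tileAt_add_one (hκ : κ.HasRule) (h : IsCovered δ (supertile ε δ κ n) z)
    (q : Fin 4) :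
    (tileAt δ (supertile ε δ κ n) z (q + 1)).sideStart δ (q + 1) =
      (tileAt δ (supertile ε δ κ n) z q).sideStart δ q +
        (tileAt δ (supertile ε δ κ n) z q).kind.leg (q + 3) :=
  (sideStart_eq_of_corner hκ (h.tileAt_mem q) (h.tileAt_mem (q + 1)) (h.covers_tileAt q)
    (h.covers_tileAt (q + 1))).symm

theorem sideStart_tileAt_neighbour (hκ : κ.HasRule) (h : IsCovered δ (supertile ε δ κ n) z)
    (q : Fin 4) (h' : IsCovered δ (supertile ε δ κ n) (z + step (q + 2))) :
    (tileAt δ (supertile ε δ κ n) (z + step (q + 2)) (q + 2)).sideStart δ (q + 2) =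
        (tileAt δ (supertile ε δ κ n) z (q + 1)).sideStart δ (q + 1) ∧
      (tileAt δ (supertile ε δ κ n) (z + step (q + 2)) (q + 2 + 1)).sideStart δ (q + 2 + 1) =
        (tileAt δ (supertile ε δ κ n) z q).sideStart δ q := by
  obtain ⟨h_start, h_leg⟩ := sideStart_eq_of_neighbour hκ (h.tileAt_mem q)
    (h'.tileAt_mem (q + 2)) (h.covers_tileAt q) (h'.covers_tileAt (q + 2))
  refine ⟨h_start.symm.trans (h.sideStart_tileAt_add_one hκ q).symm, ?_⟩
  rw [h'.sideStart_tileAt_add_one hκ, ← h_start, add_right_comm q 2 3, Kind.leg_add_two, h_leg,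
    add_neg_cancel_right]

open fwdDiff in
theorem fwdDiff_vertexLift (hκ : κ.HasRule) (δ' : Bool) (h : IsCovered δ (supertile ε δ κ n) z)
    (h' : IsCovered δ (supertile ε δ κ n) (z + step (mainDir δ'))) :
    Δ_[step (mainDir δ')] (vertexLift δ (supertile ε δ κ n)) z =
      (tileAt δ (supertile ε δ κ n) z (mainDir !δ')).kind.leg (mainDir δ') := by
  rw [fwdDiff, sub_eq_iff_eq_add']
  cases δ'
  · have h_corner := h.sideStart_tileAt_add_one hκ 0
    rw [show (0 : Fin 4) + 3 = 1 + 2 from rfl, Kind.leg_add_two, ← sub_eq_add_neg,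
      eq_sub_iff_add_eq] at h_corner
    exact (h.sideStart_tileAt_neighbour hκ 3 h').1.trans h_corner.symm
  · exact (h.sideStart_tileAt_neighbour hκ 2 h').2.trans (h.sideStart_tileAt_add_one hκ 1)

theorem leg_tileAt_eq_centreLabel_iff (hκ : κ.HasRule) (h : IsCovered δ (supertile ε δ κ n) z)
    (h' : IsCovered δ (supertile ε δ κ n) (z + step (mainDir !δ))) :
    ((tileAt δ (supertile ε δ κ n) z (mainDir !δ)).kind.leg (mainDir δ) = centreLabel (mainDir δ) ↔
        (tileAt δ (supertile ε δ κ n) z (mainDir δ)).kind.leg (mainDir !δ) =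
          centreLabel (mainDir !δ)) ∨
      ((tileAt δ (supertile ε δ κ n) (z + step (mainDir !δ)) (mainDir !δ)).kind.leg (mainDir δ) =
          centreLabel (mainDir δ) ↔
        (tileAt δ (supertile ε δ κ n) z (mainDir δ)).kind.leg (mainDir !δ) =
          centreLabel (mainDir !δ)) := by
  have h_mem := h.tileAt_mem (mainDir δ)
  have h_covers := h.covers_tileAt (mainDir δ)
  set t := tileAt δ (supertile ε δ κ n) z (mainDir δ)
  have h_or : t.Covers δ z (mainDir !δ) ∨ t.Covers δ z (mainDir (!δ) + 2) := by
    obtain ⟨h_cell, h_ori⟩ := h_covers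
    simp only [LTile.Covers, h_cell, true_and]
    generalize t.ori δ = k at *
    clear * - h_ori
    revert δ k
    decide
  refine h_or.imp (fun ht => ?_) fun ht => ?_
  · rw [eq_of_covers_of_mem_supertile hκ (h.tileAt_mem (mainDir !δ)) h_mem (h.covers_tileAt _) ht]
    exact Kind.leg_eq_centreLabel_iff δ t.kind
  · rw [← Kind.leg_eq_centreLabel_iff δ t.kind]
    have h_two : mainDir (!δ) + 2 + 2 = mainDir !δ := by rw [add_assoc]; exact add_zero _
    have h_nb := h'.covers_tileAt (mainDir !δ)
    have h_leg := (sideStart_eq_of_neighbour hκ h_mem (h'.tileAt_mem (mainDir !δ)) ht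
      (by rwa [h_two])).2
    have : (tileAt δ (supertile ε δ κ n) (z + step (mainDir !δ)) (mainDir !δ)).kind.leg
        (mainDir δ) = t.kind.leg (mainDir δ) := by
      cases δ
      · exact h_leg
      · exact Kind.leg_add_two_injective h_leg
    rw [this]

open fwdDiff in
theorem fwdDiff_vertexLift_eq_sideLabel (hκ : κ.HasRule)
    (h : IsCovered δ (supertile ε δ κ n) z)
    (h_next : IsCovered δ (supertile ε δ κ n) (z + step (mainDir δ)))
    (h_prev : IsCovered δ (supertile ε δ κ n) (z + step (mainDir (!δ) + 2))) :
    Δ_[step (mainDir δ)] (vertexLift δ (supertile ε δ κ n)) z =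
      sideLabel δ (fallsAt δ (supertile ε δ κ n) z)
        (fallsAt δ (supertile ε δ κ n) (z + step (mainDir (!δ) + 2))) := by
  have hz := h.covers_tileAt (mainDir !δ)
  have hz' := h_prev.covers_tileAt (mainDir (!δ) + 2)
  rw [h.fwdDiff_vertexLift hκ δ h_next, leg_eq_sideLabel hκ (h.tileAt_mem _) (h_prev.tileAt_mem _)
    hz hz', isFalling_eq_fallsAt hκ (h.tileAt_mem _) (by rwa [hz.1]), hz.1,
    isFalling_eq_fallsAt hκ (h_prev.tileAt_mem _) (by rwa [hz'.1]), hz'.1]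

end IsCovered

theorem exists_norm_internal_sideStart_le (δ : Bool) : ∃ C, ∀ t : LTile, t.IsAdmissible →
    ∀ q, ‖internal (t.sideStart δ q)‖ ≤ C := by
  obtain ⟨A, hA⟩ := Finite.exists_le fun κ : Kind => ‖internal (κ.apexLift δ)‖
  obtain ⟨B, hB⟩ := Finite.exists_le fun i : Kind × Fin 4 => ‖internal (i.1.leg i.2)‖
  have h_apex (t : LTile) (ht : t.IsAdmissible) : ‖internal (t.apexLift δ)‖ ≤ 1.9 + 1.9 + A := by
    rw [LTile.apexLift, map_add, map_add]
    refine norm_add_le_of_le (norm_add_le_of_le ht.2 ht.2) ?_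
    rw [map_halfTurn, norm_halfTurn]
    exact hA t.kind
  have hB_nonneg : 0 ≤ B := (norm_nonneg _).trans (hB (.quarter false false false, 0))
  refine ⟨1.9 + 1.9 + A + B, fun t ht q => ?_⟩
  rw [LTile.sideStart]
  split_ifs
  · exact (h_apex t ht).trans (le_add_of_nonneg_right hB_nonneg)
  · rw [map_add]
    exact norm_add_le_of_le (h_apex t ht) (hB (t.kind, t.ori δ + 1))

/-! ### Limits of lifts -/

theorem finite_setOf_flat_eq_and_norm_internal_le (a : ℤ × ℤ) (C : ℝ) :
    {p | flat p = a ∧ ‖internal p‖ ≤ C}.Finite := by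
  obtain ⟨M, hM⟩ := exists_nat_ge (|(a.1 : ℝ)| + |(a.2 : ℝ)| + 2 * C)
  have h_box := (Set.finite_Icc (-(M : ℤ)) M).prod (Set.finite_Icc (-(M : ℤ)) M)
  refine (h_box.image fun i => (a.1 - i.1, i.1, i.2, a.2 - i.1 - i.2)).subset ?_
  rintro ⟨p, q, r, s⟩ ⟨rfl, hp⟩
  set a := flat (p, q, r, s)
  have ha : a = (p + q, q + r + s) := rfl
  set b := internal (p, q, r, s) with hb
  have h_re : |a.1 - b.re| ≤ |(a.1 : ℝ)| + C :=
    (abs_sub _ _).trans (by gcongr; exact (Complex.abs_re_le_norm _).trans hp)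
  have h_im : |a.2 - b.im| ≤ |(a.2 : ℝ)| + C :=
    (abs_sub _ _).trans (by gcongr; exact (Complex.abs_im_le_norm _).trans hp)
  have mem_Icc {x y A B : ℝ} {m : ℤ} (hx : |x| ≤ A) (hy : |y| ≤ B) (hAB : A + B ≤ M)
      (hm : m = x / 2 + (2 - √3) / 2 * y) : m ∈ Set.Icc (-(M : ℤ)) M := by
    have := sqrt_three_bounds
    rw [abs_le] at hx hy
    have hm' : -(M : ℝ) ≤ m ∧ (m : ℝ) ≤ M := by constructor <;> nlinarith
    exact_mod_cast hm'
  refine ⟨(q, r), ⟨mem_Icc h_re h_im (by linarith) ?_,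
    mem_Icc h_im ((abs_neg _).trans_le h_re) (by linarith) ?_⟩, by simp [ha]; ring⟩
  all_goals simp only [hb, internal_apply, ha]; push_cast
  · linear_combination (r / 4 : ℝ) * sqrt_three_mul_self
  · linear_combination (-q / 4 : ℝ) * sqrt_three_mul_self

theorem exists_pointwise_limit {ι α β : Type*} (U : Ultrafilter ι) {f : ι → α → β} {S : α → Set β}
    (hS : ∀ x, (S x).Finite) (h : ∀ x, ∀ᶠ i in U, f i x ∈ S x) :
    ∃ g : α → β, ∀ x, ∀ᶠ i in U, f i x = g x := by
  have h_ex (x : α) : ∃ b, ∀ᶠ i in U, f i x = b := by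
    obtain ⟨b, -, hb⟩ := (Ultrafilter.eventually_exists_mem_iff (hS x)
      (P := fun b i => f i x = b)).1 ((h x).mono fun i hi => ⟨_, hi, rfl⟩)
    exact ⟨b, hb⟩
  exact Classical.skolem.1 h_ex

section
open fwdDiff

variable {ε δ : Bool} {ι : Type*} {κ : ι → Kind} {n : ι → ℕ} {o : ι → ℤ × ℤ}

theorem exists_limit_vertexLift (U : Ultrafilter ι) (hκ : ∀ i, (κ i).HasRule)
    (h_cov : ∀ z, ∀ᶠ i in U, IsCovered δ (supertile ε δ (κ i) (n i)) (z + o i)) :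
    ∃ a : ℤ × ℤ → Addr, (∀ z, flat (a z) = z + z) ∧ (∃ C, ∀ z, ‖internal (a z)‖ ≤ C) ∧
      ∀ e z, ∀ᶠ i in U,
        Δ_[e] a z = Δ_[e] (vertexLift δ (supertile ε δ (κ i) (n i))) (z + o i) := by
  obtain ⟨C, hC⟩ := exists_norm_internal_sideStart_le δ
  let b i z := vertexLift δ (supertile ε δ (κ i) (n i)) (z + o i) -
    vertexLift δ (supertile ε δ (κ i) (n i)) (0 + o i)
  have hb (z : ℤ × ℤ) :
      ∀ᶠ i in U, b i z ∈ {p | flat p = z + z ∧ ‖internal p‖ ≤ C + C} := by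
    filter_upwards [h_cov z, h_cov 0] with i h h₀
    have norm_le {z} (h : IsCovered δ (supertile ε δ (κ i) (n i)) z) :=
      hC _ (LTile.isAdmissible_of_mem_supertile (hκ i) (h.tileAt_mem 1)) 1
    refine ⟨?_, ?_⟩
    · rw [map_sub, h.flat_vertexLift, h₀.flat_vertexLift]
      abel
    · rw [map_sub]
      exact norm_sub_le_of_le (norm_le h) (norm_le h₀)
  obtain ⟨a, ha⟩ := exists_pointwise_limit U
    (fun z => finite_setOf_flat_eq_and_norm_internal_le (z + z) (C + C)) hb
  have h_mem (z : ℤ × ℤ) : a z ∈ {p | flat p = z + z ∧ ‖internal p‖ ≤ C + C} := by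
    obtain ⟨i, h, h'⟩ := ((hb z).and (ha z)).exists
    exact h' ▸ h
  refine ⟨a, fun z => (h_mem z).1, ⟨C + C, fun z => (h_mem z).2⟩, fun e z => ?_⟩
  filter_upwards [ha z, ha (z + e)] with i h h'
  rw [fwdDiff, fwdDiff, ← h, ← h', sub_sub_sub_cancel_right, add_right_comm]

theorem eq_zero_of_eventually_fallsAt_eq {u : ℤ × ℤ} {l : Filter ι} [l.NeBot]
    (hκ : ∀ i, (κ i).HasRule)
    (h_cov : ∀ z, ∀ᶠ i in l, IsCovered δ (supertile ε δ (κ i) (n i)) (z + o i))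
    (h_per : ∀ z, ∀ᶠ i in l, fallsAt δ (supertile ε δ (κ i) (n i)) (z + u + o i) =
      fallsAt δ (supertile ε δ (κ i) (n i)) (z + o i)) : u = 0 := by
  let U := Ultrafilter.of l
  have h_le : (U : Filter ι) ≤ l := Ultrafilter.of_le l
  replace h_cov (z) := (h_cov z).filter_mono h_le
  replace h_per (z) := (h_per z).filter_mono h_le
  have h_cov' (z e : ℤ × ℤ) :
      ∀ᶠ i in U, IsCovered δ (supertile ε δ (κ i) (n i)) (z + o i + e) := by
    simpa only [add_right_comm] using h_cov (z + e)
  obtain ⟨a, h_flat, h_bdd, h_diff⟩ := exists_limit_vertexLift U hκ h_cov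
  have h_leg (δ' : Bool) (z : ℤ × ℤ) : ∀ᶠ i in U, Δ_[step (mainDir δ')] a z =
      (tileAt δ (supertile ε δ (κ i) (n i)) (z + o i) (mainDir !δ')).kind.leg (mainDir δ') := by
    filter_upwards [h_diff (step (mainDir δ')) z, h_cov z, h_cov' z (step (mainDir δ'))]
      with i h h_cov h_cov'
    rw [h, h_cov.fwdDiff_vertexLift (hκ i) δ' h_cov']
  have h_side (z : ℤ × ℤ) : ∀ᶠ i in U, Δ_[step (mainDir δ)] a z =
      sideLabel δ (fallsAt δ (supertile ε δ (κ i) (n i)) (z + o i))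
        (fallsAt δ (supertile ε δ (κ i) (n i)) (z + step (mainDir (!δ) + 2) + o i)) := by
    filter_upwards [h_diff (step (mainDir δ)) z, h_cov z, h_cov' z (step (mainDir δ)),
      h_cov' z (step (mainDir (!δ) + 2))] with i h h_cov h_next h_prev
    rw [h, h_cov.fwdDiff_vertexLift_eq_sideLabel (hκ i) h_next h_prev, add_right_comm]
  refine PeriodicLift.eq_zero (δ := δ) (a := a)
    ⟨h_flat, h_bdd, fun δ' z => ?_, fun z => ?_, fun z => ?_⟩
  · obtain ⟨i, h⟩ := (h_leg δ' z).exists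
    exact h ▸ Kind.leg_mem_labels δ' _
  · obtain ⟨i, ⟨h_leg₁, h_leg₂, h_leg₃⟩, h_cov, h_next⟩ :=
      (((h_leg δ z).and ((h_leg (!δ) z).and (h_leg δ (z + step (mainDir !δ))))).and
        ((h_cov z).and (h_cov' z (step (mainDir !δ))))).exists
    rw [h_leg₁, h_leg₂, h_leg₃, Bool.not_not, add_right_comm]
    exact h_cov.leg_tileAt_eq_centreLabel_iff (hκ i) h_next
  · obtain ⟨i, h_side, h_side', h_per, h_per'⟩ := ((h_side z).and ((h_side (z + u)).and
      ((h_per z).and (h_per (z + step (mainDir (!δ) + 2)))))).exists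
    rw [h_side, h_side', h_per, add_right_comm z u, h_per']

end

/-! ### Aperiodicity -/

theorem HalfCell.eq_of_forall_add {c d : ℤ × ℤ} {k l : Fin 4} {a b : ℝ}
    (h : ∀ x y : ℝ, HalfCell c k x y → HalfCell d l (a + x) (b + y)) :
    a = d.1 - c.1 ∧ b = d.2 - c.2 ∧ l = k := by
  have h₁ := h c.1 c.2
  have h₂ := h (c.1 + 1) c.2
  have h₃ := h c.1 (c.2 + 1)
  have h₄ := h (c.1 + 1) (c.2 + 1)
  clear h
  fin_cases k <;> fin_cases l <;> simp [HalfCell] at h₁ h₂ h₃ h₄ ⊢ <;> grind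

theorem LTile.eq_of_region_eq {δ : Bool} {s t : LTile} {v w : ℂ}
    (h : (t.place w).region δ = (v + ·) '' (s.place w).region δ) :
    v = toPlane (t.cell δ - s.cell δ) ∧ t.ori δ = s.ori δ := by
  obtain ⟨h_re, h_im, h_ori⟩ := HalfCell.eq_of_forall_add (c := s.cell δ) (d := t.cell δ)
    (k := s.ori δ) (l := t.ori δ) (a := v.re) (b := v.im) fun x y hxy => by
      have h_mem : v + (w + ⟨x, y⟩) ∈ (t.place w).region δ :=
        h ▸ Set.mem_image_of_mem _ (LTile.mem_region_place_iff.2 (by simpa using hxy))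
      rw [LTile.mem_region_place_iff, add_left_comm, add_sub_cancel_left] at h_mem
      exact h_mem
  refine ⟨Complex.ext ?_ ?_, h_ori⟩
  · rw [h_re, toPlane_re, Prod.fst_sub, Int.cast_sub]
  · rw [h_im, toPlane_im, Prod.snd_sub, Int.cast_sub]

theorem norm_sub_toPlane_le {x : ℂ} {z : ℤ × ℤ} (h_left : z.1 ≤ x.re) (h_right : x.re ≤ z.1 + 1)
    (h_below : z.2 ≤ x.im) (h_above : x.im ≤ z.2 + 1) : ‖x - toPlane z‖ ≤ 2 := by
  have h := Complex.norm_le_abs_re_add_abs_im (x - toPlane z)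
  rw [Complex.sub_re, Complex.sub_im, toPlane_re, toPlane_im, abs_of_nonneg (by linarith),
    abs_of_nonneg (by linarith)] at h
  linarith

theorem norm_quarterPoint_sub_toPlane_le (z : ℤ × ℤ) (q : Fin 4) :
    ‖quarterPoint z q - toPlane z‖ ≤ 2 := by
  fin_cases q <;> apply norm_sub_toPlane_le <;> simp [quarterPoint] <;> norm_num

theorem exists_norm_sub_toPlane_le (x : ℂ) : ∃ z, ‖x - toPlane z‖ ≤ 2 :=
  ⟨(⌊x.re⌋, ⌊x.im⌋), norm_sub_toPlane_le (Int.floor_le _) (Int.lt_floor_add_one _).le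
    (Int.floor_le _) (Int.lt_floor_add_one _).le⟩

theorem LTile.norm_sub_le_of_mem_region {δ : Bool} {t : LTile} {w x : ℂ}
    (hx : x ∈ (t.place w).region δ) : ‖x - w - toPlane (t.cell δ)‖ ≤ 2 := by
  obtain ⟨h_left, h_right, h_below, h_above, -⟩ := LTile.mem_region_place_iff.1 hx
  exact norm_sub_toPlane_le h_left h_right h_below h_above

theorem finite_setOf_norm_toPlane_le (M : ℝ) : {u | ‖toPlane u‖ ≤ M}.Finite := by
  refine (isCompact_closedBall (0 : ℤ × ℤ) M).finite_of_discrete.subset fun u hu => ?_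
  rw [mem_closedBall_zero_iff, Prod.norm_def, Int.norm_eq_abs, Int.norm_eq_abs, ← toPlane_re,
    ← toPlane_im]
  exact max_le ((Complex.abs_re_le_norm _).trans hu) ((Complex.abs_im_le_norm _).trans hu)

theorem PTile.pos_mem_region (δ : Bool) (t : PTile) : t.pos ∈ t.region δ :=
  subset_convexHull ℝ _ (Set.mem_insert _ _)

section
open Metric

variable {ε δ : Bool} {T : Set PTile}

theorem IsGenerated.norm_sub_le_of_mem_region (hT : IsGenerated ε δ T) {t : PTile} (ht : t ∈ T)
    {x y : ℂ} (hx : x ∈ t.region δ) (hy : y ∈ t.region δ) : ‖x - y‖ ≤ 4 := by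
  obtain ⟨_, _, w, -, t', -, -, -, rfl, -⟩ := hT.exists_supertile ht ht
  have h := norm_sub_le_of_le (LTile.norm_sub_le_of_mem_region hx)
    (LTile.norm_sub_le_of_mem_region hy)
  rw [sub_sub_sub_cancel_right, sub_sub_sub_cancel_right] at h
  linarith

theorem IsGenerated.finite_setOf_meets_closedBall (hT : IsGenerated ε δ T) (x : ℂ) (R : ℝ) :
    {t ∈ T | (t.region δ ∩ closedBall x R).Nonempty}.Finite := by
  have norm_pos_sub_le {t : PTile} (ht : t ∈ T) (h : (t.region δ ∩ closedBall x R).Nonempty) :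
      ‖t.pos - x‖ ≤ 4 + R := by
    obtain ⟨y, hy, hyx⟩ := h
    rw [← sub_add_sub_cancel t.pos y x]
    exact norm_add_le_of_le (hT.norm_sub_le_of_mem_region ht (t.pos_mem_region δ) hy)
      (mem_closedBall_iff_norm.1 hyx)
  obtain h_empty | ⟨t₀, ht₀, h₀⟩ := Set.eq_empty_or_nonempty
    {t ∈ T | (t.region δ ∩ closedBall x R).Nonempty}
  · exact h_empty ▸ Set.finite_empty
  refine ((Set.toFinite (Set.univ : Set (Kind × Bool))).prod
    (finite_setOf_norm_toPlane_le (4 + R + (4 + R)))).image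
    (fun i => (⟨i.1.1, i.1.2, t₀.pos + toPlane i.2⟩ : PTile)) |>.subset ?_
  rintro t ⟨ht, h⟩
  obtain ⟨_, _, w, -, s₀, -, s, -, rfl, rfl⟩ := hT.exists_supertile ht₀ ht
  have h_pos : (s.place w).pos - (s₀.place w).pos = toPlane (flat s.pos - flat s₀.pos) := by
    rw [map_sub, toPlane_flat, toPlane_flat]
    exact add_sub_add_left_eq_sub _ _ _
  refine ⟨((s.kind, s.rot), flat s.pos - flat s₀.pos), ⟨trivial, ?_⟩, ?_⟩
  · rw [Set.mem_ofPred, ← h_pos, ← sub_sub_sub_cancel_right _ _ x]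
    exact norm_sub_le_of_le (norm_pos_sub_le ht h) (norm_pos_sub_le ht₀ h₀)
  · simp only [← h_pos, add_sub_cancel]
    rfl

/-- Whether the patch `P`, placed at `w`, contains all triangles of `T` that meet the disc with
centre `x` and radius `R`. -/
def ContainsNear (δ : Bool) (T : Set PTile) (P : Finset LTile) (w x : ℂ) (R : ℝ) : Prop :=
  ∀ t ∈ T, (t.region δ ∩ closedBall x R).Nonempty → ∃ s ∈ P, s.place w = t

theorem IsGenerated.exists_containsNear (hT : IsGenerated ε δ T) (x : ℂ) (R : ℝ) :
    ∃ (κ : Kind) (n : ℕ) (w : ℂ), κ.HasRule ∧ ContainsNear δ T (supertile ε δ κ n) w x R := by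
  obtain ⟨κ, n, w, hκ, h⟩ := hT.2 _ (hT.finite_setOf_meets_closedBall x R) (Set.sep_subset _ _)
  exact ⟨κ, n, w, hκ, fun t ht h' => h ⟨ht, h'⟩⟩

namespace ContainsNear
variable {P : Finset LTile} {w x : ℂ} {R : ℝ}

theorem exists_covers (h : ContainsNear δ T P w x R) (hT : IsTiling δ T) {z : ℤ × ℤ}
    (hz : ‖toPlane z - (x - w)‖ + 2 ≤ R) (q : Fin 4) :
    ∃ s ∈ P, s.Covers δ z q ∧ s.place w ∈ T := by
  obtain ⟨t, ht, h_mem⟩ := Set.mem_iUnion₂.1 (hT.1 ▸ Set.mem_univ (w + quarterPoint z q))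
  have h_ball : w + quarterPoint z q ∈ closedBall x R := by
    rw [mem_closedBall_iff_norm, show w + quarterPoint z q - x =
      toPlane z - (x - w) + (quarterPoint z q - toPlane z) by ring]
    exact (norm_add_le_of_le le_rfl (norm_quarterPoint_sub_toPlane_le z q)).trans hz
  obtain ⟨s, hs, rfl⟩ := h t ht ⟨_, h_mem, h_ball⟩
  exact ⟨s, hs, LTile.quarterPoint_mem_region_iff.1 h_mem, ht⟩

theorem isCovered (h : ContainsNear δ T P w x R) (hT : IsTiling δ T) {z : ℤ × ℤ}
    (hz : ‖toPlane z - (x - w)‖ + 2 ≤ R) : IsCovered δ P z := fun q =>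
  (h.exists_covers hT hz q).imp fun _ hs => ⟨hs.1, hs.2.1⟩

theorem exists_translate (h : ContainsNear δ T P w x R) (hT : IsTiling δ T) {v : ℂ}
    (h_per : HasPeriodIn (fun s : Set ℂ => s) (fun v s => (fun z => v + z) '' s)
      (PTile.region δ '' T) v (closedBall x R)) {z : ℤ × ℤ}
    (hz : ‖toPlane z - (x - w)‖ + 2 + ‖v‖ ≤ R) :
    ∃ s ∈ P, s.cell δ = z ∧ ∃ t ∈ P, v = toPlane (t.cell δ - z) ∧ t.ori δ = s.ori δ := by
  obtain ⟨s, hs, ⟨rfl, -⟩, hsT⟩ :=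
    h.exists_covers hT (by linarith [norm_nonneg v] : ‖toPlane z - (x - w)‖ + 2 ≤ R) 0
  have norm_le {y : ℂ} (hy : y ∈ (s.place w).region δ) :
      ‖y - x‖ ≤ ‖toPlane (s.cell δ) - (x - w)‖ + 2 := by
    rw [show y - x = toPlane (s.cell δ) - (x - w) + (y - w - toPlane (s.cell δ)) by ring]
    exact norm_add_le_of_le le_rfl (LTile.norm_sub_le_of_mem_region hy)
  have h_region : (s.place w).region δ ⊆ closedBall x R := fun y hy => by
    rw [mem_closedBall_iff_norm]
    linarith [norm_le hy, norm_nonneg v]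
  have h_shifted : (v + ·) '' (s.place w).region δ ⊆ closedBall x R := by
    rintro _ ⟨y, hy, rfl⟩
    rw [mem_closedBall_iff_norm, add_sub_assoc]
    linarith [norm_le hy, norm_add_le v (y - x)]
  obtain ⟨t, ht, h_eq⟩ := (h_per _ h_region h_shifted).1 (Set.mem_image_of_mem _ hsT)
  obtain ⟨t', ht', rfl⟩ := h t ht
    ⟨t.pos, t.pos_mem_region δ, h_shifted (h_eq.subset (t.pos_mem_region δ))⟩
  obtain ⟨hv, h_ori⟩ := LTile.eq_of_region_eq h_eq
  exact ⟨s, hs, rfl, t', ht', hv, h_ori⟩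

end ContainsNear

theorem IsAperiodic.of_local {α : Type} {region : α → Set ℂ} {shift : ℂ → α → α} {T : Set α}
    (h : ∀ v : ℂ, v ≠ 0 → ∃ R : ℝ, ∀ x : ℂ, ¬ HasPeriodIn region shift T v (closedBall x R)) :
    IsAperiodic region shift T := by
  refine ⟨fun v hv h_per => ?_, h⟩
  obtain ⟨R, hR⟩ := h v hv
  exact hR 0 fun t _ _ => h_per t (Set.subset_univ _) (Set.subset_univ _)

theorem IsGenerated.isAperiodic_region (hT : IsGenerated ε δ T) :
    IsAperiodic (fun s : Set ℂ => s) (fun v s => (fun z => v + z) '' s) (PTile.region δ '' T) := by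
  refine .of_local fun v hv => ?_
  by_contra! h_per
  choose x h_per using fun N : ℕ => h_per N
  choose κ n w hκ h_near using fun N : ℕ => hT.exists_containsNear (x N) N
  choose o ho using fun N => exists_norm_sub_toPlane_le (x N - w N)
  have h_large (z : ℤ × ℤ) :
      ∀ᶠ N : ℕ in atTop, ‖toPlane (z + o N) - (x N - w N)‖ + 2 + ‖v‖ ≤ N := by
    filter_upwards [tendsto_natCast_atTop_atTop.eventually_ge_atTop (‖toPlane z‖ + 2 + 2 + ‖v‖)]
      with N hN
    rw [map_add, add_sub_assoc]
    linarith [norm_add_le_of_le (le_refl ‖toPlane z‖) ((norm_sub_rev _ _).trans_le (ho N))]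
  have h_cov (z : ℤ × ℤ) :
      ∀ᶠ N in atTop, IsCovered δ (supertile ε δ (κ N) (n N)) (z + o N) :=
    (h_large z).mono fun N hN => (h_near N).isCovered hT.1 (by linarith [norm_nonneg v])
  obtain ⟨u, rfl⟩ : ∃ u, v = toPlane u := by
    obtain ⟨N, hN⟩ := (h_large 0).exists
    obtain ⟨_, _, _, _, _, hv, _⟩ := (h_near N).exists_translate hT.1 (h_per N) hN
    exact ⟨_, hv⟩
  refine hv (eq_zero_of_eventually_fallsAt_eq hκ h_cov (u := u) (fun z => ?_) ▸ map_zero toPlane)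
  filter_upwards [h_large z, h_cov z, h_cov (z + u)] with N hN h_cov h_cov'
  obtain ⟨s, hs, h_cell, t, ht, hu, h_ori⟩ := (h_near N).exists_translate hT.1 (h_per N) hN
  have h_cell' : t.cell δ = z + u + o N := by
    rw [add_toPlane_injective 0 (congrArg (0 + ·) hu), add_right_comm, add_sub_cancel]
  rw [← h_cell', ← h_cell, ← IsCovered.isFalling_eq_fallsAt (hκ N) ht (h_cell' ▸ h_cov'),
    ← IsCovered.isFalling_eq_fallsAt (hκ N) hs (h_cell ▸ h_cov), h_ori]

theorem PTile.region_shift (δ : Bool) (v : ℂ) (t : PTile) :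
    (t.shift v).region δ = (fun z => v + z) '' t.region δ := by
  have h_corners : (t.shift v).corners δ = (fun z => v + z) '' t.corners δ := by
    obtain ⟨κ, r, p⟩ := t
    cases κ <;> simp only [PTile.corners, PTile.shift, Set.image_insert_eq, Set.image_singleton,
      add_assoc] <;> rfl
  rw [PTile.region, PTile.region, h_corners]
  exact ((AffineEquiv.constVAdd ℝ ℂ v).toAffineMap.image_convexHull _).symm

theorem IsGenerated.isAperiodic (hT : IsGenerated ε δ T) :
    IsAperiodic (PTile.region δ) PTile.shift T := by
  refine .of_local fun v hv => ?_
  obtain ⟨R, hR⟩ := hT.isAperiodic_region.2 v hv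
  refine ⟨R, fun x h_per => hR x fun s hs hs' => ⟨?_, ?_⟩⟩
  · rintro ⟨t, ht, rfl⟩
    exact ⟨_, (h_per t hs (by rwa [t.region_shift])).1 ht, t.region_shift δ v⟩
  · rintro ⟨t, ht, h_eq⟩
    obtain ⟨t, rfl⟩ : ∃ t', t'.shift v = t := ⟨t.shift (-v), by simp [PTile.shift]⟩
    obtain rfl : t.region δ = s :=
      (add_right_injective v).image_injective ((t.region_shift δ v).symm.trans h_eq)
    exact Set.mem_image_of_mem _ ((h_per t hs (h_eq.subset.trans hs')).2 ht)

end

end OneTriangle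

open OneTriangle in
theorem mainTheorem1 (ε δ : Bool) :
    -- there are 17 pairs of rules, each rule being the mirror image of the other one of its pair
    ((Finset.univ.filter Kind.HasRule).card = 34 ∧
      ∀ κ : Kind, κ.HasRule →
        (∀ t ∈ rule ε δ κ, t.kind.HasRule) ∧
        (mirror δ ⟨κ, false, 0⟩).kind.HasRule ∧
        (mirror δ ⟨κ, false, 0⟩).kind ≠ κ ∧
        mirror δ (mirror δ ⟨κ, false, 0⟩) = ⟨κ, false, 0⟩ ∧
        subst ε δ (mirror δ ⟨κ, false, 0⟩) = (subst ε δ ⟨κ, false, 0⟩).image (mirror δ)) ∧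
    -- the rules do not overlap
    (∀ κ : Kind, κ.HasRule → ∀ n : ℕ,
      (supertile ε δ κ n : Set LTile).PairwiseDisjoint (subst ε δ) ∧
      (supertile ε δ κ n : Set LTile).Pairwise fun s t =>
        Disjoint (interior ((s.place 0).region δ)) (interior ((t.place 0).region δ))) ∧
    -- they generate a tiling of the plane
    (∃ T : Set PTile, IsGenerated ε δ T) ∧
    -- which consists of copies of one isosceles right triangle in four orientations, is
    -- edge-to-edge, and is aperiodic, with the marks and without them
    ∀ T : Set PTile, IsGenerated ε δ T →
      (∀ t ∈ T, ∃ (v : ℂ) (k : ℕ),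
        t.region δ = convexHull ℝ {v, v + Complex.I ^ k, v + Complex.I ^ (k + 1)}) ∧
      IsEdgeToEdge δ T ∧
      IsAperiodic (PTile.region δ) PTile.shift T ∧
      IsAperiodic (fun s : Set ℂ => s) (fun v s => (fun z => v + z) '' s) (PTile.region δ '' T) := by
  refine ⟨⟨card_filter_hasRule, fun κ hκ => ?_⟩,
    fun κ hκ n => ⟨pairwiseDisjoint_subst_supertile hκ,
      pairwise_disjoint_interior_supertile hκ n 0⟩,
    ⟨_, isGenerated_limitTiling ε δ⟩,
    fun T hT => ⟨hT.exists_shape, hT.isEdgeToEdge, hT.isAperiodic, hT.isAperiodic_region⟩⟩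
  obtain ⟨h_rule, h_ne, h_mirror⟩ := mirror_mirror_and_hasRule δ κ hκ
  exact ⟨hasRule_of_mem_rule ε δ κ hκ, h_rule, h_ne, h_mirror, subst_mirror ε δ κ hκ⟩
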